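/- Let $X=(Z,U)$ be a random vector with $Z\in\mathbb R^l$, let $D\in\{0,1\}$ be a treatment, $Y(0),Y(1)$ real potential outcomes, and $Y=DY(1)+(1-D)Y(0)$. Let $(X_i,D_i,Y_i)$, $i\ge 1$, be i.i.d. copies of $(X,D,Y)$. Let $\tilde X\in\mathbb R^{\tilde k}$ be a subvector of coordinates of $X$ with $D\perp X\mid\tilde X$. Put $p(\tilde x)=P(D=1\mid\tilde X=\tilde x)$, $m_j(\tilde x)=E[Y(j)\mid\tilde X=\tilde x]$, $\tau(z)=E[Y(1)-Y(0)\mid Z=z]$, and $$\psi=\frac{DY}{p(\tilde X)}-\frac{(1-D)Y}{1-p(\tilde X)},\qquad \psi^*=\frac{D\{Y-m_1(\tilde X)\}}{p(\tilde X)}-\frac{(1-D)\{Y-m_0(\tilde X)\}}{1-p(\tilde X)}+m_1(\tilde X)-m_0(\tilde X),$$ $\sigma_N^2(z)=E[(\psi-\tau(z))^2\mid Z=z]$, $\sigma_N^{*2}(z)=E[(\psi^*-\tau(z))^2\mid Z=z]$, $\Sigma_N(z)=\|K\|_2^2\,\sigma_N^2(z)/f_Z(z)$, $\Sigma_N^*(z)=\|K\|_2^2\,\sigma_N^{*2}(z)/f_Z(z)$,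 where $\|K\|_2^2=\int K^2$ and $f_Z$ is the density of $Z$. *Assumptions.* (1) $(Y(0),Y(1))\perp D\mid X$, and $c<p<1-c$ for some $c>0$; $p$ is continuous on the support of $\tilde X$. (2) The support of $X$ is a product of compact intervals; the densities of $X$ and of $Z$ are bounded away from zero and infinity and $s$ times continuously differentiable on the supports. (3) $E[Y(j)^2\mid X]$ is bounded, and $m_j$ is $s$ times continuously differentiable on the support of $\tilde X$, $j=0,1$. (4) $K:\mathbb R^l\to\mathbb R$ is a symmetric ($K(-u)=K(u)$), square-integrable, $s$ times continuously differentiable kernel of order $s$; $\mathcal L:\mathbb R^{\tilde k}\to\mathbb R$ is a symmetric, continuously differentiable kernel of order $s_1$ that vanishes outside $[-1,1]^{\tilde k}$, and $\int_{\prod_i[a_i,b_i]}\mathcal L>0$ whenever, for each $i$, either $a_i=-1$ and $0\le b_i\le1$, or $b_i=1$ and $-1\le a_i\le0$. Here a kernel of order $s$ has integral one, vanishing moments of all degrees $1,\dots,s-1$, integrable monomial moments up to degree $s$, and some non-zero moment of degree $s$. (5) The bandwidths $h=h_n>0$ and $h_1=h_{1,n}>0$ satisfy $h\to0$, $nh^l\to\infty$,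 $nh^{2s+l}\to0$, $h_1\to0$, $\log n/(nh_1^{\tilde k+s_1})\to0$, $h_1^{2s_1}h^{-2s_1-l}\to0$, $nh^lh_1^{2s_1}\to0$. *Estimators.* With $K_i=K((Z_i-z)/h)$ and $\mathcal L_{h_1}(u)=h_1^{-\tilde k}\mathcal L(u/h_1)$, let $$\hat f(z)=\frac1{nh^l}\sum_{i=1}^nK_i,\quad \hat p(\tilde X_i)=\frac{\sum_{j\ne i}D_j\mathcal L_{h_1}(\tilde X_j-\tilde X_i)}{\sum_{j\ne i}\mathcal L_{h_1}(\tilde X_j-\tilde X_i)},\quad \hat m_d(x)=\frac{\sum_{t:D_t=d}\mathcal L_{h_1}(\tilde X_t-x)Y_t}{\sum_{t:D_t=d}\mathcal L_{h_1}(\tilde X_t-x)},$$ let $\hat\psi_i$ and $\hat\psi_i^*$ be $\psi$ and $\psi^*$ at observation $i$ with $p,m_0,m_1$ replaced by $\hat p,\hat m_0,\hat m_1$, and let $\hat\tau_N(z)=\sum_i\hat\psi_iK_i/\sum_iK_i$, $$\hat\sigma_N^2(z)=\frac1{nh^l}\sum_{i=1}^n\frac{(\hat\psi_i-\hat\tau_N(z))^2K_i}{\hat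 f(z)},\quad \hat\sigma_N^{*2}(z)=\frac1{nh^l}\sum_{i=1}^n\frac{(\hat\psi^*_i-\hat\tau_N(z))^2K_i}{\hat f(z)},$$ $\hat\Sigma_N(z)=\|K\|_2^2\hat\sigma_N^2(z)/\hat f(z)$ and $\hat\Sigma^*_N(z)=\|K\|_2^2\hat\sigma_N^{*2}(z)/\hat f(z)$. **Theorem.** For almost every $z$ in the support of $Z$, $$\hat\Sigma_N(z)=\Sigma_N(z)+o_p(1)\quad\text{and}\quad \hat\Sigma_N^*(z)=\Sigma_N^*(z)+o_p(1)\qquad(n\to\infty).$$ Moreover, for any choice of versions of $\tau$, $\sigma_N^2$ and $\sigma_N^{*2}$, both relations hold at every point $z$ in the interior of the support of $Z$ at which these three functions are continuous and near which $Y(0)^2$ and $Y(1)^2$ are uniformly integrable given $Z$ (for every $\varepsilon>0$ there are $M$ and $r>0$ such that, almost surely on $\{\|Z-z\|<r\}$, $E[Y(j)^21\{|Y(j)|>M\}\mid Z]\le\varepsilon$ for $j=0,1$). -/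

import Mathlib

open MeasureTheory ProbabilityTheory Filter Topology Set

namespace IPW

noncomputable section

/-! ## Subjects, observations, and coordinate blocks -/

/-- The covariate vector `X = (Z, U)`, with `Z` of dimension `l` and `U` of dimension `q`. -/
abbrev Cov (l q : ℕ) : Type := Fin (l + q) → ℝ

/-- A full subject `(X, D, Y(0), Y(1))`; the treatment `D` is binary. -/
abbrev Subject (l q : ℕ) : Type := Cov l q × Bool × ℝ × ℝ

/-- What is observed of a subject: `(X, D, Y)`. -/
abbrev Obs (l q : ℕ) : Type := Cov l q × Bool × ℝ

/-- The first `l` coordinates `Z` of `X`. -/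
def zPart {l q : ℕ} (x : Cov l q) : Fin l → ℝ := fun i => x (Fin.castAdd q i)

/-- The subvector of `X` consisting of the coordinates in `S`. -/
def subPart {l q : ℕ} (S : Finset (Fin (l + q))) (x : Cov l q) : S → ℝ := fun i => x i

/-- The covariates of a subject. -/
def covX {l q : ℕ} (w : Subject l q) : Cov l q := w.1

/-- The component `Z` of a subject. -/
def covZ {l q : ℕ} (w : Subject l q) : Fin l → ℝ := zPart w.1

/-- The component `X̃` of a subject. -/
def covS {l q : ℕ} (S : Finset (Fin (l + q))) (w : Subject l q) : S → ℝ := subPart S w.1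

/-- The treatment of a subject. -/
def treat {l q : ℕ} (w : Subject l q) : Bool := w.2.1

/-- The potential outcome `Y(j)`, where `false` and `true` stand for `0` and `1`. -/
def potential {l q : ℕ} (j : Bool) (w : Subject l q) : ℝ := bif j then w.2.2.2 else w.2.2.1

/-- The observed outcome `Y = D Y(1) + (1 - D) Y(0)`. -/
def outcome {l q : ℕ} (w : Subject l q) : ℝ := potential (treat w) w

/-- The observed part `(X, D, Y)` of a subject. -/
def observe {l q : ℕ} (w : Subject l q) : Obs l q := (covX w, treat w, outcome w)

/-- The number `1` or `0` attached to a treatment status. -/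
def dnum (d : Bool) : ℝ := bif d then 1 else 0

/-! ## Conditional expectations given a random vector, as functions of its value -/

/-- `g` is a version of `t ↦ E[φ | T = t]`. -/
def IsCondMean {Ω E : Type*} [MeasurableSpace Ω] [mE : MeasurableSpace E]
    (P : Measure Ω) (φ : Ω → ℝ) (T : Ω → E) (g : E → ℝ) : Prop :=
  Measurable g ∧ Integrable φ P ∧ P[φ | mE.comap T] =ᵐ[P] fun ω => g (T ω)

/-! ## The functions `ψ` and `ψ*` -/

/-- `D Y / p - (1 - D) Y / (1 - p)`. -/
def psi (p : ℝ) (d : Bool) (y : ℝ) : ℝ :=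
  dnum d * y / p - (1 - dnum d) * y / (1 - p)

/-- `D (Y - m₁) / p - (1 - D) (Y - m₀) / (1 - p) + m₁ - m₀`. -/
def psiStar (p m₀ m₁ : ℝ) (d : Bool) (y : ℝ) : ℝ :=
  dnum d * (y - m₁) / p - (1 - dnum d) * (y - m₀) / (1 - p) + m₁ - m₀

/-! ## Kernels -/

/-- A kernel of order `s`: it has integrable monomial moments up to degree `s`, integrates to one,
its moments of degrees `1, …, s - 1` vanish, and not all moments of degree `s` vanish. -/
def IsKernelOfOrder {ι : Type*} [Fintype ι] (s : ℕ) (g : (ι → ℝ) → ℝ) : Prop :=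
  (∀ e : ι → ℕ, ∑ i, e i ≤ s → Integrable (fun u : ι → ℝ => (∏ i, u i ^ e i) * g u)) ∧
  ∫ u, g u = 1 ∧
  (∀ e : ι → ℕ, 1 ≤ ∑ i, e i → ∑ i, e i < s → ∫ u : ι → ℝ, (∏ i, u i ^ e i) * g u = 0) ∧
  ∃ e : ι → ℕ, ∑ i, e i = s ∧ ∫ u : ι → ℝ, (∏ i, u i ^ e i) * g u ≠ 0

/-- The kernel has positive mass on the part of `[-1, 1]^ι` that is left when it is cut, in each
coordinate, on at most one side, by a half-line that contains `0`. This is the part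
of the kernel seen from a point near the boundary of a box. -/
def PosTruncatedMass {ι : Type*} [Fintype ι] (g : (ι → ℝ) → ℝ) : Prop :=
  ∀ a b : ι → ℝ,
    (∀ i, (a i = -1 ∧ 0 ≤ b i ∧ b i ≤ 1) ∨ (b i = 1 ∧ -1 ≤ a i ∧ a i ≤ 0)) →
    0 < ∫ u in Icc a b, g u

/-- Conditions on the kernel `𝓛` used to estimate the propensity score. -/
structure PropensityKernel {ι : Type*} [Fintype ι] (s₁ : ℕ) (L : (ι → ℝ) → ℝ) : Prop where
  order : IsKernelOfOrder s₁ L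
  symm : ∀ u, L (-u) = L u
  support : ∀ u, u ∉ Icc (fun _ => (-1 : ℝ)) (fun _ => 1) → L u = 0
  smooth : ContDiff ℝ 1 L
  truncated : PosTruncatedMass L

/-- Conditions on the kernel `K` used for smoothing over `Z`. -/
structure SmoothingKernel {ι : Type*} [Fintype ι] (s : ℕ) (K : (ι → ℝ) → ℝ) : Prop where
  order : IsKernelOfOrder s K
  symm : ∀ u, K (-u) = K u
  smooth : ContDiff ℝ s K
  sq_integrable : Integrable fun u => K u ^ 2

/-- Conditions on the bandwidths `h` and `h₁`, for `dim Z = l` and `dim X̃ = kt`. -/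
structure Bandwidths (l kt s s₁ : ℕ) (h h₁ : ℕ → ℝ) : Prop where
  h_pos : ∀ n, 0 < h n
  h₁_pos : ∀ n, 0 < h₁ n
  h_zero : Tendsto h atTop (𝓝 0)
  nh_top : Tendsto (fun n : ℕ => n * h n ^ l) atTop atTop
  nh_zero : Tendsto (fun n : ℕ => n * h n ^ (2 * s + l)) atTop (𝓝 0)
  h₁_zero : Tendsto h₁ atTop (𝓝 0)
  log_zero : Tendsto (fun n : ℕ => Real.log n / (n * h₁ n ^ (kt + s₁))) atTop (𝓝 0)
  ratio_zero : Tendsto (fun n => h₁ n ^ (2 * s₁) / h n ^ (2 * s₁ + l)) atTop (𝓝 0)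
  bias_zero : Tendsto (fun n : ℕ => n * h n ^ l * h₁ n ^ (2 * s₁)) atTop (𝓝 0)

/-! ## The population -/

/-- The vector `T` has a density `f` on the box `[a, b]`, bounded away from zero and infinity and
`s` times continuously differentiable there, and no mass outside. -/
structure HasBoxDensity {Ω ι : Type*} [MeasurableSpace Ω] [Fintype ι] (P : Measure Ω)
    (T : Ω → ι → ℝ) (a b : ι → ℝ) (s : ℕ) (f : (ι → ℝ) → ℝ) : Prop where
  law : P.map T = (volume.restrict (Icc a b)).withDensity fun t => ENNReal.ofReal (f t)
  bounds : ∃ c C : ℝ, 0 < c ∧ ∀ t ∈ Icc a b, c ≤ f t ∧ f t ≤ C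
  smooth : ContDiffOn ℝ s f (Icc a b)

/-- The assumptions on the law `P` of `(X, D, Y(0), Y(1))`. Here `[a, b]` is the support of `X`,
`fX` and `fZ` are the densities of `X` and `Z`, `S` is the set of coordinates of `X` that make up
`X̃`, `p` is the propensity score as a function of `X̃`, and `m j` is `x ↦ E[Y(j) | X̃ = x]`. -/
structure Population {l q : ℕ} (P : Measure (Subject l q)) [IsProbabilityMeasure P]
    (a b : Cov l q) (s : ℕ) (fX : Cov l q → ℝ) (fZ : (Fin l → ℝ) → ℝ)
    (S : Finset (Fin (l + q))) (p : (S → ℝ) → ℝ) (m : Bool → (S → ℝ) → ℝ) : Prop where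
  box : ∀ i, a i < b i
  density_X : HasBoxDensity P covX a b s fX
  density_Z : HasBoxDensity P covZ (zPart a) (zPart b) s fZ
  /-- `(Y(0), Y(1)) ⊥ D | X`. -/
  unconfounded : CondIndepFun (MeasurableSpace.comap covX inferInstance)
    (Measurable.comap_le (by unfold covX; fun_prop))
    (fun w : Subject l q => (potential false w, potential true w)) treat P
  /-- `D ⊥ X | X̃`. -/
  sufficient : CondIndepFun (MeasurableSpace.comap (covS S) inferInstance)
    (Measurable.comap_le (by unfold covS subPart; fun_prop)) treat covX P
  /-- `p(x) = P(D = 1 | X̃ = x)`. -/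
  propensity : IsCondMean P (fun w => dnum (treat w)) (covS S) p
  overlap : ∃ c : ℝ, 0 < c ∧ ∀ x ∈ Icc (subPart S a) (subPart S b), c < p x ∧ p x < 1 - c
  propensity_cont : ContinuousOn p (Icc (subPart S a) (subPart S b))
  /-- `E[Y(j)² | X]` is finite and bounded. -/
  sq_integrable : ∀ j, Integrable (fun w => potential j w ^ 2) P
  sq_bounded : ∃ C : ℝ, ∀ j,
    ∀ᵐ w ∂P, (P[fun w => potential j w ^ 2 | MeasurableSpace.comap covX inferInstance]) w ≤ C
  regression : ∀ j, IsCondMean P (potential j) (covS S) (m j)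
  regression_smooth : ∀ j, ContDiffOn ℝ s (m j) (Icc (subPart S a) (subPart S b))

/-- `τ(z) = E[Y(1) - Y(0) | Z = z]`. -/
def IsCATE {l q : ℕ} (P : Measure (Subject l q)) (τ : (Fin l → ℝ) → ℝ) : Prop :=
  IsCondMean P (fun w => potential true w - potential false w) covZ τ

/-- `σ²(z) = E[(ψ(p(X̃), W) - τ(z))² | Z = z]`. -/
def IsSigmaSq {l q : ℕ} (P : Measure (Subject l q)) (S : Finset (Fin (l + q)))
    (p : (S → ℝ) → ℝ) (τ σ2 : (Fin l → ℝ) → ℝ) : Prop :=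
  IsCondMean P (fun w => (psi (p (covS S w)) (treat w) (outcome w) - τ (covZ w)) ^ 2) covZ σ2

/-- `σ*²(z) = E[(ψ*(p(X̃), W) - τ(z))² | Z = z]`. -/
def IsSigmaStarSq {l q : ℕ} (P : Measure (Subject l q)) (S : Finset (Fin (l + q)))
    (p : (S → ℝ) → ℝ) (m : Bool → (S → ℝ) → ℝ) (τ σ2 : (Fin l → ℝ) → ℝ) : Prop :=
  IsCondMean P (fun w => (psiStar (p (covS S w)) (m false (covS S w)) (m true (covS S w))
    (treat w) (outcome w) - τ (covZ w)) ^ 2) covZ σ2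

/-- The squares of the potential outcomes are uniformly integrable under the conditional laws
given `Z = z'`, for `z'` near `z`. -/
def LocallyUniformlySqIntegrable {l q : ℕ} (P : Measure (Subject l q)) (z : Fin l → ℝ) : Prop :=
  ∀ j : Bool, ∀ ε : ℝ, 0 < ε → ∃ M r : ℝ, 0 < r ∧ ∀ᵐ w ∂P, covZ w ∈ Metric.ball z r →
    (P[{w | M < |potential j w|}.indicator (fun w => potential j w ^ 2) |
      MeasurableSpace.comap covZ inferInstance]) w ≤ ε

/-! ## The estimators, computed from a data set `w₁, …, wₙ` -/

section Estimators

variable {l q n : ℕ}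

/-- `K_i = K((Z_i - z) / h)`. -/
def kerWeight (K : (Fin l → ℝ) → ℝ) (h : ℝ) (z : Fin l → ℝ) (o : Obs l q) : ℝ :=
  K (h⁻¹ • (zPart o.1 - z))

/-- `f̂(z) = n⁻¹ ∑ᵢ h⁻ˡ K((Zᵢ - z) / h)`. -/
def fHat (K : (Fin l → ℝ) → ℝ) (h : ℝ) (z : Fin l → ℝ) (w : Fin n → Obs l q) : ℝ :=
  (∑ i, (h ^ l)⁻¹ * kerWeight K h z (w i)) / n

/-- The scaled kernel `𝓛_{h₁}(u) = h₁^{-k̃} 𝓛(u / h₁)`. -/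
def scaledL {S : Finset (Fin (l + q))} (L : (S → ℝ) → ℝ) (h₁ : ℝ) (u : S → ℝ) : ℝ :=
  (h₁ ^ S.card)⁻¹ * L (h₁⁻¹ • u)

/-- The leave-one-out estimator `p̂(X̃ᵢ)` of the propensity score. -/
def pHat {S : Finset (Fin (l + q))} (L : (S → ℝ) → ℝ) (h₁ : ℝ) (w : Fin n → Obs l q)
    (i : Fin n) : ℝ :=
  (∑ j ∈ Finset.univ.erase i,
      dnum (w j).2.1 * scaledL L h₁ (subPart S (w j).1 - subPart S (w i).1)) /
    ∑ j ∈ Finset.univ.erase i, scaledL L h₁ (subPart S (w j).1 - subPart S (w i).1)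

/-- The estimator `m̂_d(x)` of `E[Y(d) | X̃ = x]`, from the subjects with treatment `d`. -/
def mHat {S : Finset (Fin (l + q))} (L : (S → ℝ) → ℝ) (h₁ : ℝ) (w : Fin n → Obs l q)
    (d : Bool) (x : S → ℝ) : ℝ :=
  (∑ t ∈ Finset.univ.filter (fun t => (w t).2.1 = d),
      scaledL L h₁ (subPart S (w t).1 - x) * (w t).2.2) /
    ∑ t ∈ Finset.univ.filter (fun t => (w t).2.1 = d), scaledL L h₁ (subPart S (w t).1 - x)

/-- `ψ(p̂, Wᵢ)`. -/
def psiHat {S : Finset (Fin (l + q))} (L : (S → ℝ) → ℝ) (h₁ : ℝ) (w : Fin n → Obs l q)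
    (i : Fin n) : ℝ :=
  psi (pHat L h₁ w i) (w i).2.1 (w i).2.2

/-- `ψ*(p̂, Wᵢ)`. -/
def psiStarHat {S : Finset (Fin (l + q))} (L : (S → ℝ) → ℝ) (h₁ : ℝ) (w : Fin n → Obs l q)
    (i : Fin n) : ℝ :=
  psiStar (pHat L h₁ w i) (mHat L h₁ w false (subPart S (w i).1))
    (mHat L h₁ w true (subPart S (w i).1)) (w i).2.1 (w i).2.2

/-- The estimator `τ̂(z)` with nonparametrically estimated propensity score. -/
def tauHat {S : Finset (Fin (l + q))} (K : (Fin l → ℝ) → ℝ) (L : (S → ℝ) → ℝ) (h h₁ : ℝ)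
    (z : Fin l → ℝ) (w : Fin n → Obs l q) : ℝ :=
  (∑ i, psiHat L h₁ w i * ((h ^ l)⁻¹ * kerWeight K h z (w i))) /
    ∑ i, (h ^ l)⁻¹ * kerWeight K h z (w i)

/-- `σ̂²(z)`. -/
def sigmaSqHat {S : Finset (Fin (l + q))} (K : (Fin l → ℝ) → ℝ) (L : (S → ℝ) → ℝ) (h h₁ : ℝ)
    (z : Fin l → ℝ) (w : Fin n → Obs l q) : ℝ :=
  1 / (n * h ^ l) *
    ∑ i, (psiHat L h₁ w i - tauHat K L h h₁ z w) ^ 2 * kerWeight K h z (w i) / fHat K h z w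

/-- `σ̂*²(z)`. -/
def sigmaStarSqHat {S : Finset (Fin (l + q))} (K : (Fin l → ℝ) → ℝ) (L : (S → ℝ) → ℝ)
    (h h₁ : ℝ) (z : Fin l → ℝ) (w : Fin n → Obs l q) : ℝ :=
  1 / (n * h ^ l) *
    ∑ i, (psiStarHat L h₁ w i - tauHat K L h h₁ z w) ^ 2 * kerWeight K h z (w i) / fHat K h z w

/-- `‖K‖₂² = ∫ K²`. -/
def kerNormSq (K : (Fin l → ℝ) → ℝ) : ℝ := ∫ u, K u ^ 2

/-- `Σ̂(z) = ‖K‖₂² σ̂²(z) / f̂(z)`. -/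
def SigmaHat {S : Finset (Fin (l + q))} (K : (Fin l → ℝ) → ℝ) (L : (S → ℝ) → ℝ) (h h₁ : ℝ)
    (z : Fin l → ℝ) (w : Fin n → Obs l q) : ℝ :=
  kerNormSq K * sigmaSqHat K L h h₁ z w / fHat K h z w

/-- `Σ̂*(z) = ‖K‖₂² σ̂*²(z) / f̂(z)`. -/
def SigmaStarHat {S : Finset (Fin (l + q))} (K : (Fin l → ℝ) → ℝ) (L : (S → ℝ) → ℝ) (h h₁ : ℝ)
    (z : Fin l → ℝ) (w : Fin n → Obs l q) : ℝ :=
  kerNormSq K * sigmaStarSqHat K L h h₁ z w / fHat K h z w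

/-- `Σ(z) = ‖K‖₂² σ²(z) / f(z)`, and likewise `Σ*(z)` from `σ*²(z)`. -/
def asymVar (K : (Fin l → ℝ) → ℝ) (fZ σ2 : (Fin l → ℝ) → ℝ) (z : Fin l → ℝ) : ℝ :=
  kerNormSq K * σ2 z / fZ z

end Estimators

/-- The observations `w 0, w 1, …` are i.i.d. copies of the observed part of a subject. -/
structure IsSample {l q : ℕ} {Ω : Type*} [MeasurableSpace Ω] (μ : Measure Ω)
    (P : Measure (Subject l q)) (w : ℕ → Ω → Obs l q) : Prop where
  measurable : ∀ i, Measurable (w i)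
  indep : iIndepFun w μ
  law : ∀ i, μ.map (w i) = P.map observe

/-- Both variance estimators at `z`, computed from the first `n` observations with the bandwidths
`h n` and `h₁ n`, converge in probability to their targets. -/
def VarianceConsistentAt {l q : ℕ} {Ω : Type*} [MeasurableSpace Ω] (μ : Measure Ω)
    (w : ℕ → Ω → Obs l q) {S : Finset (Fin (l + q))} (K : (Fin l → ℝ) → ℝ) (L : (S → ℝ) → ℝ)
    (h h₁ : ℕ → ℝ) (fZ σ2 σs2 : (Fin l → ℝ) → ℝ) (z : Fin l → ℝ) : Prop :=
  TendstoInMeasure μ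
    (fun (n : ℕ) ω => SigmaHat K L (h n) (h₁ n) z (fun i : Fin n => w i ω)) atTop
    (fun _ => asymVar K fZ σ2 z) ∧
  TendstoInMeasure μ
    (fun (n : ℕ) ω => SigmaStarHat K L (h n) (h₁ n) z (fun i : Fin n => w i ω)) atTop
    (fun _ => asymVar K fZ σs2 z)

end

end IPW

/-! Expanding the square writes either variance estimator as a continuous function of kernel
averages `n⁻¹ ∑ K_h(Z_i - z) T_i`, where `T_i` is `1`, an estimated score or its square
(`weighted_deviation_eq`). If these averages converge in probability to `f_Z(z) E[T | Z = z]`, the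
theorem follows by continuous mapping, because `f_Z(z) ≠ 0` (`convProb_variance`).

Limits with the true nuisance functions. Inverse probability weighting gives the score conditional
mean `τ` for any bounded regression functions `g`, since the added `g₁ - g₀` cancels what the
residuals subtract (`Population.integral_score_mul`). Hence `ψ` (`g = 0`) and `ψ*` (`g = m`) are one
case, with conditional second moment `σ² + τ²` (`Population.integral_score_sq_mul`). A squared score
grows like `Y²`, and only second moments of `Y` are available, so `convProb_kernel_average` is a
weak law by truncation of `Y`. The truncated part has variance of order `1 / (n h^l)`. The rest is
small in mean when large outcomes carry little second moment near `z` (`TailSmall`). The mean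
converges at Lebesgue points of `f_Z(x) E[T | Z = x]`. Almost every point qualifies, by Lebesgue
differentiation and `ae_small_density`. A given interior point qualifies by continuity and uniform
integrability.

Replacing the nuisance functions by estimators. Bernstein's inequality and a union bound control the
kernel sums of both arms at all sample points at once
(`ObservedLaw.tendsto_measure_not_concentrated`), which makes `p̂` uniformly close to `p`. Near the
boundary the kernel loses mass, but both arms lose the same proportion and it cancels in the ratio;
all that is needed is that the remaining mass stays away from zero
(`ObservedLaw.exists_le_smoothedDensity`). Two moments of `Y` give no exponential bound for `m̂`, so
its error is controlled only in mean square, weighted by `|K_h(Z_i - z)|`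
(`ObservedLaw.eventually_lintegral_residual_le`). Together these make the weighted mean squared
error of both estimated scores vanish (`ObservedLaw.convProb_weighted_score_error`). That suffices:
a change of the score or of its square is at most `η (1 + Y²)` plus a constant depending on `η`
times the squared error, and the weighted average of `1 + Y²` is tight
(`ObservedLaw.convProb_plugIn`).

All of this takes place under product measures; `ConvProb.tendstoInMeasure` carries the result to an
arbitrary sample. -/

namespace IPW

/-! ### Convergence in probability under product measures. -/

/-- Convergence in probability of statistics of `n` independent draws from `Q`, as `n → ∞`. -/
def ConvProb {α E : Type*} [MeasurableSpace α] [PseudoMetricSpace E] (Q : Measure α)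
    (F : ∀ n : ℕ, (Fin n → α) → E) (c : E) : Prop :=
  ∀ ε : ℝ, 0 < ε →
    Tendsto (fun n : ℕ => Measure.pi (fun _ : Fin n => Q) {v | ε ≤ dist (F n v) c}) atTop (𝓝 0)

section ConvProb

variable {α E E' : Type*} [MeasurableSpace α] [PseudoMetricSpace E] [PseudoMetricSpace E']
  {Q : Measure α}

lemma ConvProb.map {F : ∀ n : ℕ, (Fin n → α) → E} {c : E} (hF : ConvProb Q F c) {g : E → E'}
    (hg : ContinuousAt g c) : ConvProb Q (fun n v => g (F n v)) (g c) := by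
  intro ε hε
  obtain ⟨δ, hδ, h⟩ := Metric.continuousAt_iff.1 hg ε hε
  refine tendsto_of_tendsto_of_tendsto_of_le_of_le tendsto_const_nhds (hF δ hδ)
    (fun _ => zero_le) fun n => measure_mono fun v hv => ?_
  by_contra hcon
  exact absurd (h (not_le.1 hcon)) (not_lt.2 hv)

lemma ConvProb.prodMk {F : ∀ n : ℕ, (Fin n → α) → E} {c : E} (hF : ConvProb Q F c)
    {G : ∀ n : ℕ, (Fin n → α) → E'} {d : E'} (hG : ConvProb Q G d) :
    ConvProb Q (fun n v => (F n v, G n v)) (c, d) := by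
  intro ε hε
  have := (hF ε hε).add (hG ε hε)
  rw [add_zero] at this
  refine tendsto_of_tendsto_of_tendsto_of_le_of_le tendsto_const_nhds this
    (fun _ => zero_le) fun n => (measure_mono ?_).trans (measure_union_le _ _)
  intro v hv
  simpa [Prod.dist_eq, le_max_iff] using hv

/-- It is enough to bound, for every `η`, the probability of a large deviation by `η`. -/
lemma convProb_of_eventually_le {F : ∀ n : ℕ, (Fin n → α) → E} {c : E}
    (h : ∀ ε : ℝ, 0 < ε → ∀ η : ℝ, 0 < η → ∀ᶠ n : ℕ in atTop,
      Measure.pi (fun _ : Fin n => Q) {v | ε ≤ dist (F n v) c} ≤ ENNReal.ofReal η) :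
    ConvProb Q F c := by
  intro ε hε
  rw [ENNReal.tendsto_nhds_zero]
  intro η hη
  by_cases htop : η = ⊤
  · simp [htop]
  · have := h ε hε η.toReal (ENNReal.toReal_pos hη.ne' htop)
    rwa [ENNReal.ofReal_toReal htop] at this

lemma ConvProb.congr {F G : ∀ n : ℕ, (Fin n → α) → E} {c : E} (hF : ConvProb Q F c)
    (h : ∀ n v, F n v = G n v) : ConvProb Q G c := by
  have : F = G := by funext n v; exact h n v
  exact this ▸ hF

/-- Convergence in mean implies convergence in probability. -/
lemma convProb_of_tendsto_lintegral {F : ∀ n : ℕ, (Fin n → α) → ℝ} {c : ℝ}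
    (hF : ∀ n, Measurable (F n))
    (h : Tendsto (fun n : ℕ => ∫⁻ v, ‖F n v - c‖ₑ ∂(Measure.pi fun _ : Fin n => Q)) atTop (𝓝 0)) :
    ConvProb Q F c := by
  intro ε hε
  have h2 : Tendsto (fun n : ℕ => (∫⁻ v, ‖F n v - c‖ₑ ∂(Measure.pi fun _ : Fin n => Q)) /
      ENNReal.ofReal ε) atTop (𝓝 0) := by
    have := ENNReal.Tendsto.div_const h (b := ENNReal.ofReal ε)
      (Or.inr (by simpa using hε))
    simpa using this
  refine tendsto_of_tendsto_of_tendsto_of_le_of_le tendsto_const_nhds h2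
    (fun _ => zero_le) fun n => ?_
  refine le_trans (measure_mono ?_) (meas_ge_le_lintegral_div
    (((hF n).sub_const c).enorm.aemeasurable) (by simpa using hε) ENNReal.ofReal_ne_top)
  intro v hv
  simp only [mem_ofPred_eq, Real.dist_eq] at hv ⊢
  rw [← ofReal_norm, Real.norm_eq_abs]
  exact ENNReal.ofReal_le_ofReal hv

end ConvProb

/-! ### Independent draws: Fubini, variance of sums, exponential inequalities. -/

section Product

variable {α : Type*} [MeasurableSpace α] (Q : Measure α) [IsProbabilityMeasure Q]

/-- Fubini with draw `i` outermost. It serves to condition on the observation at which a kernel sum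
is evaluated: the other `n` draws are still independent with law `Q`. -/
lemma lintegral_pi_succAbove {n : ℕ} (i : Fin (n + 1)) {F : α → (Fin n → α) → ENNReal}
    (hF : Measurable (Function.uncurry F)) :
    ∫⁻ v, F (v i) (fun j => v (i.succAbove j)) ∂(Measure.pi fun _ : Fin (n + 1) => Q) =
      ∫⁻ o, ∫⁻ u, F o u ∂(Measure.pi fun _ : Fin n => Q) ∂Q := by
  have h := measurePreserving_piFinSuccAbove (fun _ : Fin (n + 1) => Q) i
  have h2 := h.lintegral_comp hF
  rw [lintegral_prod _ hF.aemeasurable] at h2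
  exact h2

lemma lintegral_pi_eval {n : ℕ} (i : Fin n) {f : α → ENNReal} (hf : Measurable f) :
    ∫⁻ v, f (v i) ∂(Measure.pi fun _ : Fin n => Q) = ∫⁻ o, f o ∂Q :=
  (measurePreserving_eval (fun _ : Fin n => Q) i).lintegral_comp hf

lemma ae_pi_eval {n : ℕ} {r : α → Prop} (h : ∀ᵐ o ∂Q, r o) :
    ∀ᵐ v ∂(Measure.pi fun _ : Fin n => Q), ∀ i, r (v i) :=
  ae_all_iff.2 fun i => (measurePreserving_eval (fun _ : Fin n => Q) i).quasiMeasurePreserving.ae h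

/-- Variances of independent summands add, and each is at most the second moment. -/
lemma lintegral_sum_sq_le {n : ℕ} {f : α → ℝ} (hf : MemLp f 2 Q) (r : ℝ) :
    ∫⁻ v, ENNReal.ofReal ((r * ∑ j, (f (v j) - ∫ o, f o ∂Q)) ^ 2)
        ∂(Measure.pi fun _ : Fin n => Q) ≤
      ENNReal.ofReal (r ^ 2 * n * ∫ o, f o ^ 2 ∂Q) := by
  set π := Measure.pi fun _ : Fin n => Q
  have hmem : ∀ j : Fin n, MemLp (fun v : Fin n → α => f (v j)) 2 π := fun j =>
    hf.comp_measurePreserving (measurePreserving_eval (fun _ : Fin n => Q) j)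
  have hint : ∀ j : Fin n, ∫ v, f (v j) ∂π = ∫ o, f o ∂Q := fun j =>
    by
    have h := measurePreserving_eval (fun _ : Fin n => Q) j
    have h2 := integral_map (μ := π) h.measurable.aemeasurable (f := f)
      (by rw [h.map_eq]; exact hf.aestronglyMeasurable)
    rw [h.map_eq] at h2
    exact h2.symm
  have hsum : MemLp (fun v : Fin n → α => ∑ j, f (v j)) 2 π := memLp_finsetSum _ fun j _ => hmem j
  have hv := variance_sum_pi (μ := fun _ : Fin n => Q) (X := fun _ => f) (fun _ => hf)
  have hE : ∫ v, ∑ j, f (v j) ∂π = n * ∫ o, f o ∂Q := by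
    rw [integral_finsetSum _ fun j _ => (hmem j).integrable (by norm_num)]
    simp [hint]
  have hvar : Var[fun v : Fin n → α => ∑ j, f (v j); π] = n * Var[f; Q] := by
    have : (fun v : Fin n → α => ∑ j, f (v j)) = ∑ j : Fin n, fun v : Fin n → α => f (v j) := by
      ext v; simp
    rw [this, hv]; simp
  have hle : Var[f; Q] ≤ ∫ o, f o ^ 2 ∂Q := variance_le_expectation_sq hf.aestronglyMeasurable
  have hcent : ∀ v : Fin n → α, ∑ j, (f (v j) - ∫ o, f o ∂Q) =
      ∑ j, f (v j) - ∫ v, ∑ j, f (v j) ∂π := by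
    intro v; rw [hE]; simp
  rw [← ofReal_integral_eq_lintegral_ofReal]
  · refine ENNReal.ofReal_le_ofReal ?_
    simp_rw [hcent, mul_pow]
    rw [integral_const_mul, ← variance_eq_integral hsum.aestronglyMeasurable.aemeasurable, hvar,
      mul_assoc]
    gcongr
  · simp_rw [hcent]
    exact (((hsum.sub (memLp_const _)).const_mul r)).integrable_sq
  · exact Eventually.of_forall fun v => sq_nonneg _

lemma exp_le_one_add_add_sq {x : ℝ} (hx : |x| ≤ 1) : Real.exp x ≤ 1 + x + x ^ 2 := by
  have := Real.abs_exp_sub_one_sub_id_le hx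
  linarith [(abs_le.1 this).2]

/-- The condition `|t| * B ≤ 1` puts the exponent in the range where `exp x ≤ 1 + x + x²`.
Integrating this and using `1 + y ≤ exp y` gives the bound. -/
lemma integral_exp_le {f : α → ℝ} (hfm : Measurable f) {B V t : ℝ} (hB : ∀ o, |f o| ≤ B)
    (hV : ∫ o, f o ^ 2 ∂Q ≤ V) (htB : |t| * B ≤ 1) :
    ∫ o, Real.exp (t * f o) ∂Q ≤ Real.exp (t * ∫ o, f o ∂Q + t ^ 2 * V) := by
  have habs : ∀ o, |t * f o| ≤ 1 := fun o => by
    rw [abs_mul]; exact (mul_le_mul_of_nonneg_left (hB o) (abs_nonneg _)).trans htB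
  have hfi : Integrable f Q := Integrable.of_bound hfm.aestronglyMeasurable B
    (Eventually.of_forall hB)
  have hf2 : Integrable (fun o => f o ^ 2) Q :=
    Integrable.of_bound (hfm.pow_const 2).aestronglyMeasurable (B ^ 2)
      (Eventually.of_forall fun o => by
        rw [Real.norm_eq_abs, abs_pow]; exact pow_le_pow_left₀ (abs_nonneg _) (hB o) 2)
  have hexp : Integrable (fun o => Real.exp (t * f o)) Q :=
    Integrable.of_bound (by fun_prop) (Real.exp 1)
      (Eventually.of_forall fun o => by
        rw [Real.norm_eq_abs, abs_of_pos (Real.exp_pos _)]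
        exact Real.exp_le_exp.2 ((le_abs_self _).trans (habs o)))
  calc ∫ o, Real.exp (t * f o) ∂Q ≤ ∫ o, (1 + t * f o + t ^ 2 * f o ^ 2) ∂Q := by
        refine integral_mono hexp (((integrable_const _).add (hfi.const_mul t)).add
          (hf2.const_mul _)) fun o => ?_
        simpa [mul_pow] using exp_le_one_add_add_sq (habs o)
    _ = 1 + t * ∫ o, f o ∂Q + t ^ 2 * ∫ o, f o ^ 2 ∂Q := by
        have h1 : Integrable (fun o => 1 + t * f o) Q := (integrable_const _).add (hfi.const_mul t)
        rw [integral_add h1 (hf2.const_mul _),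
          integral_add (integrable_const _) (hfi.const_mul t), integral_const_mul,
          integral_const_mul]
        simp
    _ ≤ 1 + (t * ∫ o, f o ∂Q + t ^ 2 * V) := by nlinarith [sq_nonneg t]
    _ ≤ _ := by linarith [Real.add_one_le_exp (t * ∫ o, f o ∂Q + t ^ 2 * V)]

/-- Chernoff's bound, with the moment generating function factorised by independence. The parameter
`t` is left free; it will be taken proportional to a power of the bandwidth. -/
lemma measure_sum_ge_le {n : ℕ} {f : α → ℝ} (hfm : Measurable f) {B V t ε : ℝ}
    (hB : ∀ o, |f o| ≤ B) (hV : ∫ o, f o ^ 2 ∂Q ≤ V) (ht : 0 ≤ t) (htB : t * B ≤ 1) :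
    Measure.pi (fun _ : Fin n => Q) {v | n * ε ≤ ∑ j, f (v j) - n * ∫ o, f o ∂Q} ≤
      ENNReal.ofReal (Real.exp (n * (t ^ 2 * V - t * ε))) := by
  set π := Measure.pi fun _ : Fin n => Q
  have hpi : ∫ v, Real.exp (t * ∑ j, f (v j)) ∂π = (∫ o, Real.exp (t * f o) ∂Q) ^ n := by
    simp_rw [Finset.mul_sum, Real.exp_sum]
    rw [integral_fintype_prod_eq_pow (fun o => Real.exp (t * f o))]
    simp
  have hbd : ∀ v : Fin n → α, |∑ j, f (v j)| ≤ n * B := fun v =>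
    (Finset.abs_sum_le_sum_abs _ _).trans ((Finset.sum_le_sum fun j _ => hB (v j)).trans (by simp))
  have hint : Integrable (fun v : Fin n → α => Real.exp (t * ∑ j, f (v j))) π := by
    refine Integrable.of_bound (Measurable.aestronglyMeasurable (by fun_prop))
      (Real.exp (t * (n * B))) (Eventually.of_forall fun v => ?_)
    rw [Real.norm_eq_abs, abs_of_pos (Real.exp_pos _)]
    exact Real.exp_le_exp.2 (mul_le_mul_of_nonneg_left ((le_abs_self _).trans (hbd v)) ht)
  have hch := measure_ge_le_exp_mul_mgf (μ := π) (X := fun v : Fin n → α => ∑ j, f (v j))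
    (n * ε + n * ∫ o, f o ∂Q) ht hint
  have hset : {v : Fin n → α | n * ε ≤ ∑ j, f (v j) - n * ∫ o, f o ∂Q} =
      {v | n * ε + n * ∫ o, f o ∂Q ≤ ∑ j, f (v j)} := by
    ext v; simp [le_sub_iff_add_le]
  rw [hset, ← ENNReal.ofReal_toReal (measure_ne_top π _)]
  refine ENNReal.ofReal_le_ofReal (hch.trans ?_)
  rw [mgf, hpi]
  calc Real.exp (-t * (n * ε + n * ∫ o, f o ∂Q)) * (∫ o, Real.exp (t * f o) ∂Q) ^ n
      ≤ Real.exp (-t * (n * ε + n * ∫ o, f o ∂Q)) *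
          Real.exp (t * ∫ o, f o ∂Q + t ^ 2 * V) ^ n := by
        gcongr
        exact integral_exp_le Q hfm hB hV (by rwa [abs_of_nonneg ht])
    _ = _ := by
        rw [← Real.exp_nat_mul, ← Real.exp_add]; congr 1; ring

/-- A form of Bernstein's inequality. -/
lemma measure_abs_sum_ge_le {n : ℕ} {f : α → ℝ} (hfm : Measurable f) {B V t ε : ℝ}
    (hB : ∀ o, |f o| ≤ B) (hV : ∫ o, f o ^ 2 ∂Q ≤ V) (ht : 0 ≤ t) (htB : t * B ≤ 1) :
    Measure.pi (fun _ : Fin n => Q) {v | n * ε ≤ |∑ j, f (v j) - n * ∫ o, f o ∂Q|} ≤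
      2 * ENNReal.ofReal (Real.exp (n * (t ^ 2 * V - t * ε))) := by
  have h1 := measure_sum_ge_le Q (n := n) (ε := ε) hfm hB hV ht htB
  have h2 := measure_sum_ge_le Q (n := n) (ε := ε) (f := fun o => -f o) (V := V) (t := t) (B := B)
    hfm.neg (by simpa using hB) (by simpa using hV) ht htB
  rw [two_mul]
  refine le_trans (measure_mono ?_) ((measure_union_le _ _).trans (add_le_add h1 h2))
  intro v hv
  simp only [mem_ofPred_eq, le_abs, mem_union, Finset.sum_neg_distrib, integral_neg] at hv ⊢
  rcases hv with hv | hv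
  · exact Or.inl hv
  · right; linarith

end Product

/-! ### Rescaled kernels. -/

section Scaling

variable {ι : Type*} [Fintype ι]

/-- The kernel `K` centred at `z`, with bandwidth `h`, normalised to preserve integrals. -/
noncomputable def rescale (K : (ι → ℝ) → ℝ) (h : ℝ) (z x : ι → ℝ) : ℝ :=
  (h ^ Fintype.card ι)⁻¹ * K (h⁻¹ • (x - z))

lemma measurable_rescale {K : (ι → ℝ) → ℝ} (hK : Measurable K) (h : ℝ) :
    Measurable fun q : (ι → ℝ) × (ι → ℝ) => rescale K h q.1 q.2 := by
  unfold rescale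
  exact (hK.comp (by fun_prop)).const_mul _

lemma lintegral_comp_inv_smul_sub {φ : (ι → ℝ) → ENNReal} (hφ : Measurable φ) {h : ℝ}
    (hh : 0 < h) (z : ι → ℝ) :
    ∫⁻ x, φ (h⁻¹ • (x - z)) = ENNReal.ofReal (h ^ Fintype.card ι) * ∫⁻ u, φ u := by
  rw [lintegral_sub_right_eq_self (fun x : ι → ℝ => φ (h⁻¹ • x)) z]
  have h1 := Measure.map_addHaar_smul (volume : Measure (ι → ℝ)) (inv_ne_zero hh.ne')
  rw [← lintegral_map hφ (measurable_const_smul h⁻¹), h1, lintegral_smul_measure]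
  congr 1
  simp [abs_of_pos hh]

lemma lintegral_comp_inv_smul_sub_le {φ : (ι → ℝ) → ENNReal} (hφ : Measurable φ) {h : ℝ}
    (hh : 0 < h) (z : ι → ℝ) {ν : Measure (ι → ℝ)} {C : ENNReal} (hν : ν ≤ C • volume) :
    ∫⁻ x, φ (h⁻¹ • (x - z)) ∂ν ≤ C * (ENNReal.ofReal (h ^ Fintype.card ι) * ∫⁻ u, φ u) := by
  refine (lintegral_mono' hν le_rfl).trans ?_
  rw [lintegral_smul_measure, lintegral_comp_inv_smul_sub hφ hh, smul_eq_mul]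

lemma lintegral_rescale_le {K : (ι → ℝ) → ℝ} (hK : Measurable K) {h : ℝ}
    (hh : 0 < h) (z : ι → ℝ) {ν : Measure (ι → ℝ)} {C : ENNReal} (hν : ν ≤ C • volume) :
    ∫⁻ x, ‖rescale K h z x‖ₑ ∂ν ≤ C * ∫⁻ u, ‖K u‖ₑ := by
  have hp : 0 < h ^ Fintype.card ι := pow_pos hh _
  have h1 : ∀ x, ‖rescale K h z x‖ₑ = (fun u => (ENNReal.ofReal (h ^ Fintype.card ι))⁻¹ * ‖K u‖ₑ)
      (h⁻¹ • (x - z)) := by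
    intro x
    simp only [rescale, enorm_mul]
    rw [← ENNReal.ofReal_inv_of_pos hp, Real.enorm_of_nonneg (by positivity)]
  simp_rw [h1]
  refine (lintegral_comp_inv_smul_sub_le (hK.enorm.const_mul _) hh z hν).trans ?_
  rw [lintegral_const_mul _ hK.enorm, ← mul_assoc (ENNReal.ofReal _), ENNReal.mul_inv_cancel
    (by simpa using hp) ENNReal.ofReal_ne_top, one_mul]

lemma lintegral_rescale_sq_le {K : (ι → ℝ) → ℝ} (hK : Measurable K) {h : ℝ}
    (hh : 0 < h) (z : ι → ℝ) {ν : Measure (ι → ℝ)} {C : ENNReal} (hν : ν ≤ C • volume) :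
    ∫⁻ x, ENNReal.ofReal (rescale K h z x ^ 2) ∂ν ≤
      C * (ENNReal.ofReal (h ^ Fintype.card ι)⁻¹ * ∫⁻ u, ENNReal.ofReal (K u ^ 2)) := by
  have hp : 0 < h ^ Fintype.card ι := pow_pos hh _
  have hm : Measurable fun u => ENNReal.ofReal (K u ^ 2) := (hK.pow_const 2).ennreal_ofReal
  have h1 : ∀ x, ENNReal.ofReal (rescale K h z x ^ 2) =
      (fun u => ENNReal.ofReal (((h ^ Fintype.card ι)⁻¹) ^ 2) * ENNReal.ofReal (K u ^ 2))
      (h⁻¹ • (x - z)) := by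
    intro x
    simp only [rescale]
    rw [← ENNReal.ofReal_mul (by positivity), mul_pow]
  simp_rw [h1]
  refine (lintegral_comp_inv_smul_sub_le (hm.const_mul _) hh z hν).trans ?_
  rw [lintegral_const_mul _ hm, ← mul_assoc (ENNReal.ofReal _), ← ENNReal.ofReal_mul hp.le]
  gcongr
  apply le_of_eq
  field_simp

/-- An integrable kernel may be unbounded and have slow tails. Where `‖u‖` or `‖K u‖` exceeds a
large `N`, it has small mass, which stays small against any measure dominated by `C • volume`.
Elsewhere the rescaled kernel is at most `N / h ^ card` and lives on the ball of radius `N h`. The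
radius `R = N` depends neither on the measure nor on `h` and `z`. -/
lemma exists_lintegral_rescale_le {K : (ι → ℝ) → ℝ} (hK : Measurable K) (hKi : Integrable K)
    {C : ENNReal} (hC : C ≠ ⊤) {η : ENNReal} (hη : 0 < η) :
    ∃ R : ℝ, 0 < R ∧ ∀ ν : Measure (ι → ℝ), ν ≤ C • volume → ∀ h : ℝ, 0 < h → ∀ z,
      ∫⁻ x, ‖rescale K h z x‖ₑ ∂ν ≤
        η + ENNReal.ofReal (R / h ^ Fintype.card ι) * ν (Metric.closedBall z (R * h)) := by
  let T : ℕ → Set (ι → ℝ) := fun N => {u | (N : ℝ) < ‖u‖ ∨ (N : ℝ) < ‖K u‖}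
  have hT : ∀ N, MeasurableSet (T N) := fun N =>
    (measurableSet_lt measurable_const measurable_norm).union
      (measurableSet_lt measurable_const hK.norm)
  let φ : ℕ → (ι → ℝ) → ENNReal := fun N => (T N).indicator fun u => ‖K u‖ₑ
  have hφm : ∀ N, Measurable (φ N) := fun N => hK.enorm.indicator (hT N)
  have hlim : Tendsto (fun N => ∫⁻ u, φ N u) atTop (𝓝 (∫⁻ _ : ι → ℝ, 0)) := by
    refine tendsto_lintegral_of_dominated_convergence (fun u => ‖K u‖ₑ) hφm
      (fun N => Eventually.of_forall fun u => indicator_le_self _ _ u) hKi.2.ne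
      (Eventually.of_forall fun u => ?_)
    refine tendsto_const_nhds.congr' ?_
    obtain ⟨N₀, hN₀⟩ := exists_nat_ge (max ‖u‖ ‖K u‖)
    filter_upwards [eventually_ge_atTop N₀] with N hN
    have hN' : (N₀ : ℝ) ≤ N := by exact_mod_cast hN
    have h1 := (le_max_left ‖u‖ ‖K u‖).trans (hN₀.trans hN')
    have h2 := (le_max_right ‖u‖ ‖K u‖).trans (hN₀.trans hN')
    refine (indicator_of_notMem ?_ _).symm
    simp only [T, mem_ofPred_eq, not_or, not_lt]
    exact ⟨h1, h2⟩
  rw [lintegral_zero] at hlim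
  have hlim2 : Tendsto (fun N => C * ∫⁻ u, φ N u) atTop (𝓝 0) := by
    simpa using ENNReal.Tendsto.const_mul hlim (Or.inr hC)
  obtain ⟨N, hN1, hN⟩ := ((eventually_ge_atTop 1).and (hlim2.eventually (gt_mem_nhds hη))).exists
  have hNpos : (0 : ℝ) < N := by exact_mod_cast hN1
  refine ⟨N, hNpos, fun ν hν h hh z => ?_⟩
  have hp : 0 < h ^ Fintype.card ι := pow_pos hh _
  have hpt : ∀ x, ‖rescale K h z x‖ₑ ≤
      ENNReal.ofReal (h ^ Fintype.card ι)⁻¹ * φ N (h⁻¹ • (x - z)) +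
      (Metric.closedBall z (N * h)).indicator
        (fun _ => ENNReal.ofReal (N / h ^ Fintype.card ι)) x := by
    intro x
    simp only [rescale, enorm_mul]
    rw [Real.enorm_of_nonneg (by positivity : 0 ≤ (h ^ Fintype.card ι)⁻¹)]
    by_cases hx : h⁻¹ • (x - z) ∈ T N
    · simp only [φ, indicator_of_mem hx]
      exact le_self_add
    · simp only [T, mem_ofPred_eq, not_or, not_lt] at hx
      have hball : x ∈ Metric.closedBall z (N * h) := by
        rw [mem_closedBall_iff_norm]
        have := hx.1
        rw [norm_smul, norm_inv, Real.norm_of_nonneg hh.le, inv_mul_le_iff₀ hh] at this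
        linarith
      rw [indicator_of_mem hball]
      refine le_trans ?_ le_add_self
      rw [div_eq_inv_mul, ENNReal.ofReal_mul (by positivity)]
      gcongr
      rw [← ofReal_norm]
      exact ENNReal.ofReal_le_ofReal hx.2
  have hm' : Measurable fun x => φ N (h⁻¹ • (x - z)) := (hφm N).comp (by fun_prop)
  refine (lintegral_mono hpt).trans ?_
  rw [lintegral_add_left (hm'.const_mul _),
      lintegral_indicator Metric.isClosed_closedBall.measurableSet,
    setLIntegral_const]
  gcongr
  rw [lintegral_const_mul _ hm']
  refine le_trans ?_ hN.le
  refine (mul_le_mul_right (lintegral_comp_inv_smul_sub_le (hφm N) hh z hν) _).trans ?_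
  rw [mul_left_comm, ← mul_assoc (ENNReal.ofReal _), ← ENNReal.ofReal_mul (by positivity),
    inv_mul_cancel₀ hp.ne', ENNReal.ofReal_one, one_mul]

lemma integral_rescale {K : (ι → ℝ) → ℝ} {h : ℝ} (hh : 0 < h) (z : ι → ℝ) :
    ∫ x, rescale K h z x = ∫ u, K u := by
  unfold rescale
  rw [integral_const_mul, integral_sub_right_eq_self (fun x : ι → ℝ => K (h⁻¹ • x)) z,
    Measure.integral_comp_inv_smul_of_nonneg _ _ hh.le]
  simp only [Module.finrank_fintype_fun_eq_card, smul_eq_mul]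
  rw [inv_mul_cancel_left₀ (pow_pos hh _).ne']

lemma integrable_rescale {K : (ι → ℝ) → ℝ} (hKi : Integrable K) {h : ℝ} (hh : 0 < h)
    (z : ι → ℝ) : Integrable (rescale K h z) := by
  unfold rescale
  refine Integrable.const_mul ?_ _
  exact ((integrable_comp_smul_iff volume K (inv_ne_zero hh.ne')).2 hKi).comp_sub_right z

end Scaling

/-! ### Lebesgue points and differentiation of measures. -/

section Lebesgue

variable {ι : Type*} [Fintype ι]

/-- The mean oscillation of `G` around its value at `z` vanishes on small balls. -/
def IsLebesguePoint (G : (ι → ℝ) → ℝ) (z : ι → ℝ) : Prop :=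
  ∀ ε : ℝ, 0 < ε → ∀ᶠ r in 𝓝[>] (0 : ℝ),
    ∫⁻ x in Metric.closedBall z r, ‖G x - G z‖ₑ ≤ ENNReal.ofReal (ε * r ^ Fintype.card ι)

lemma volume_closedBall_eq (z : ι → ℝ) {r : ℝ} (hr : 0 ≤ r) :
    volume (Metric.closedBall z r) = ENNReal.ofReal ((2 * r) ^ Fintype.card ι) :=
  Real.volume_pi_closedBall z hr

lemma isLebesguePoint_of_continuousAt {G : (ι → ℝ) → ℝ} {z : ι → ℝ} (hG : ContinuousAt G z) :
    IsLebesguePoint G z := by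
  intro ε hε
  have hε' : 0 < ε / 2 ^ Fintype.card ι := by positivity
  obtain ⟨δ, hδ, hδG⟩ := Metric.continuousAt_iff.1 hG _ hε'
  filter_upwards [Ioo_mem_nhdsGT hδ] with r hr
  calc ∫⁻ x in Metric.closedBall z r, ‖G x - G z‖ₑ
      ≤ ∫⁻ _ in Metric.closedBall z r, ENNReal.ofReal (ε / 2 ^ Fintype.card ι) := by
        refine setLIntegral_mono measurable_const fun x hx => ?_
        rw [← ofReal_norm, ← dist_eq_norm]
        exact ENNReal.ofReal_le_ofReal
          (hδG ((Metric.mem_closedBall.1 hx).trans_lt hr.2)).le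
    _ = ENNReal.ofReal (ε * r ^ Fintype.card ι) := by
        rw [setLIntegral_const, volume_closedBall_eq z hr.1.le, ← ENNReal.ofReal_mul hε'.le,
          mul_pow]
        congr 1
        field_simp

/-- A ball of radius `r` in the sup norm is a cube of volume `(2 r) ^ card`, whence the factor `2 ^
card`. The limit `c` need not be zero. -/
lemma eventually_le_of_tendsto_div_zero {ν : Measure (ι → ℝ)} {z : ι → ℝ} {c : ENNReal}
    (h : Tendsto (fun r => ν (Metric.closedBall z r) / volume (Metric.closedBall z r))
      (𝓝[>] (0 : ℝ)) (𝓝 c)) {ε : ℝ} (hε : 0 < ε)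
    (hc : c < ENNReal.ofReal (ε / 2 ^ Fintype.card ι)) :
    ∀ᶠ r in 𝓝[>] (0 : ℝ), ν (Metric.closedBall z r) ≤ ENNReal.ofReal (ε * r ^ Fintype.card ι) := by
  filter_upwards [h.eventually (gt_mem_nhds hc), self_mem_nhdsWithin] with r hr hr0
  have hr0 : 0 < r := hr0
  rw [volume_closedBall_eq z hr0.le] at hr
  have hp : 0 < (2 * r) ^ Fintype.card ι := by positivity
  have := (ENNReal.div_le_iff (by simpa using hp) ENNReal.ofReal_ne_top).1 hr.le
  refine this.trans (le_of_eq ?_)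
  rw [← ENNReal.ofReal_mul (by positivity), mul_pow]
  congr 1
  field_simp

lemma ae_isLebesguePoint {G : (ι → ℝ) → ℝ} (hG : LocallyIntegrable G) :
    ∀ᵐ z, IsLebesguePoint G z := by
  filter_upwards [(Besicovitch.vitaliFamily (volume : Measure
      (ι → ℝ))).ae_tendsto_lintegral_enorm_sub_div hG]
    with z hz ε hε
  have h1 := hz.comp (Besicovitch.tendsto_filterAt volume z)
  have h2 := eventually_le_of_tendsto_div_zero (ν := volume.withDensity fun x => ‖G x - G z‖ₑ)
    (z := z) (c := 0) (by
      refine h1.congr fun r => ?_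
      simp only [Function.comp]
      rw [withDensity_apply _ Metric.isClosed_closedBall.measurableSet]) hε (by simp; positivity)
  filter_upwards [h2] with r hr
  rwa [withDensity_apply _ Metric.isClosed_closedBall.measurableSet] at hr

/-- The infimum over `M` of the Radon-Nikodym densities has integral at most `ν M univ` for every
`M`, so it vanishes almost everywhere. Differentiation of measures, for all countably many `ν M` at
once, then turns a small density at `z` into small mass of small balls. -/
lemma ae_small_density {ν : ℕ → Measure (ι → ℝ)} [∀ M, IsFiniteMeasure (ν M)]
    (h0 : Tendsto (fun M => ν M univ) atTop (𝓝 0)) :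
    ∀ᵐ z, ∀ ε : ℝ, 0 < ε → ∃ M, ∀ᶠ r in 𝓝[>] (0 : ℝ),
      ν M (Metric.closedBall z r) ≤ ENNReal.ofReal (ε * r ^ Fintype.card ι) := by
  have hinf : ∀ᵐ z : ι → ℝ, (⨅ M, (ν M).rnDeriv volume z) = 0 := by
    refine (lintegral_eq_zero_iff (Measurable.iInf fun M => Measure.measurable_rnDeriv _ _)).1 ?_
    refine le_antisymm (ge_of_tendsto' h0 fun M => ?_) zero_le
    calc ∫⁻ z, ⨅ M, (ν M).rnDeriv volume z ≤ ∫⁻ z, (ν M).rnDeriv volume z :=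
          lintegral_mono fun z => iInf_le _ M
      _ ≤ ν M univ := Measure.lintegral_rnDeriv_le
  have hdiff : ∀ᵐ z : ι → ℝ, ∀ M, Tendsto
      (fun r => ν M (Metric.closedBall z r) / volume (Metric.closedBall z r)) (𝓝[>] (0 : ℝ))
      (𝓝 ((ν M).rnDeriv volume z)) :=
    ae_all_iff.2 fun M => Besicovitch.ae_tendsto_rnDeriv (ν M) volume
  filter_upwards [hinf, hdiff] with z hz hd ε hε
  have : (⨅ M, (ν M).rnDeriv volume z) < ENNReal.ofReal (ε / 2 ^ Fintype.card ι) := by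
    rw [hz]; simp; positivity
  obtain ⟨M, hM⟩ := iInf_lt_iff.1 this
  exact ⟨M, eventually_le_of_tendsto_div_zero (hd M) hε hM⟩

end Lebesgue

/-! ### Kernel mass near the boundary of a box. -/

section TruncatedMass

variable {ι : Type*} [Fintype ι]

lemma ae_coord_ne (i : ι) (c : ℝ) : ∀ᵐ u : ι → ℝ, u i ≠ c := by
  have h := (Measure.pi_hyperplane (fun _ : ι => (volume : Measure ℝ)) i c)
  rw [← volume_pi] at h
  exact measure_eq_zero_iff_ae_notMem.1 h

/-- Dominated convergence: at a point `u` sharing no coordinate with the corners, membership in the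
box is locally constant in the corners, and the remaining points lie on finitely many hyperplanes.
-/
lemma continuous_setIntegral_Icc {L : (ι → ℝ) → ℝ} (hL : Integrable L) :
    Continuous fun q : (ι → ℝ) × (ι → ℝ) => ∫ u in Icc q.1 q.2, L u := by
  rw [continuous_iff_continuousAt]
  intro q₀
  simp_rw [← integral_indicator measurableSet_Icc]
  refine continuousAt_of_dominated (bound := fun u => ‖L u‖)
    (Eventually.of_forall fun q => (hL.indicator measurableSet_Icc).aestronglyMeasurable)
    (Eventually.of_forall fun q => Eventually.of_forall fun u => norm_indicator_le_norm_self _ _)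
    hL.norm ?_
  have h1 : ∀ᵐ u : ι → ℝ, ∀ i, u i ≠ q₀.1 i := ae_all_iff.2 fun i => ae_coord_ne i _
  have h2 : ∀ᵐ u : ι → ℝ, ∀ i, u i ≠ q₀.2 i := ae_all_iff.2 fun i => ae_coord_ne i _
  filter_upwards [h1, h2] with u hu1 hu2
  refine ContinuousAt.congr continuousAt_const
    (f := fun _ => (Icc q₀.1 q₀.2).indicator L u) ?_
  have e1 : ∀ᶠ q : (ι → ℝ) × (ι → ℝ) in 𝓝 q₀, ∀ i, (q.1 i ≤ u i ↔ q₀.1 i ≤ u i) := by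
    refine eventually_all.2 fun i => ?_
    have hc : ContinuousAt (fun q : (ι → ℝ) × (ι → ℝ) => q.1 i) q₀ := by fun_prop
    rcases lt_or_gt_of_ne (hu1 i) with h | h
    · filter_upwards [hc.eventually (lt_mem_nhds h)] with q hq
      simp [not_le.2 h, not_le.2 hq]
    · filter_upwards [hc.eventually (gt_mem_nhds h)] with q hq
      simp [le_of_lt h, le_of_lt hq]
  have e2 : ∀ᶠ q : (ι → ℝ) × (ι → ℝ) in 𝓝 q₀, ∀ i, (u i ≤ q.2 i ↔ u i ≤ q₀.2 i) := by
    refine eventually_all.2 fun i => ?_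
    have hc : ContinuousAt (fun q : (ι → ℝ) × (ι → ℝ) => q.2 i) q₀ := by fun_prop
    rcases lt_or_gt_of_ne (hu2 i) with h | h
    · filter_upwards [hc.eventually (lt_mem_nhds h)] with q hq
      simp [le_of_lt h, le_of_lt hq]
    · filter_upwards [hc.eventually (gt_mem_nhds h)] with q hq
      simp [not_le.2 h, not_le.2 hq]
  filter_upwards [e1, e2] with q hq1 hq2
  have : u ∈ Icc q.1 q.2 ↔ u ∈ Icc q₀.1 q₀.2 := by
    simp only [mem_Icc, Pi.le_def, hq1, hq2]
  by_cases hm : u ∈ Icc q₀.1 q₀.2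
  · rw [indicator_of_mem hm, indicator_of_mem (this.2 hm)]
  · rw [indicator_of_notMem hm, indicator_of_notMem (mt this.1 hm)]

/-- The admissible cuts form a compact set, a product of two-piece sets of endpoint pairs, on which
the positive continuous truncated mass attains its minimum. -/
lemma exists_pos_le_truncatedMass {L : (ι → ℝ) → ℝ} (hL : Integrable L)
    (hpos : PosTruncatedMass L) : ∃ c : ℝ, 0 < c ∧ ∀ a b : ι → ℝ,
      (∀ i, (a i = -1 ∧ 0 ≤ b i ∧ b i ≤ 1) ∨ (b i = 1 ∧ -1 ≤ a i ∧ a i ≤ 0)) →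
      c ≤ ∫ u in Icc a b, L u := by
  let T : Set (ℝ × ℝ) := ({-1} ×ˢ Icc 0 1) ∪ (Icc (-1) 0 ×ˢ {1})
  have hT : IsCompact T := (isCompact_singleton.prod isCompact_Icc).union
    (isCompact_Icc.prod isCompact_singleton)
  let T' : Set (ι → ℝ × ℝ) := univ.pi fun _ => T
  have hT' : IsCompact T' := isCompact_univ_pi fun _ => hT
  have hne : T'.Nonempty := ⟨fun _ => (-1, 0), fun i _ => Or.inl ⟨by simp, by simp⟩⟩
  have hcont : Continuous fun q : ι → ℝ × ℝ =>
      ∫ u in Icc (fun i => (q i).1) (fun i => (q i).2), L u :=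
    (continuous_setIntegral_Icc hL).comp
      (f := fun q : ι → ℝ × ℝ => ((fun i => (q i).1 : ι → ℝ), (fun i => (q i).2 : ι → ℝ)))
      (by fun_prop)
  obtain ⟨q, hq, hmin⟩ := hT'.exists_isMinOn hne hcont.continuousOn
  refine ⟨_, hpos (fun i => (q i).1) (fun i => (q i).2) fun i => ?_, fun a b hab => ?_⟩
  · rcases hq i (mem_univ i) with h | h
    · exact Or.inl ⟨h.1, h.2.1, h.2.2⟩
    · exact Or.inr ⟨h.2, h.1.1, h.1.2⟩
  · refine hmin (a := fun i => (a i, b i)) fun i _ => ?_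
    rcases hab i with h | h
    · exact Or.inl ⟨h.1, h.2.1, h.2.2⟩
    · exact Or.inr ⟨⟨h.2.1, h.2.2⟩, h.1⟩

/-- The part of a rescaled kernel that falls into a box has mass bounded away from zero. -/
lemma exists_le_setIntegral_rescale {L : (ι → ℝ) → ℝ} (hL : Integrable L)
    (hsupp : ∀ u, u ∉ Icc (fun _ => (-1 : ℝ)) (fun _ => 1) → L u = 0)
    (hpos : PosTruncatedMass L) {A B : ι → ℝ} (hAB : ∀ i, A i < B i) :
    ∃ c : ℝ, 0 < c ∧ ∃ h₀ : ℝ, 0 < h₀ ∧ ∀ h, 0 < h → h < h₀ → ∀ x ∈ Icc A B,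
      c ≤ ∫ x' in Icc A B, rescale L h x x' := by
  obtain ⟨c, hc, hcL⟩ := exists_pos_le_truncatedMass hL hpos
  obtain ⟨h₀, hh₀, hh₀'⟩ : ∃ h₀ : ℝ, 0 < h₀ ∧ ∀ i, 2 * h₀ ≤ B i - A i := by
    have : ∀ᶠ t : ℝ in 𝓝[>] 0, ∀ i, 2 * t ≤ B i - A i := by
      refine eventually_all.2 fun i => ?_
      filter_upwards [Ioo_mem_nhdsGT (half_pos (sub_pos.2 (hAB i)))] with t ht
      linarith [ht.2]
    obtain ⟨t, h1, h2⟩ := (this.and self_mem_nhdsWithin).exists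
    exact ⟨t, h2, h1⟩
  -- The corners below describe the box in the coordinate `u = (x' - x) / h`, cut down to the
  -- support `[-1, 1]` of the kernel.
  refine ⟨c, hc, h₀, hh₀, fun h hh hlt x hx => ?_⟩
  let a : ι → ℝ := fun i => max (-1) ((A i - x i) / h)
  let b : ι → ℝ := fun i => min 1 ((B i - x i) / h)
  have hset : ∫ x' in Icc A B, rescale L h x x' = ∫ u in Icc a b, L u := by
    rw [← integral_indicator measurableSet_Icc, ← integral_indicator measurableSet_Icc,
      ← integral_rescale (K := (Icc a b).indicator L) hh x]
    congr 1
    ext x'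
    by_cases hx' : x' ∈ Icc A B
    · rw [indicator_of_mem hx', rescale, rescale]
      congr 1
      by_cases hu : h⁻¹ • (x' - x) ∈ Icc (fun _ : ι => (-1 : ℝ)) (fun _ => 1)
      · rw [indicator_of_mem]
        refine ⟨fun i => max_le (hu.1 i) ?_, fun i => le_min (hu.2 i) ?_⟩
        · simp only [Pi.smul_apply, Pi.sub_apply, smul_eq_mul, ← div_eq_inv_mul]
          gcongr; exact hx'.1 i
        · simp only [Pi.smul_apply, Pi.sub_apply, smul_eq_mul, ← div_eq_inv_mul]
          gcongr; exact hx'.2 i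
      · rw [hsupp _ hu, indicator_apply_eq_zero.2 fun _ => hsupp _ hu]
    · rw [indicator_of_notMem hx', rescale, indicator_of_notMem, mul_zero]
      intro hu
      refine hx' ⟨fun i => ?_, fun i => ?_⟩
      · have := (le_max_right _ _).trans (hu.1 i)
        simp only [Pi.smul_apply, Pi.sub_apply, smul_eq_mul, ← div_eq_inv_mul] at this
        linarith [(div_le_div_iff_of_pos_right hh).1 this]
      · have := (hu.2 i).trans (min_le_right _ _)
        simp only [Pi.smul_apply, Pi.sub_apply, smul_eq_mul, ← div_eq_inv_mul] at this
        linarith [(div_le_div_iff_of_pos_right hh).1 this]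
  rw [hset]
  refine hcL a b fun i => ?_
  have hA : (A i - x i) / h ≤ 0 := div_nonpos_of_nonpos_of_nonneg (by linarith [hx.1 i]) hh.le
  have hB : 0 ≤ (B i - x i) / h := div_nonneg (by linarith [hx.2 i]) hh.le
  -- At most one side cuts into the support: if the lower face is closer than `h`, the upper one is
  -- farther than `2 * h₀ - h`, which exceeds `h`.
  by_cases hcase : (A i - x i) / h ≤ -1
  · left
    exact ⟨max_eq_left hcase, le_min zero_le_one hB, min_le_left _ _⟩
  · right
    refine ⟨min_eq_left ?_, le_max_left _ _, max_le (by norm_num) hA⟩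
    rw [le_div_iff₀ hh]
    rw [not_le, lt_div_iff₀ hh] at hcase
    linarith [hh₀' i]

lemma uniform_modulus {A B : ι → ℝ} {f : (ι → ℝ) → ℝ} (hf : ContinuousOn f (Icc A B))
    {ω : ℝ} (hω : 0 < ω) : ∃ δ : ℝ, 0 < δ ∧ ∀ x ∈ Icc A B, ∀ x' ∈ Icc A B,
      ‖x' - x‖ ≤ δ → |f x' - f x| ≤ ω := by
  obtain ⟨δ, hδ, h⟩ := Metric.uniformContinuousOn_iff.1
    (isCompact_Icc.uniformContinuousOn_of_continuous hf) ω hω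
  refine ⟨δ / 2, half_pos hδ, fun x hx x' hx' hd => ?_⟩
  have := h x' hx' x hx (by rw [dist_eq_norm]; linarith)
  rw [Real.dist_eq] at this
  exact this.le

lemma norm_sub_le_of_rescale_ne_zero {L : (ι → ℝ) → ℝ}
    (hsupp : ∀ u, u ∉ Icc (fun _ => (-1 : ℝ)) (fun _ => 1) → L u = 0) {h : ℝ} (hh : 0 < h)
    {x x' : ι → ℝ} (hne : rescale L h x x' ≠ 0) : ‖x' - x‖ ≤ h := by
  have hu : h⁻¹ • (x' - x) ∈ Icc (fun _ : ι => (-1 : ℝ)) (fun _ => 1) := by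
    by_contra hcon
    exact hne (by rw [rescale, hsupp _ hcon, mul_zero])
  rw [pi_norm_le_iff_of_nonneg hh.le]
  intro i
  have h1 := hu.1 i
  have h2 := hu.2 i
  simp only [Pi.smul_apply, Pi.sub_apply, smul_eq_mul, ← div_eq_inv_mul] at h1 h2
  rw [le_div_iff₀ hh] at h1
  rw [div_le_iff₀ hh] at h2
  rw [Real.norm_eq_abs, abs_le]
  constructor <;> simp only [Pi.sub_apply] <;> linarith

end TruncatedMass

/-! ### Laws with a density on a box. -/

section BoxDensity

variable {Ω ι : Type*} [MeasurableSpace Ω] [Fintype ι] {P : Measure Ω} {T : Ω → ι → ℝ}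
  {a b : ι → ℝ} {s : ℕ} {f : (ι → ℝ) → ℝ}

lemma HasBoxDensity.continuousOn (hf : HasBoxDensity P T a b s f) : ContinuousOn f (Icc a b) :=
  hf.smooth.continuousOn

lemma HasBoxDensity.measurable_indicator (hf : HasBoxDensity P T a b s f) :
    Measurable ((Icc a b).indicator f) := by
  classical
  rw [← piecewise_eq_indicator]
  exact hf.continuousOn.measurable_piecewise continuousOn_const measurableSet_Icc

/-- `f` is constrained only on the box. Its extension by zero is measurable, bounded and nonnegative
everywhere, so the law can be handled as a density against full Lebesgue measure. -/
lemma HasBoxDensity.map_eq (hf : HasBoxDensity P T a b s f) :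
    P.map T = volume.withDensity fun t => ENNReal.ofReal ((Icc a b).indicator f t) := by
  rw [hf.law, ← withDensity_indicator measurableSet_Icc]
  congr 1
  ext t
  by_cases ht : t ∈ Icc a b <;> simp [ht]

lemma HasBoxDensity.indicator_nonneg (hf : HasBoxDensity P T a b s f) (t : ι → ℝ) :
    0 ≤ (Icc a b).indicator f t := by
  obtain ⟨c, C, hc, h⟩ := hf.bounds
  exact Set.indicator_nonneg (fun t ht => hc.le.trans (h t ht).1) t

lemma HasBoxDensity.exists_bound (hf : HasBoxDensity P T a b s f) :
    ∃ C : ℝ, 0 < C ∧ ∀ t, (Icc a b).indicator f t ≤ C := by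
  obtain ⟨c, C, hc, h⟩ := hf.bounds
  refine ⟨max C 1, by positivity, fun t => ?_⟩
  by_cases ht : t ∈ Icc a b
  · rw [indicator_of_mem ht]; exact (h t ht).2.trans (le_max_left _ _)
  · rw [indicator_of_notMem ht]; positivity

lemma HasBoxDensity.exists_map_le (hf : HasBoxDensity P T a b s f) :
    ∃ C : ENNReal, C ≠ ⊤ ∧ P.map T ≤ C • volume := by
  obtain ⟨C, hC, h⟩ := hf.exists_bound
  refine ⟨ENNReal.ofReal C, ENNReal.ofReal_ne_top, ?_⟩
  rw [hf.map_eq, ← withDensity_const]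
  exact withDensity_mono (Eventually.of_forall fun t => ENNReal.ofReal_le_ofReal (h t))

lemma HasBoxDensity.ae_mem (hf : HasBoxDensity P T a b s f) : ∀ᵐ t ∂(P.map T), t ∈ Icc a b := by
  rw [hf.law]
  exact (withDensity_absolutelyContinuous _ _).ae_le (ae_restrict_mem measurableSet_Icc)

lemma HasBoxDensity.map_absolutelyContinuous (hf : HasBoxDensity P T a b s f) :
    P.map T ≪ volume := by
  rw [hf.map_eq]
  exact withDensity_absolutelyContinuous _ _

lemma HasBoxDensity.integral_map_eq (hf : HasBoxDensity P T a b s f) (g : (ι → ℝ) → ℝ) :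
    ∫ t, g t ∂(P.map T) = ∫ t, (Icc a b).indicator f t * g t := by
  rw [hf.map_eq, integral_withDensity_eq_integral_toReal_smul
    hf.measurable_indicator.ennreal_ofReal (Eventually.of_forall fun t => ENNReal.ofReal_lt_top)]
  simp only [ENNReal.toReal_ofReal (hf.indicator_nonneg _), smul_eq_mul]

lemma HasBoxDensity.integrable_map (hf : HasBoxDensity P T a b s f) {g : (ι → ℝ) → ℝ}
    (hg : Integrable g) : Integrable g (P.map T) := by
  obtain ⟨C, hC, h⟩ := hf.exists_map_le
  exact (hg.smul_measure hC).mono_measure h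

/-- A property of almost every value of `T` holds almost everywhere on the box. -/
lemma HasBoxDensity.ae_of_ae_map (hf : HasBoxDensity P T a b s f) {r : (ι → ℝ) → Prop}
    (h : ∀ᵐ t ∂(P.map T), r t) : ∀ᵐ t, t ∈ Icc a b → r t := by
  rw [hf.map_eq, ae_withDensity_iff hf.measurable_indicator.ennreal_ofReal] at h
  filter_upwards [h] with t ht hmem
  refine ht ?_
  obtain ⟨c, C, hc, h⟩ := hf.bounds
  rw [indicator_of_mem hmem]
  simpa using hc.trans_le (h t hmem).1

end BoxDensity

/-! ### Marginal densities. -/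

section Marginal

variable {Ω : Type*} [MeasurableSpace Ω] {P : Measure Ω}

/-- A subvector of a vector with a box density has a box density. -/
lemma HasBoxDensity.marginal {ι : Type*} [Fintype ι] [DecidableEq ι] {T : Ω → ι → ℝ}
    (hT : Measurable T) {a b : ι → ℝ} {s : ℕ} {f : (ι → ℝ) → ℝ} (hab : ∀ i, a i < b i)
    (hf : HasBoxDensity P T a b s f) (S : Finset ι) :
    ∃ g : (S → ℝ) → ℝ, HasBoxDensity P (fun ω (i : S) => T ω i) (fun i : S => a i)
      (fun i : S => b i) 0 g := by
  let e := MeasurableEquiv.piEquivPiSubtypeProd (fun _ : ι => ℝ) (· ∈ S)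
  have he : MeasurePreserving e volume volume := by
    convert volume_preserving_piEquivPiSubtypeProd (fun _ : ι => ℝ) (· ∈ S) <;> rfl
  let I : Set ({i // i ∈ S} → ℝ) := Icc (fun i => a i) (fun i => b i)
  let J : Set ({i // i ∉ S} → ℝ) := Icc (fun i => a i) (fun i => b i)
  have hmem : ∀ t r, e.symm (t, r) ∈ Icc a b ↔ t ∈ I ∧ r ∈ J := by
    intro t r
    simp only [I, J, mem_Icc, Pi.le_def, Subtype.forall]
    have h1 : ∀ i (hi : i ∈ S), e.symm (t, r) i = t ⟨i, hi⟩ := fun i hi => by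
      simp [e, MeasurableEquiv.piEquivPiSubtypeProd, Equiv.piEquivPiSubtypeProd, hi]
    have h2 : ∀ i (hi : i ∉ S), e.symm (t, r) i = r ⟨i, hi⟩ := fun i hi => by
      simp [e, MeasurableEquiv.piEquivPiSubtypeProd, Equiv.piEquivPiSubtypeProd, hi]
    constructor
    · rintro ⟨ha, hb⟩
      exact ⟨⟨fun i hi => h1 i hi ▸ ha i, fun i hi => h1 i hi ▸ hb i⟩,
        ⟨fun i hi => h2 i hi ▸ ha i, fun i hi => h2 i hi ▸ hb i⟩⟩
    · rintro ⟨⟨ha, hb⟩, ⟨ha', hb'⟩⟩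
      refine ⟨fun i => ?_, fun i => ?_⟩ <;> by_cases hi : i ∈ S
      · rw [h1 i hi]; exact ha i hi
      · rw [h2 i hi]; exact ha' i hi
      · rw [h1 i hi]; exact hb i hi
      · rw [h2 i hi]; exact hb' i hi
  have hcont : Continuous fun q : ({i // i ∈ S} → ℝ) × ({i // i ∉ S} → ℝ) => e.symm q := by
    refine continuous_pi fun i => ?_
    by_cases hi : i ∈ S
    · simp only [e, MeasurableEquiv.piEquivPiSubtypeProd, Equiv.piEquivPiSubtypeProd,
        MeasurableEquiv.symm_mk, MeasurableEquiv.coe_mk, Equiv.coe_fn_symm_mk, hi, dite_true]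
      fun_prop
    · simp only [e, MeasurableEquiv.piEquivPiSubtypeProd, Equiv.piEquivPiSubtypeProd,
        MeasurableEquiv.symm_mk, MeasurableEquiv.coe_mk, Equiv.coe_fn_symm_mk, hi, dite_false]
      fun_prop
  obtain ⟨c, C, hc, hbd⟩ := hf.bounds
  have hJvol : volume J ≠ ⊤ := isCompact_Icc.measure_lt_top.ne
  have hJpos : 0 < volume.real J := by
    refine ENNReal.toReal_pos (ne_of_gt ?_) hJvol
    simp only [J, Real.volume_Icc_pi]
    exact pos_iff_ne_zero.2 (Finset.prod_ne_zero_iff.2 fun i _ => by simpa using hab i)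
  have hfib : ∀ t ∈ I, ContinuousOn (fun r => f (e.symm (t, r))) J := fun t ht =>
    hf.continuousOn.comp (hcont.comp (by fun_prop)).continuousOn fun r hr => (hmem t r).2 ⟨ht, hr⟩
  have hint : ∀ t ∈ I, IntegrableOn (fun r => f (e.symm (t, r))) J := fun t ht =>
    (hfib t ht).integrableOn_compact isCompact_Icc
  -- The marginal density integrates `f` over the box `J` of the remaining coordinates, so the
  -- bounds of `f` are multiplied by the positive volume of `J`. Smoothness of order `0` means
  -- continuity, which follows by dominated convergence.
  refine ⟨fun t => ∫ r in J, f (e.symm (t, r)), ?_, ⟨c * volume.real J, C * volume.real J,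
    by positivity, fun t ht => ⟨?_, ?_⟩⟩, ?_⟩
  · have hproj : (fun ω (i : S) => T ω i) = (fun q => (e q).1) ∘ T := rfl
    have hm : Measurable fun q => (e q).1 := measurable_fst.comp e.measurable
    rw [hproj, ← Measure.map_map hm hT, hf.map_eq]
    ext A hA
    have hgm : Measurable fun t => ENNReal.ofReal ((Icc a b).indicator f t) :=
      hf.measurable_indicator.ennreal_ofReal
    have hG : Measurable fun q => ((fun q => (e q).1) ⁻¹' A).indicator
        (fun t => ENNReal.ofReal ((Icc a b).indicator f t)) (e.symm q) :=
      (hgm.indicator (hm hA)).comp e.symm.measurable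
    rw [Measure.map_apply hm hA, withDensity_apply _ (hm hA), withDensity_apply _ hA,
      ← lintegral_indicator (hm hA),
      ← (he.symm e).lintegral_comp (hgm.indicator (hm hA)), Measure.volume_eq_prod,
      lintegral_prod _ hG.aemeasurable,
      Measure.restrict_restrict hA, ← lintegral_indicator (hA.inter measurableSet_Icc)]
    refine lintegral_congr fun t => ?_
    by_cases htA : t ∈ A
    · by_cases htI : t ∈ I
      · have hAI : t ∈ A ∩ I := ⟨htA, htI⟩
        rw [indicator_of_mem hAI,
          ofReal_integral_eq_lintegral_ofReal (hint t htI)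
          ((ae_restrict_iff' measurableSet_Icc).2 (Eventually.of_forall fun r hr =>
            hc.le.trans (hbd _ ((hmem t r).2 ⟨htI, hr⟩)).1)),
                ← lintegral_indicator measurableSet_Icc]
        refine lintegral_congr fun r => ?_
        have : e.symm (t, r) ∈ (fun q => (e q).1) ⁻¹' A := by simpa using htA
        rw [indicator_of_mem this]
        by_cases hr : r ∈ J
        · rw [indicator_of_mem hr, indicator_of_mem ((hmem t r).2 ⟨htI, hr⟩)]
        · rw [indicator_of_notMem hr, indicator_of_notMem fun h => hr ((hmem t r).1 h).2,
            ENNReal.ofReal_zero]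
      · rw [indicator_of_notMem fun h => htI h.2, ← lintegral_zero
          (μ := (volume : Measure ({i // i ∉ S} → ℝ)))]
        refine lintegral_congr fun r => ?_
        rw [indicator_apply_eq_zero]
        intro _
        rw [indicator_of_notMem fun h => htI ((hmem t r).1 h).1, ENNReal.ofReal_zero]
    · rw [indicator_of_notMem fun h => htA h.1, ← lintegral_zero
          (μ := (volume : Measure ({i // i ∉ S} → ℝ)))]
      refine lintegral_congr fun r => ?_
      rw [indicator_of_notMem]
      simpa using htA
  · have := setIntegral_mono_on (integrableOn_const hJvol) (hint t ht) measurableSet_Icc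
      fun r hr => (hbd _ ((hmem t r).2 ⟨ht, hr⟩)).1
    simpa [setIntegral_const, mul_comm] using this
  · have := setIntegral_mono_on (hint t ht) (integrableOn_const hJvol) measurableSet_Icc
      fun r hr => (hbd _ ((hmem t r).2 ⟨ht, hr⟩)).2
    simpa [setIntegral_const, mul_comm] using this
  · rw [Nat.cast_zero, contDiffOn_zero]
    refine continuousOn_of_dominated (bound := fun _ => C) (fun t ht => (hint t ht).1)
      (fun t ht => (ae_restrict_iff' measurableSet_Icc).2 (Eventually.of_forall fun r hr => ?_))
      (integrableOn_const hJvol)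
      ((ae_restrict_iff' measurableSet_Icc).2 (Eventually.of_forall fun r hr => ?_))
    · have h := hbd _ ((hmem t r).2 ⟨ht, hr⟩)
      rw [Real.norm_eq_abs, abs_of_nonneg (hc.le.trans h.1)]
      exact h.2
    · exact hf.continuousOn.comp (hcont.comp (by fun_prop)).continuousOn
        fun t ht => (hmem t r).2 ⟨ht, hr⟩

end Marginal

/-! ### Conditional means and domination of weighted laws. -/

section CondMean

variable {Ω E : Type*} [mΩ : MeasurableSpace Ω] [mE : MeasurableSpace E] {P : Measure Ω}
  {φ : Ω → ℝ} {T : Ω → E} {g k : E → ℝ}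

lemma IsCondMean.condExp_mul_eq (hg : IsCondMean P φ T g) (hk : Measurable k)
    (hi : Integrable (fun ω => φ ω * k (T ω)) P) :
    P[fun ω => φ ω * k (T ω) | mE.comap T] =ᵐ[P] fun ω => g (T ω) * k (T ω) := by
  have hkT : StronglyMeasurable[mE.comap T] fun ω => k (T ω) :=
    (hk.comp (comap_measurable T)).stronglyMeasurable
  have h1 := condExp_mul_of_stronglyMeasurable_right hkT hi hg.2.1
  filter_upwards [h1, hg.2.2] with ω h2 h3
  exact h2.trans (by simp [h3])

lemma IsCondMean.integrable_mul (hg : IsCondMean P φ T g) (hk : Measurable k)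
    (hi : Integrable (fun ω => φ ω * k (T ω)) P) :
    Integrable (fun ω => g (T ω) * k (T ω)) P :=
  integrable_condExp.congr (hg.condExp_mul_eq hk hi)

lemma IsCondMean.integral_mul [IsProbabilityMeasure P] (hg : IsCondMean P φ T g)
    (hT : Measurable T) (hk : Measurable k)
    (hi : Integrable (fun ω => φ ω * k (T ω)) P) :
    ∫ ω, φ ω * k (T ω) ∂P = ∫ ω, g (T ω) * k (T ω) ∂P := by
  rw [← integral_condExp hT.comap_le]
  exact integral_congr_ae (hg.condExp_mul_eq hk hi)

/-- The tower property. It brings moment bounds given `X` down to bounds given `Z` or `X̃`. -/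
lemma ae_condExp_le_of_le [IsProbabilityMeasure P] {m m' : MeasurableSpace Ω} (hm : m ≤ m')
    (hm' : m' ≤ mΩ) {W : Ω → ℝ}
    {C : ℝ} (hC : ∀ᵐ ω ∂P, (P[W | m']) ω ≤ C) : ∀ᵐ ω ∂P, (P[W | m]) ω ≤ C := by
  have h1 : P[P[W | m'] | m] =ᵐ[P] P[W | m] := condExp_condExp_of_le hm hm'
  have h2 : P[P[W | m'] | m] ≤ᵐ[P] P[fun _ => C | m] :=
    condExp_mono integrable_condExp (integrable_const C) hC
  rw [condExp_const (hm.trans hm')] at h2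
  filter_upwards [h1, h2] with ω a b
  rw [← a]; exact b

lemma IsCondMean.ae_abs_le (hg : IsCondMean P φ T g) {W : Ω → ℝ}
    (hW : Integrable W P) (hφ : ∀ᵐ ω ∂P, |φ ω| ≤ W ω) {C : ℝ}
    (hC : ∀ᵐ ω ∂P, (P[W | mE.comap T]) ω ≤ C) : ∀ᵐ ω ∂P, |g (T ω)| ≤ C := by
  have h1 : P[φ | mE.comap T] ≤ᵐ[P] P[W | mE.comap T] :=
    condExp_mono hg.2.1 hW (by filter_upwards [hφ] with ω h using (abs_le.1 h).2)
  have h2 : P[-W | mE.comap T] ≤ᵐ[P] P[φ | mE.comap T] :=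
    condExp_mono hW.neg hg.2.1 (by
      filter_upwards [hφ] with ω h
      exact (abs_le.1 h).1)
  filter_upwards [h1, h2, condExp_neg (μ := P) W (mE.comap T), hg.2.2, hC] with ω a b c d e
  rw [← d, abs_le]
  rw [c] at b
  simp only [Pi.neg_apply] at b
  exact ⟨by linarith, by linarith⟩

/-- On an event `T ∈ A` the integrals of `W` and of its conditional expectation agree, and the
latter is at most `C` times the probability. A conditional moment bound thus becomes a domination of
measures, which can be integrated against kernels. -/
lemma map_withDensity_le [IsProbabilityMeasure P] (hT : Measurable T) {W : Ω → ℝ}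
    (hW : Integrable W P)
    (hW0 : ∀ ω, 0 ≤ W ω) {C : ℝ} (hC : ∀ᵐ ω ∂P, (P[W | mE.comap T]) ω ≤ C) :
    (P.withDensity fun ω => ENNReal.ofReal (W ω)).map T ≤ ENNReal.ofReal C • P.map T := by
  refine Measure.le_iff.2 fun A hA => ?_
  rw [Measure.smul_apply, Measure.map_apply hT hA, Measure.map_apply hT hA,
    withDensity_apply _ (hT hA), ← ofReal_integral_eq_lintegral_ofReal hW.integrableOn
    (Eventually.of_forall hW0), ← setIntegral_condExp hT.comap_le hW ⟨A, hA, rfl⟩, smul_eq_mul]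
  by_cases hC0 : 0 ≤ C
  · rw [← ENNReal.ofReal_toReal (measure_ne_top P (T ⁻¹' A)), ← ENNReal.ofReal_mul hC0]
    refine ENNReal.ofReal_le_ofReal ?_
    have := integral_mono_ae (μ := P.restrict (T ⁻¹' A)) integrable_condExp.integrableOn
      (integrable_const C) (ae_restrict_of_ae hC)
    simpa [mul_comm, Measure.real] using this
  · rw [ENNReal.ofReal_of_nonpos, ENNReal.ofReal_of_nonpos (le_of_not_ge hC0), zero_mul]
    refine integral_nonpos_of_ae (ae_restrict_of_ae ?_)
    filter_upwards [hC] with ω h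
    exact h.trans (le_of_not_ge hC0)

end CondMean

/-! ### Identification of the arms: propensity and unconfoundedness. -/

section Identification

variable {l q : ℕ}

lemma measurable_covX : Measurable (covX : Subject l q → Cov l q) := measurable_fst

lemma measurable_zPart : Measurable (zPart : Cov l q → Fin l → ℝ) := by unfold zPart; fun_prop

lemma measurable_subPart (S : Finset (Fin (l + q))) : Measurable (subPart S) := by
  unfold subPart; fun_prop

lemma measurable_covZ : Measurable (covZ : Subject l q → Fin l → ℝ) :=
  measurable_zPart.comp measurable_fst

lemma measurable_covS (S : Finset (Fin (l + q))) :
    Measurable (covS S : Subject l q → S → ℝ) :=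
  (measurable_subPart S).comp measurable_fst

lemma measurable_treat : Measurable (treat : Subject l q → Bool) :=
  measurable_fst.comp measurable_snd

lemma measurable_potential (j : Bool) : Measurable (potential j : Subject l q → ℝ) := by
  unfold potential; cases j <;> simp only [cond_true, cond_false] <;> fun_prop

lemma measurableSet_treat_eq (j : Bool) : MeasurableSet {w : Subject l q | treat w = j} :=
  measurable_treat (measurableSet_singleton j)

lemma measurable_outcome : Measurable (outcome : Subject l q → ℝ) := by
  have : (outcome : Subject l q → ℝ) =
      fun w => if treat w = true then potential true w else potential false w := by
    funext w; unfold outcome; cases treat w <;> simp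
  rw [this]
  exact Measurable.ite (measurableSet_treat_eq true) (measurable_potential _)
    (measurable_potential _)

lemma measurable_observe : Measurable (observe : Subject l q → Obs l q) :=
  measurable_covX.prodMk (measurable_treat.prodMk measurable_outcome)

/-- The probability of arm `j`, from the probability of treatment. -/
noncomputable def armProb {E : Type*} (p : E → ℝ) (j : Bool) (x : E) : ℝ :=
  bif j then p x else 1 - p x

lemma measurable_armProb {E : Type*} [MeasurableSpace E] {p : E → ℝ} (hp : Measurable p)
    (j : Bool) : Measurable (armProb p j) := by
  unfold armProb; cases j <;> simp only [cond_true, cond_false] <;> fun_prop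

variable {P : Measure (Subject l q)} [IsProbabilityMeasure P]
  {a b : Cov l q} {s : ℕ} {fX : Cov l q → ℝ} {fZ : (Fin l → ℝ) → ℝ}
  {S : Finset (Fin (l + q))} {p : (S → ℝ) → ℝ} {m : Bool → (S → ℝ) → ℝ}

lemma Population.ae_covX_mem (hP : Population P a b s fX fZ S p m) :
    ∀ᵐ w ∂P, covX w ∈ Icc a b :=
  ae_of_ae_map measurable_covX.aemeasurable hP.density_X.ae_mem

lemma Population.ae_covS_mem (hP : Population P a b s fX fZ S p m) :
    ∀ᵐ w ∂P, covS S w ∈ Icc (subPart S a) (subPart S b) := by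
  filter_upwards [hP.ae_covX_mem] with w hw
  exact ⟨fun i => hw.1 i, fun i => hw.2 i⟩

lemma Population.ae_armProb_mem (hP : Population P a b s fX fZ S p m) (j : Bool) :
    ∀ᵐ w ∂P, 0 ≤ armProb p j (covS S w) ∧ armProb p j (covS S w) ≤ 1 := by
  obtain ⟨c, hc, h⟩ := hP.overlap
  filter_upwards [hP.ae_covS_mem] with w hw
  have := h _ hw
  cases j <;> simp only [armProb, cond_true, cond_false] <;> constructor <;> linarith

lemma Population.integrable_armProb_mul (hP : Population P a b s fX fZ S p m) (j : Bool)
    {F : Subject l q → ℝ} (hF : Integrable F P) :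
    Integrable (fun w => armProb p j (covS S w) * F w) P := by
  refine hF.bdd_mul (c := 1)
    ((measurable_armProb hP.propensity.1 j).comp (measurable_covS S)).aestronglyMeasurable ?_
  filter_upwards [hP.ae_armProb_mem j] with w hw
  rw [Real.norm_eq_abs, abs_of_nonneg hw.1]
  exact hw.2

lemma Population.isCondMean_armProb (hP : Population P a b s fX fZ S p m) (j : Bool) :
    IsCondMean P ({w | treat w = j}.indicator fun _ => (1 : ℝ)) (covS S) (armProb p j) := by
  have hi : ∀ j : Bool, Integrable ({w : Subject l q | treat w = j}.indicator
      fun _ => (1 : ℝ)) P := fun j => (integrable_const 1).indicator (measurableSet_treat_eq j)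
  have ht : ({w : Subject l q | treat w = true}.indicator fun _ => (1 : ℝ)) =
      fun w => dnum (treat w) := by
    funext w
    by_cases h : treat w = true <;> simp [h, dnum]
  refine ⟨measurable_armProb hP.propensity.1 j, hi j, ?_⟩
  cases j with
  | true =>
    rw [ht]
    exact hP.propensity.2.2
  | false =>
    have hf : ({w : Subject l q | treat w = false}.indicator fun _ => (1 : ℝ)) =
        (fun _ => 1) - fun w => dnum (treat w) := by
      funext w
      by_cases h : treat w = true <;> simp [h, dnum]
    rw [hf]
    have h1 := condExp_sub (integrable_const (1 : ℝ)) hP.propensity.2.1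
      (MeasurableSpace.comap (covS S) inferInstance)
    rw [condExp_const (measurable_covS S).comap_le] at h1
    filter_upwards [h1, hP.propensity.2.2] with w hw1 hw2
    rw [hw1, Pi.sub_apply, hw2]
    rfl

/-- `P(D = j | X)` depends on `X` only through the subvector. -/
lemma Population.condExp_treat (hP : Population P a b s fX fZ S p m) (j : Bool) :
    P[{w | treat w = j}.indicator fun _ => (1 : ℝ) | MeasurableSpace.comap covX inferInstance]
      =ᵐ[P] fun w => armProb p j (covS S w) := by
  have hpm := measurable_armProb hP.propensity.1 j
  have hcm := hP.isCondMean_armProb j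
  have hsm : Measurable[MeasurableSpace.comap (covX (l := l) (q := q)) inferInstance]
      (covS S : Subject l q → S → ℝ) := (measurable_subPart S).comp (comap_measurable covX)
  refine (ae_eq_condExp_of_forall_setIntegral_eq measurable_covX.comap_le hcm.2.1
    (fun A _ _ => ?_) (fun A hA _ => ?_) (hpm.comp hsm).aestronglyMeasurable).symm
  · have := hP.integrable_armProb_mul j (integrable_const 1)
    simp only [mul_one] at this
    exact this.integrableOn
  · have hA' : MeasurableSet A := measurable_covX.comap_le A hA
    -- For an event `A` of `X`, independence given `X̃` factorises the conditional probability of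
    -- `A` together with arm `j`. The factor `armProb p j` is a function of `X̃`, so it passes
    -- through the conditional expectation and both integrals over `A` agree.
    have hind := (condIndepFun_iff _ (Measurable.comap_le (measurable_covS S)) treat covX
      measurable_treat measurable_covX P).1 hP.sufficient {w | treat w = j} A
      ⟨{j}, measurableSet_singleton j, rfl⟩ hA
    have hiA : Integrable (A.indicator fun _ => (1 : ℝ)) P := (integrable_const 1).indicator hA'
    have hpull : P[fun w => armProb p j (covS S w) * A.indicator (fun _ => (1 : ℝ)) w |
        MeasurableSpace.comap (covS S) inferInstance] =ᵐ[P] fun w => armProb p j (covS S w) *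
          (P[A.indicator fun _ => (1 : ℝ) | MeasurableSpace.comap (covS S) inferInstance]) w :=
      condExp_mul_of_stronglyMeasurable_left
        (hpm.comp (comap_measurable (covS S))).stronglyMeasurable
        (hP.integrable_armProb_mul j hiA) hiA
    rw [← integral_indicator hA', ← integral_indicator hA']
    have e1 : A.indicator ({w : Subject l q | treat w = j}.indicator fun _ => (1 : ℝ)) =
        ({w | treat w = j} ∩ A).indicator fun _ => (1 : ℝ) := by
      rw [indicator_indicator, inter_comm]
    have e2 : A.indicator (armProb p j ∘ covS S) =
        fun w => armProb p j (covS S w) * A.indicator (fun _ => (1 : ℝ)) w := by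
      funext w; by_cases hw : w ∈ A <;> simp [hw]
    rw [e1, e2, ← integral_condExp (measurable_covS S).comap_le,
      ← integral_condExp (measurable_covS S).comap_le
        (f := ({w | treat w = j} ∩ A).indicator fun _ => (1 : ℝ))]
    refine integral_congr_ae ?_
    filter_upwards [hpull, hind, hcm.2.2] with w h1 h2 h3
    rw [h1, h2, Pi.mul_apply, h3]

/-- Restricting to arm `j` acts on the law of `(X, Y(0), Y(1))` as weighting by the probability
of arm `j`. -/
lemma Population.map_restrict_treat (hP : Population P a b s fX fZ S p m) (j : Bool) :
    (P.restrict {w | treat w = j}).map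
        (fun w => (covX w, potential false w, potential true w)) =
      (P.withDensity fun w => ENNReal.ofReal (armProb p j (covS S w))).map
        (fun w => (covX w, potential false w, potential true w)) := by
  have hYm : Measurable fun w : Subject l q => (potential false w, potential true w) :=
    (measurable_potential _).prodMk (measurable_potential _)
  have hm : Measurable fun w : Subject l q => (covX w, potential false w, potential true w) :=
    measurable_covX.prodMk hYm
  have hpm := measurable_armProb hP.propensity.1 j
  -- Rectangles determine the law. On `A ×ˢ B`, unconfoundedness splits the outcome event from arm
  -- `j` given `X`, and `condExp_treat` evaluates the second factor.
  refine Measure.ext_prod fun {A B} hA hB => ?_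
  have hAm := measurable_covX (l := l) (q := q) hA
  have hBm := hYm hB
  have hset : (fun w : Subject l q => (covX w, potential false w, potential true w)) ⁻¹' (A ×ˢ B) =
      covX ⁻¹' A ∩ (fun w => (potential false w, potential true w)) ⁻¹' B := rfl
  rw [Measure.map_apply hm (hA.prod hB), Measure.map_apply hm (hA.prod hB), hset,
    Measure.restrict_apply (hAm.inter hBm), withDensity_apply _ (hAm.inter hBm)]
  set A' : Set (Subject l q) := covX ⁻¹' A with hA'
  set B' : Set (Subject l q) := (fun w => (potential false w, potential true w)) ⁻¹' B with hB'
  have hind := (condIndepFun_iff _ (Measurable.comap_le measurable_covX)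
    (fun w : Subject l q => (potential false w, potential true w)) treat
    hYm measurable_treat P).1 hP.unconfounded B' {w | treat w = j} ⟨B, hB, rfl⟩
    ⟨{j}, measurableSet_singleton j, rfl⟩
  have hiB : Integrable (B'.indicator fun _ => (1 : ℝ)) P := (integrable_const 1).indicator hBm
  have hpull : P[fun w => armProb p j (covS S w) * B'.indicator (fun _ => (1 : ℝ)) w |
      MeasurableSpace.comap covX inferInstance] =ᵐ[P] fun w => armProb p j (covS S w) *
        (P[B'.indicator fun _ => (1 : ℝ) | MeasurableSpace.comap covX inferInstance]) w :=
    condExp_mul_of_stronglyMeasurable_left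
      ((hpm.comp (measurable_subPart S)).comp (comap_measurable covX)).stronglyMeasurable
      (hP.integrable_armProb_mul j hiB) hiB
  have hj := measurableSet_treat_eq (l := l) (q := q) j
  have key : ∫ w in A', (B' ∩ {w | treat w = j}).indicator (fun _ => (1 : ℝ)) w ∂P =
      ∫ w in A', armProb p j (covS S w) * B'.indicator (fun _ => (1 : ℝ)) w ∂P := by
    rw [← setIntegral_condExp measurable_covX.comap_le
      ((integrable_const 1).indicator (hBm.inter hj)) ⟨A, hA, rfl⟩,
      ← setIntegral_condExp measurable_covX.comap_le
      (hP.integrable_armProb_mul j hiB) ⟨A, hA, rfl⟩]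
    refine integral_congr_ae (ae_restrict_of_ae ?_)
    filter_upwards [hpull, hind, hP.condExp_treat j] with w h1 h2 h3
    rw [h1, h2, Pi.mul_apply, h3, mul_comm]
  have e2 : ∀ w, armProb p j (covS S w) * B'.indicator (fun _ => (1 : ℝ)) w =
      B'.indicator (fun w => armProb p j (covS S w)) w := by
    intro w; by_cases hw : w ∈ B' <;> simp [hw]
  have hip : Integrable (fun w => armProb p j (covS S w)) P := by
    simpa using hP.integrable_armProb_mul j (integrable_const 1)
  simp_rw [e2] at key
  rw [setIntegral_indicator (hBm.inter hj), setIntegral_indicator hBm,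
    setIntegral_const, smul_eq_mul, mul_one] at key
  rw [← ofReal_integral_eq_lintegral_ofReal hip.integrableOn
    (ae_restrict_of_ae (by filter_upwards [hP.ae_armProb_mem j] with w hw using hw.1)), ← key,
    Measure.real, ENNReal.ofReal_toReal (measure_ne_top _ _)]
  congr 1
  ext w; simp only [mem_inter_iff]; tauto

/-- Because it comes from an equality of laws, no integrability of `F` has to be assumed. -/
lemma Population.setIntegral_treat (hP : Population P a b s fX fZ S p m) (j : Bool)
    {F : Cov l q × ℝ × ℝ → ℝ} (hF : Measurable F) :
    ∫ w in {w | treat w = j}, F (covX w, potential false w, potential true w) ∂P =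
      ∫ w, armProb p j (covS S w) * F (covX w, potential false w, potential true w) ∂P := by
  have hm : Measurable fun w : Subject l q => (covX w, potential false w, potential true w) :=
    measurable_covX.prodMk ((measurable_potential _).prodMk (measurable_potential _))
  have hpm : Measurable fun w : Subject l q => armProb p j (covS S w) :=
    (measurable_armProb hP.propensity.1 j).comp (measurable_covS S)
  rw [← integral_map hm.aemeasurable hF.aestronglyMeasurable (μ := P.restrict _),
    hP.map_restrict_treat j, integral_map hm.aemeasurable hF.aestronglyMeasurable,
    integral_withDensity_eq_integral_toReal_smul hpm.ennreal_ofReal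
      (Eventually.of_forall fun _ => ENNReal.ofReal_lt_top)]
  refine integral_congr_ae ?_
  filter_upwards [hP.ae_armProb_mem j] with w hw
  simp only [ENNReal.toReal_ofReal hw.1, smul_eq_mul]

end Identification

/-- The form in which domination of weighted laws is applied: the weight `W` is traded for a
constant in any integral against a nonnegative function of `T`. -/
lemma lintegral_mul_comp_le {Ω E : Type*} [MeasurableSpace Ω] [MeasurableSpace E] {P : Measure Ω}
    {T : Ω → E} (hT : Measurable T) {W : Ω → ENNReal} (hW : Measurable W) {ν : Measure E}
    {C : ENNReal} (h : (P.withDensity W).map T ≤ C • ν) {k : E → ENNReal} (hk : Measurable k) :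
    ∫⁻ ω, W ω * k (T ω) ∂P ≤ C * ∫⁻ x, k x ∂ν := by
  have h1 := lintegral_mono' h (le_refl k)
  have hkT : Measurable fun ω => k (T ω) := hk.comp hT
  rw [lintegral_map hk hT, lintegral_smul_measure,
    lintegral_withDensity_eq_lintegral_mul _ hW hkT] at h1
  exact h1

/-! ### Envelopes, inverse probability weighting and moments of the scores. -/

section Moments

variable {l q : ℕ} {P : Measure (Subject l q)} [IsProbabilityMeasure P]
  {a b : Cov l q} {s : ℕ} {fX : Cov l q → ℝ} {fZ : (Fin l → ℝ) → ℝ}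
  {S : Finset (Fin (l + q))} {p : (S → ℝ) → ℝ} {m : Bool → (S → ℝ) → ℝ}

/-- An envelope for functions of at most quadratic growth in the potential outcomes. -/
def envelope (w : Subject l q) : ℝ := 1 + (potential false w ^ 2 + potential true w ^ 2)

lemma measurable_envelope : Measurable (envelope : Subject l q → ℝ) :=
  measurable_const.add (((measurable_potential _).pow_const 2).add
    ((measurable_potential _).pow_const 2))

lemma envelope_pos (w : Subject l q) : 0 < envelope w := by unfold envelope; positivity

lemma potential_sq_le_envelope (j : Bool) (w : Subject l q) :
    1 + potential j w ^ 2 ≤ envelope w := by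
  unfold envelope
  cases j <;> nlinarith [sq_nonneg (potential false w), sq_nonneg (potential true w)]

lemma outcome_sq_le_envelope (w : Subject l q) : 1 + outcome w ^ 2 ≤ envelope w :=
  potential_sq_le_envelope _ w

lemma Population.integrable_envelope (hP : Population P a b s fX fZ S p m) :
    Integrable (envelope : Subject l q → ℝ) P :=
  (integrable_const 1).add ((hP.sq_integrable false).add (hP.sq_integrable true))

/-- The bound given `X` descends to every function `g` of `X`; the constant is chosen before `g`, so
the same one serves `Z` and `X̃`. -/
lemma Population.exists_condExp_envelope_le (hP : Population P a b s fX fZ S p m) :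
    ∃ C : ℝ, 0 < C ∧ ∀ {E : Type} [MeasurableSpace E] (g : Cov l q → E),
      Measurable g → ∀ᵐ w ∂P,
        (P[envelope | MeasurableSpace.comap (fun w => g (covX w)) inferInstance]) w ≤ C := by
  obtain ⟨C, hC⟩ := hP.sq_bounded
  refine ⟨max (1 + (C + C)) 1, by positivity, fun {E} _ g hg => ?_⟩
  have hle : MeasurableSpace.comap (g ∘ covX (l := l) (q := q)) inferInstance ≤
      MeasurableSpace.comap covX inferInstance := by
    rw [← MeasurableSpace.comap_comp]
    exact MeasurableSpace.comap_mono hg.comap_le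
  refine ae_condExp_le_of_le hle measurable_covX.comap_le ?_
  have h1 := condExp_add (integrable_const (1 : ℝ))
    ((hP.sq_integrable false).add (hP.sq_integrable true))
    (MeasurableSpace.comap (covX (l := l) (q := q)) inferInstance)
  have h2 := condExp_add (hP.sq_integrable false) (hP.sq_integrable true)
    (MeasurableSpace.comap (covX (l := l) (q := q)) inferInstance)
  rw [condExp_const measurable_covX.comap_le] at h1
  filter_upwards [h1, h2, hC false, hC true] with w e1 e2 e3 e4
  refine le_trans (le_of_eq e1) ((le_max_left _ _).trans' ?_)
  rw [Pi.add_apply, e2, Pi.add_apply]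
  linarith

/-- Weighting by the envelope at most multiplies the law of a function of `X` by a constant. -/
lemma Population.exists_map_envelope_le (hP : Population P a b s fX fZ S p m) :
    ∃ C : ℝ, 0 < C ∧ ∀ {E : Type} [MeasurableSpace E] (g : Cov l q → E), Measurable g →
      (P.withDensity fun w => ENNReal.ofReal (envelope w)).map (fun w => g (covX w)) ≤
        ENNReal.ofReal C • P.map fun w => g (covX w) := by
  obtain ⟨C, hC, h⟩ := hP.exists_condExp_envelope_le
  refine ⟨C, hC, fun g hg => map_withDensity_le (hg.comp measurable_covX) hP.integrable_envelope
    (fun w => (envelope_pos w).le) (h g hg)⟩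

lemma Population.integrable_envelope_mul (hP : Population P a b s fX fZ S p m) {E : Type}
    [MeasurableSpace E] {g : Cov l q → E} (hg : Measurable g) {k : E → ℝ} (hk : Measurable k)
    (hi : Integrable (fun w => k (g (covX w))) P) :
    Integrable (fun w => envelope w * k (g (covX w))) P := by
  obtain ⟨C, hC, h⟩ := hP.exists_map_envelope_le
  have hgX : Measurable fun w : Subject l q => g (covX w) := hg.comp measurable_covX
  refine ⟨(measurable_envelope.mul (hk.comp hgX)).aestronglyMeasurable, ?_⟩
  have h1 := lintegral_mul_comp_le hgX measurable_envelope.ennreal_ofReal (h g hg) hk.enorm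
  rw [lintegral_map hk.enorm hgX] at h1
  refine lt_of_le_of_lt (le_trans (le_of_eq ?_) h1)
    (ENNReal.mul_lt_top ENNReal.ofReal_lt_top hi.2)
  refine lintegral_congr fun w => ?_
  rw [enorm_mul, Real.enorm_of_nonneg (envelope_pos w).le]

/-- Products with functions of `X` are integrable when they are so for constant outcomes. -/
lemma Population.integrable_mul_of_le (hP : Population P a b s fX fZ S p m) {E : Type}
    [MeasurableSpace E] {g : Cov l q → E} (hg : Measurable g) {k : E → ℝ} (hk : Measurable k)
    (hi : Integrable (fun w => k (g (covX w))) P) {φ : Subject l q → ℝ} (hφ : Measurable φ)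
    {C : ℝ} (hC : ∀ᵐ w ∂P, |φ w| ≤ C * envelope w) :
    Integrable (fun w => φ w * k (g (covX w))) P := by
  refine ((hP.integrable_envelope_mul hg hk hi).const_mul C).norm.mono'
    (hφ.mul (hk.comp (hg.comp measurable_covX))).aestronglyMeasurable ?_
  filter_upwards [hC] with w hw
  rw [← mul_assoc, norm_mul, norm_mul (C * envelope w), Real.norm_eq_abs, Real.norm_eq_abs]
  gcongr
  exact hw.trans (le_abs_self _)

lemma Population.ae_abs_le (hP : Population P a b s fX fZ S p m)
    {φ : Subject l q → ℝ} {C : ℝ} (hC : ∀ᵐ w ∂P, |φ w| ≤ C * envelope w) {g : (Fin l → ℝ) → ℝ}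
    (hg : IsCondMean P φ covZ g) : ∃ C' : ℝ, ∀ᵐ w ∂P, |g (covZ w)| ≤ C' := by
  obtain ⟨C₁, hC₁, h⟩ := hP.exists_condExp_envelope_le
  refine ⟨max C 0 * C₁, hg.ae_abs_le (hP.integrable_envelope.const_mul (max C 0)) ?_ ?_⟩
  · filter_upwards [hC] with w hw
    exact hw.trans (mul_le_mul_of_nonneg_right (le_max_left _ _) (envelope_pos w).le)
  · have h2 := condExp_smul (μ := P) (max C 0) (envelope (l := l) (q := q))
      (MeasurableSpace.comap (covZ : Subject l q → _) inferInstance)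
    filter_upwards [h zPart measurable_zPart, h2] with w h3 h4
    refine le_trans (le_of_eq h4) ?_
    simp only [Pi.smul_apply, smul_eq_mul]
    gcongr
    exact h3

/-- Weighting by the inverse probability of arm `j` identifies means of potential outcomes. -/
lemma Population.integral_inverse_weighted (hP : Population P a b s fX fZ S p m) (j : Bool)
    {F : Cov l q × ℝ × ℝ → ℝ} (hF : Measurable F) :
    ∫ w in {w | treat w = j}, F (covX w, potential false w, potential true w) /
      armProb p j (covS S w) ∂P = ∫ w, F (covX w, potential false w, potential true w) ∂P := by
  have hm : Measurable fun x : Cov l q × ℝ × ℝ => F x / armProb p j (subPart S x.1) :=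
    hF.div ((measurable_armProb hP.propensity.1 j).comp
      ((measurable_subPart S).comp measurable_fst))
  refine (hP.setIntegral_treat j hm).trans (integral_congr_ae ?_)
  obtain ⟨c, hc, h⟩ := hP.overlap
  filter_upwards [hP.ae_covS_mem] with w hw
  have hpos : armProb p j (covS S w) ≠ 0 := by
    have := h _ hw
    cases j <;> simp only [armProb, cond_true, cond_false] <;> intro h0 <;> linarith
  exact mul_div_cancel₀ _ hpos

/-- The augmented inverse-probability-weighted score with regression functions `g`; for `g = 0`
this is the inverse-probability-weighted score. -/
noncomputable def score (S : Finset (Fin (l + q))) (p : (S → ℝ) → ℝ) (g : Bool → (S → ℝ) → ℝ)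
    (o : Obs l q) : ℝ :=
  psiStar (p (subPart S o.1)) (g false (subPart S o.1)) (g true (subPart S o.1)) o.2.1 o.2.2

lemma measurable_dnum : Measurable dnum := measurable_of_countable _

lemma measurable_score (hp : Measurable p) {g : Bool → (S → ℝ) → ℝ} (hg : ∀ j, Measurable (g j)) :
    Measurable (score S p g) := by
  have h1 : Measurable fun o : Obs l q => p (subPart S o.1) :=
    hp.comp ((measurable_subPart S).comp measurable_fst)
  have h2 : ∀ j, Measurable fun o : Obs l q => g j (subPart S o.1) := fun j =>
    (hg j).comp ((measurable_subPart S).comp measurable_fst)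
  have h3 : Measurable fun o : Obs l q => dnum o.2.1 :=
    measurable_dnum.comp (measurable_fst.comp measurable_snd)
  have h4 : Measurable fun o : Obs l q => o.2.2 := measurable_snd.comp measurable_snd
  unfold score psiStar
  exact ((((h3.mul (h4.sub (h2 true))).div h1).sub
    (((measurable_const.sub h3).mul (h4.sub (h2 false))).div (measurable_const.sub h1))).add
    (h2 true)).sub (h2 false)

lemma abs_psiStar_le {c M p₀ m₀ m₁ y : ℝ} {d : Bool} (hc : 0 < c) (hp : c < p₀ ∧ p₀ < 1 - c)
    (h0 : |m₀| ≤ M) (h1 : |m₁| ≤ M) :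
    |psiStar p₀ m₀ m₁ d y| ≤ (|y| + M) / c + 2 * M := by
  have hM : 0 ≤ M := (abs_nonneg _).trans h0
  have h2 : |m₁ - m₀| ≤ 2 * M := (abs_sub _ _).trans (by linarith)
  have key : ∀ r x : ℝ, c < r → |x| ≤ M → |(y - x) / r| ≤ (|y| + M) / c := by
    intro r x hr hx
    rw [abs_div, abs_of_pos (hc.trans hr)]
    have : |y - x| ≤ |y| + M := (abs_sub _ _).trans (by linarith)
    gcongr
  cases d
  · have : psiStar p₀ m₀ m₁ false y = -((y - m₀) / (1 - p₀)) + (m₁ - m₀) := by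
      simp [psiStar, dnum]; ring
    rw [this]
    refine (abs_add_le _ _).trans (add_le_add ?_ h2)
    rw [abs_neg]
    exact key _ _ (by linarith [hp.2]) h0
  · have : psiStar p₀ m₀ m₁ true y = (y - m₁) / p₀ + (m₁ - m₀) := by
      simp [psiStar, dnum]; ring
    rw [this]
    exact (abs_add_le _ _).trans (add_le_add (key _ _ hp.1 h1) h2)

/-- Bounds on the score on the support of `X`. -/
lemma exists_abs_score_le {A B : S → ℝ}
    (hover : ∃ c : ℝ, 0 < c ∧ ∀ x ∈ Icc A B, c < p x ∧ p x < 1 - c) {g : Bool → (S → ℝ) → ℝ}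
    {M : ℝ} (hM : ∀ j, ∀ x ∈ Icc A B, |g j x| ≤ M) : ∃ C : ℝ, 0 < C ∧ ∀ o : Obs l q,
      subPart S o.1 ∈ Icc A B → |score S p g o| ≤ C * (1 + o.2.2 ^ 2) ∧
        score S p g o ^ 2 ≤ C * (1 + o.2.2 ^ 2) := by
  obtain ⟨c, hc, h⟩ := hover
  let N := max M 0
  have hN : 0 ≤ N := le_max_right _ _
  let D := (1 + N) / c + 2 * N
  have hD : 0 < D := by positivity
  refine ⟨2 * D + 2 * D ^ 2, by positivity, fun o ho => ?_⟩
  have h1 : |score S p g o| ≤ D * (1 + |o.2.2|) := by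
    refine (abs_psiStar_le hc (h _ ho) ((hM false _ ho).trans (le_max_left M 0))
      ((hM true _ ho).trans (le_max_left M 0))).trans ?_
    have h2 : (|o.2.2| + N) / c ≤ (1 + N) / c * (1 + |o.2.2|) := by
      rw [div_mul_eq_mul_div]
      gcongr
      nlinarith [abs_nonneg o.2.2]
    have h3 : 2 * N ≤ 2 * N * (1 + |o.2.2|) := by nlinarith [abs_nonneg o.2.2]
    calc _ ≤ (1 + N) / c * (1 + |o.2.2|) + 2 * N * (1 + |o.2.2|) := add_le_add h2 h3
      _ = _ := by ring
  have h4 : |o.2.2| ≤ (1 + o.2.2 ^ 2) / 2 := by nlinarith [sq_nonneg (|o.2.2| - 1), sq_abs o.2.2]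
  have h5 : 0 ≤ o.2.2 ^ 2 := sq_nonneg _
  constructor
  · refine h1.trans ?_
    have h6 : 1 + |o.2.2| ≤ 2 * (1 + o.2.2 ^ 2) := by linarith
    calc D * (1 + |o.2.2|) ≤ D * (2 * (1 + o.2.2 ^ 2)) := by gcongr
      _ ≤ (2 * D + 2 * D ^ 2) * (1 + o.2.2 ^ 2) := by
        rw [← mul_assoc, mul_comm D 2]; gcongr; nlinarith
  · rw [← sq_abs]
    have h6 : |score S p g o| ^ 2 ≤ (D * (1 + |o.2.2|)) ^ 2 :=
      pow_le_pow_left₀ (abs_nonneg _) h1 2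
    refine h6.trans ?_
    rw [mul_pow]
    have h7 : (1 + |o.2.2|) ^ 2 ≤ 2 * (1 + o.2.2 ^ 2) := by
      nlinarith [sq_nonneg (|o.2.2| - 1), sq_abs o.2.2]
    nlinarith [mul_le_mul_of_nonneg_left h7 (sq_nonneg D), mul_nonneg hD.le h5]

variable {g : Bool → (S → ℝ) → ℝ} {M : ℝ}

lemma Population.exists_ae_score_le (hP : Population P a b s fX fZ S p m)
    (hM : ∀ j, ∀ x ∈ Icc (subPart S a) (subPart S b), |g j x| ≤ M) : ∃ C : ℝ, 0 < C ∧
      ∀ᵐ w ∂P, |score S p g (observe w)| ≤ C * envelope w ∧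
        score S p g (observe w) ^ 2 ≤ C * envelope w := by
  obtain ⟨C, hC, h⟩ := exists_abs_score_le (l := l) (q := q) hP.overlap hM
  refine ⟨C, hC, ?_⟩
  filter_upwards [hP.ae_covS_mem] with w hw
  have h1 := h (observe w) hw
  have h2 := mul_le_mul_of_nonneg_left (outcome_sq_le_envelope w) hC.le
  exact ⟨h1.1.trans h2, h1.2.trans h2⟩

/-- The score has the conditional mean `τ` given `Z`. -/
lemma Population.integral_score_mul (hP : Population P a b s fX fZ S p m)
    (hg : ∀ j, Measurable (g j))
    (hM : ∀ j, ∀ x ∈ Icc (subPart S a) (subPart S b), |g j x| ≤ M)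
    {τ : (Fin l → ℝ) → ℝ} (hτ : IsCATE P τ) {k : (Fin l → ℝ) → ℝ} (hk : Measurable k)
    (hi : Integrable (fun w => k (covZ w)) P) :
    ∫ w, score S p g (observe w) * k (covZ w) ∂P = ∫ w, τ (covZ w) * k (covZ w) ∂P := by
  obtain ⟨c, hc, hover⟩ := hP.overlap
  have hpm := hP.propensity.1
  let F : Bool → Cov l q × ℝ × ℝ → ℝ := fun j x =>
    ((bif j then x.2.2 else x.2.1) - g j (subPart S x.1)) * k (zPart x.1)
  have hgm : ∀ j, Measurable fun x : Cov l q × ℝ × ℝ => g j (subPart S x.1) := fun j =>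
    (hg j).comp ((measurable_subPart S).comp measurable_fst)
  have hkm : Measurable fun x : Cov l q × ℝ × ℝ => k (zPart x.1) :=
    hk.comp (measurable_zPart.comp measurable_fst)
  have hF : ∀ j, Measurable (F j) := by
    intro j
    refine Measurable.mul (Measurable.sub ?_ (hgm j)) hkm
    cases j <;> simp only [cond_true, cond_false] <;> fun_prop
  have hval : ∀ j (w : Subject l q), F j (covX w, potential false w, potential true w) =
      (potential j w - g j (covS S w)) * k (covZ w) := by
    intro j w; cases j <;> rfl
  have hgS : ∀ j, Measurable fun w : Subject l q => g j (covS S w) := fun j =>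
    (hg j).comp (measurable_covS S)
  have hsqrt : ∀ j (w : Subject l q), |potential j w| ≤ envelope w := fun j w => by
    nlinarith [potential_sq_le_envelope j w, sq_nonneg (|potential j w| - 1),
      sq_abs (potential j w)]
  have henv1 : ∀ w : Subject l q, 1 ≤ envelope w := fun w => by
    nlinarith [potential_sq_le_envelope false w, sq_nonneg (potential false w)]
  have hbd : ∀ j, ∀ᵐ w ∂P, |g j (covS S w)| ≤ |M| * envelope w := by
    intro j
    filter_upwards [hP.ae_covS_mem] with w hw
    have h1 := (hM j _ hw).trans (le_abs_self M)
    nlinarith [henv1 w, abs_nonneg M, mul_le_mul_of_nonneg_left (henv1 w) (abs_nonneg M)]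
  have hgi : ∀ j, Integrable (fun w => g j (covS S w) * k (covZ w)) P := fun j =>
    hP.integrable_mul_of_le measurable_zPart hk hi (hgS j) (hbd j)
  have hYi : ∀ j, Integrable (fun w => potential j w * k (covZ w)) P := fun j =>
    hP.integrable_mul_of_le (C := 1) measurable_zPart hk hi (measurable_potential j)
      (Eventually.of_forall fun w => by rw [one_mul]; exact hsqrt j w)
  have hFi : ∀ j, Integrable (fun w => F j (covX w, potential false w, potential true w)) P := by
    intro j
    simp_rw [hval, sub_mul]
    exact (hYi j).sub (hgi j)
  have hdivm : ∀ j, Measurable fun w : Subject l q =>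
      {w | treat w = j}.indicator (fun w => (potential j w - g j (covS S w)) /
        armProb p j (covS S w)) w := fun j =>
    (((measurable_potential j).sub (hgS j)).div ((measurable_armProb hpm j).comp
      (measurable_covS S))).indicator (measurableSet_treat_eq j)
  have harm : ∀ j x, x ∈ Icc (subPart S a) (subPart S b) → c < armProb p j x := by
    intro j x hx
    have := hover x hx
    cases j <;> simp only [armProb, cond_true, cond_false] <;> linarith
  have hdivi : ∀ j, Integrable (fun w => {w | treat w = j}.indicator
      (fun w => (potential j w - g j (covS S w)) / armProb p j (covS S w)) w * k (covZ w)) P := by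
    intro j
    refine hP.integrable_mul_of_le (C := (1 + |M|) / c) measurable_zPart hk hi (hdivm j) ?_
    filter_upwards [hP.ae_covS_mem, hbd j] with w hw hw2
    refine (norm_indicator_le_norm_self (E := ℝ) _ _).trans ?_
    have hlt := harm j _ hw
    rw [Real.norm_eq_abs, abs_div, abs_of_pos (hc.trans hlt), div_mul_eq_mul_div]
    have : |potential j w - g j (covS S w)| ≤ (1 + |M|) * envelope w :=
      (abs_sub _ _).trans (by linarith [hsqrt j w])
    have h0 : 0 ≤ (1 + |M|) * envelope w := (abs_nonneg _).trans this
    gcongr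
  -- The score is the weighted residual of the treated, minus that of the untreated, plus `g₁ - g₀`.
  have hdec : ∀ w : Subject l q, score S p g (observe w) * k (covZ w) =
      ({w | treat w = true}.indicator
        (fun w => (potential true w - g true (covS S w)) / armProb p true (covS S w)) w *
          k (covZ w) -
      {w | treat w = false}.indicator
        (fun w => (potential false w - g false (covS S w)) / armProb p false (covS S w)) w *
          k (covZ w)) +
      (g true (covS S w) * k (covZ w) - g false (covS S w) * k (covZ w)) := by
    intro w
    have h1 : score S p g (observe w) = psiStar (p (covS S w)) (g false (covS S w))
      (g true (covS S w)) (treat w) (outcome w) := rfl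
    have h2 : outcome w = potential (treat w) w := rfl
    rw [h1, h2]
    cases ht : treat w
    · simp [indicator, ht, psiStar, dnum, armProb]; ring
    · simp [indicator, ht, psiStar, dnum, armProb]; ring
  -- Weighting turns the residual of arm `j` into the mean of `Y(j) - g_j`, which removes `g₁ - g₀`
  -- again. Nothing requires `g` to be the true regression.
  have hint : ∀ j, ∫ w, {w | treat w = j}.indicator
      (fun w => (potential j w - g j (covS S w)) / armProb p j (covS S w)) w * k (covZ w) ∂P =
      ∫ w, potential j w * k (covZ w) ∂P - ∫ w, g j (covS S w) * k (covZ w) ∂P := by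
    intro j
    rw [← integral_sub (hYi j) (hgi j)]
    have h1 := hP.integral_inverse_weighted j (hF j)
    rw [← integral_indicator (measurableSet_treat_eq j)] at h1
    simp_rw [hval] at h1
    refine Eq.trans (integral_congr_ae (Eventually.of_forall fun w => ?_)) (h1.trans
      (integral_congr_ae (Eventually.of_forall fun w => by simp only; ring)))
    by_cases hw : treat w = j
    · simp [indicator, hw]; ring
    · simp [indicator, hw]
  simp_rw [hdec]
  rw [integral_add (f := fun w => _ - _) (g := fun w => _ - _) ((hdivi true).sub (hdivi false))
      ((hgi true).sub (hgi false)),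
    integral_sub (hdivi true) (hdivi false), integral_sub (hgi true) (hgi false), hint, hint]
  have hdiff : Integrable (fun w => (potential true w - potential false w) * k (covZ w)) P := by
    simp_rw [sub_mul]; exact (hYi true).sub (hYi false)
  rw [← hτ.integral_mul measurable_covZ hk hdiff]
  simp_rw [sub_mul]
  rw [integral_sub (hYi true) (hYi false)]
  ring

lemma Population.exists_ae_cate_le (hP : Population P a b s fX fZ S p m)
    {τ : (Fin l → ℝ) → ℝ} (hτ : IsCATE P τ) : ∃ C : ℝ, ∀ᵐ w ∂P, |τ (covZ w)| ≤ C := by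
  refine hP.ae_abs_le (C := 1) (Eventually.of_forall fun w => ?_) hτ
  rw [one_mul, envelope]
  refine (abs_sub _ _).trans ?_
  nlinarith [sq_nonneg (|potential true w| - 1), sq_abs (potential true w),
    sq_nonneg (|potential false w| - 1), sq_abs (potential false w)]

lemma Population.ae_deviation_le (hP : Population P a b s fX fZ S p m)
    (hM : ∀ j, ∀ x ∈ Icc (subPart S a) (subPart S b), |g j x| ≤ M)
    {τ : (Fin l → ℝ) → ℝ} (hτ : IsCATE P τ) : ∃ C : ℝ, 0 < C ∧
      ∀ᵐ w ∂P, |(score S p g (observe w) - τ (covZ w)) ^ 2| ≤ C * envelope w := by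
  obtain ⟨C, hC, h⟩ := hP.exists_ae_score_le hM
  obtain ⟨D, hD⟩ := hP.exists_ae_cate_le hτ
  refine ⟨2 * C + 2 * D ^ 2, by positivity, ?_⟩
  filter_upwards [h, hD] with w h1 h2
  have henv1 : 1 ≤ envelope w := by
    nlinarith [potential_sq_le_envelope false w, sq_nonneg (potential false w)]
  have h3 : τ (covZ w) ^ 2 ≤ D ^ 2 := by rw [← sq_abs]; exact pow_le_pow_left₀ (abs_nonneg _) h2 2
  rw [abs_of_nonneg (sq_nonneg _)]
  nlinarith [sq_nonneg (score S p g (observe w) + τ (covZ w)), h1.2,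
    mul_le_mul_of_nonneg_left henv1 (sq_nonneg D)]

/-- The conditional second moment of the score given `Z`, from its conditional variance. -/
lemma Population.integral_score_sq_mul (hP : Population P a b s fX fZ S p m)
    (hg : ∀ j, Measurable (g j))
    (hM : ∀ j, ∀ x ∈ Icc (subPart S a) (subPart S b), |g j x| ≤ M)
    {τ σ2 : (Fin l → ℝ) → ℝ} (hτ : IsCATE P τ)
    (hσ : IsCondMean P (fun w => (score S p g (observe w) - τ (covZ w)) ^ 2) covZ σ2)
    {k : (Fin l → ℝ) → ℝ} (hk : Measurable k) (hi : Integrable (fun w => k (covZ w)) P) :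
    ∫ w, score S p g (observe w) ^ 2 * k (covZ w) ∂P =
      ∫ w, (σ2 (covZ w) + τ (covZ w) ^ 2) * k (covZ w) ∂P := by
  obtain ⟨D, hD⟩ := hP.exists_ae_cate_le hτ
  obtain ⟨C, hC, hdev⟩ := hP.ae_deviation_le hM hτ
  obtain ⟨C', hC', hsc⟩ := hP.exists_ae_score_le hM
  have hτZ : Measurable fun w : Subject l q => τ (covZ w) := hτ.1.comp measurable_covZ
  have hsm : Measurable fun w : Subject l q => score S p g (observe w) :=
    (measurable_score hP.propensity.1 hg).comp measurable_observe
  have hiτ : Integrable (fun w => τ (covZ w) * k (covZ w)) P :=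
    hi.bdd_mul hτZ.aestronglyMeasurable hD
  have hiτ2 : Integrable (fun w => τ (covZ w) * (τ (covZ w) * k (covZ w))) P :=
    hiτ.bdd_mul hτZ.aestronglyMeasurable hD
  have hdi : Integrable (fun w => (score S p g (observe w) - τ (covZ w)) ^ 2 * k (covZ w)) P :=
    hP.integrable_mul_of_le measurable_zPart hk hi ((hsm.sub hτZ).pow_const 2) hdev
  have hsi : Integrable (fun w => score S p g (observe w) * (τ (covZ w) * k (covZ w))) P :=
    hP.integrable_mul_of_le measurable_zPart (k := fun z => τ z * k z) (hτ.1.mul hk) hiτ hsm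
      (hsc.mono fun w h => h.1)
  have e1 := hσ.integral_mul measurable_covZ hk hdi
  have e2 := hP.integral_score_mul hg hM hτ (k := fun z => τ z * k z) (hτ.1.mul hk) hiτ
  have hσi := hσ.integrable_mul hk hdi
  -- The score `s` satisfies `s² = (s - τ)² + 2 s τ - τ²`. The cross term is evaluated by the mean
  -- identity with test function `τ k`, leaving `σ² + 2 τ² - τ²`.
  have hL : ∀ w : Subject l q, score S p g (observe w) ^ 2 * k (covZ w) =
      (score S p g (observe w) - τ (covZ w)) ^ 2 * k (covZ w) +
      (2 * (score S p g (observe w) * (τ (covZ w) * k (covZ w))) -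
        τ (covZ w) * (τ (covZ w) * k (covZ w))) := fun w => by ring
  have hR : ∀ w : Subject l q, (σ2 (covZ w) + τ (covZ w) ^ 2) * k (covZ w) =
      σ2 (covZ w) * k (covZ w) + τ (covZ w) * (τ (covZ w) * k (covZ w)) := fun w => by ring
  simp_rw [hL, hR]
  rw [integral_add (g := fun w => _ - _) hdi ((hsi.const_mul 2).sub hiτ2), integral_sub
      (hsi.const_mul 2) hiτ2,
    integral_const_mul, integral_add hσi hiτ2, e1, e2]
  ring

end Moments

/-! ### The law of the observations. -/

section ObservedLaw

variable {l q : ℕ}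

/-- The value of `Z` in an observation. -/
def obsZ (o : Obs l q) : Fin l → ℝ := zPart o.1

/-- The value of the subvector in an observation. -/
def obsS (S : Finset (Fin (l + q))) (o : Obs l q) : S → ℝ := subPart S o.1

/-- The weight `1 + Y²` of an observation. -/
def obsW (o : Obs l q) : ℝ := 1 + o.2.2 ^ 2

lemma measurable_obsZ : Measurable (obsZ : Obs l q → _) := measurable_zPart.comp measurable_fst

lemma measurable_obsS (S : Finset (Fin (l + q))) : Measurable (obsS S : Obs l q → _) :=
  (measurable_subPart S).comp measurable_fst

lemma measurable_obsY : Measurable fun o : Obs l q => o.2.2 := measurable_snd.comp measurable_snd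

lemma measurable_obsW : Measurable (obsW : Obs l q → ℝ) :=
  measurable_const.add (measurable_obsY.pow_const 2)

lemma measurableSet_arm (j : Bool) : MeasurableSet {o : Obs l q | o.2.1 = j} :=
  (measurable_fst.comp measurable_snd) (measurableSet_singleton j)

lemma one_le_obsW (o : Obs l q) : 1 ≤ obsW o := by unfold obsW; nlinarith [sq_nonneg o.2.2]

lemma obsW_pos (o : Obs l q) : 0 < obsW o := one_pos.trans_le (one_le_obsW o)

/-- The properties of the law `Q` of `(X, D, Y)` on which the plug-in estimators rely. -/
structure ObservedLaw (Q : Measure (Obs l q)) (S : Finset (Fin (l + q))) (A B : S → ℝ)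
    (p : (S → ℝ) → ℝ) (m : Bool → (S → ℝ) → ℝ) (fS : (S → ℝ) → ℝ) : Prop where
  box : ∀ i, A i < B i
  density : HasBoxDensity Q (obsS S) A B 0 fS
  moment_Z : ∃ C : ENNReal, C ≠ ⊤ ∧
    (Q.withDensity fun o => ENNReal.ofReal (obsW o)).map obsZ ≤ C • volume
  moment_S : ∃ C : ENNReal, C ≠ ⊤ ∧
    (Q.withDensity fun o => ENNReal.ofReal (obsW o)).map (obsS S) ≤ C • volume
  sq_integrable : Integrable (fun o => o.2.2 ^ 2) Q
  measurable_p : Measurable p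
  measurable_m : ∀ j, Measurable (m j)
  overlap : ∃ c : ℝ, 0 < c ∧ ∀ x ∈ Icc A B, c < p x ∧ p x < 1 - c
  cont_p : ContinuousOn p (Icc A B)
  cont_m : ∀ j, ContinuousOn (m j) (Icc A B)
  arm : ∀ (j : Bool) (k : (S → ℝ) → ℝ), Measurable k → (∃ C, ∀ x, |k x| ≤ C) →
    ∫ o, {o : Obs l q | o.2.1 = j}.indicator (fun o => k (obsS S o)) o ∂Q =
      ∫ o, armProb p j (obsS S o) * k (obsS S o) ∂Q
  arm_outcome : ∀ (j : Bool) (k : (S → ℝ) → ℝ), Measurable k → (∃ C, ∀ x, |k x| ≤ C) →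
    ∫ o, {o : Obs l q | o.2.1 = j}.indicator (fun o => o.2.2 * k (obsS S o)) o ∂Q =
      ∫ o, armProb p j (obsS S o) * m j (obsS S o) * k (obsS S o) ∂Q

variable {P : Measure (Subject l q)} [IsProbabilityMeasure P]
  {a b : Cov l q} {s : ℕ} {fX : Cov l q → ℝ} {fZ : (Fin l → ℝ) → ℝ}
  {S : Finset (Fin (l + q))} {p : (S → ℝ) → ℝ} {m : Bool → (S → ℝ) → ℝ}

/-- The observed weight `1 + Y²` never exceeds the envelope of the two potential outcomes, whose
weighted law is already dominated. -/
lemma Population.exists_map_obsW_le (hP : Population P a b s fX fZ S p m) {E : Type}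
    [MeasurableSpace E] {g : Cov l q → E} (hg : Measurable g) {ν : Measure E} {C : ENNReal}
    (hC : C ≠ ⊤) (h : P.map (fun w => g (covX w)) ≤ C • ν) : ∃ C' : ENNReal, C' ≠ ⊤ ∧
      ((P.map observe).withDensity fun o => ENNReal.ofReal (obsW o)).map (fun o => g o.1) ≤
        C' • ν := by
  obtain ⟨D, hD, hle⟩ := hP.exists_map_envelope_le
  refine ⟨ENNReal.ofReal D * C, ENNReal.mul_ne_top ENNReal.ofReal_ne_top hC, ?_⟩
  have hgo : Measurable fun o : Obs l q => g o.1 := hg.comp measurable_fst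
  have hgX : Measurable fun w : Subject l q => g (covX w) := hg.comp measurable_covX
  have h1 : ((P.map observe).withDensity fun o => ENNReal.ofReal (obsW o)).map (fun o => g o.1) ≤
      (P.withDensity fun w => ENNReal.ofReal (envelope w)).map (fun w => g (covX w)) := by
    refine Measure.le_iff.2 fun A hA => ?_
    rw [Measure.map_apply hgo hA, Measure.map_apply hgX hA, withDensity_apply _ (hgo hA),
      withDensity_apply _ (hgX hA), setLIntegral_map (hgo hA) measurable_obsW.ennreal_ofReal
      measurable_observe]
    exact lintegral_mono fun w => ENNReal.ofReal_le_ofReal (outcome_sq_le_envelope w)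
  refine h1.trans ((hle g hg).trans ?_)
  rw [mul_smul]
  exact smul_le_smul_left _ h

/-- After this the analysis of `p̂` and `m̂` no longer mentions potential outcomes. For
`arm_outcome`, restriction to arm `j` becomes the weight `armProb p j`, a function of `X̃`, and then
`Y(j)` may be replaced by its conditional mean `m j`. -/
lemma Population.exists_observedLaw (hP : Population P a b s fX fZ S p m) :
    ∃ fS, ObservedLaw (P.map observe) S (subPart S a) (subPart S b) p m fS := by
  obtain ⟨fS, hfS⟩ := hP.density_X.marginal measurable_covX hP.box S
  have hmap : (P.map observe).map (obsS S) = P.map (covS S) :=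
    Measure.map_map (measurable_obsS S) measurable_observe
  have hlaw : HasBoxDensity (P.map observe) (obsS S) (subPart S a) (subPart S b) 0 fS :=
    ⟨hmap.trans hfS.law, hfS.bounds, hfS.smooth⟩
  obtain ⟨CZ, hCZ, hZ⟩ := hP.density_Z.exists_map_le
  obtain ⟨CS, hCS, hS⟩ := hfS.exists_map_le
  refine ⟨fS, ⟨fun i => hP.box i, hlaw, hP.exists_map_obsW_le measurable_zPart hCZ hZ,
    hP.exists_map_obsW_le (measurable_subPart S) hCS hS, ?_, hP.propensity.1,
    fun j => (hP.regression j).1, hP.overlap, hP.propensity_cont,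
    fun j => (hP.regression_smooth j).continuousOn, fun j k hk hkb => ?_, fun j k hk hkb => ?_⟩⟩
  · rw [integrable_map_measure (measurable_obsY.pow_const 2).aestronglyMeasurable
      measurable_observe.aemeasurable]
    refine hP.integrable_envelope.mono' ((measurable_obsY.pow_const 2).comp
      measurable_observe).aestronglyMeasurable (Eventually.of_forall fun w => ?_)
    rw [Real.norm_eq_abs, Function.comp, abs_of_nonneg (sq_nonneg _)]
    exact (le_add_of_nonneg_left zero_le_one).trans (outcome_sq_le_envelope w)
  · have hm1 : Measurable fun o : Obs l q => k (obsS S o) := hk.comp (measurable_obsS S)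
    have hm2 : Measurable fun o : Obs l q => armProb p j (obsS S o) * k (obsS S o) :=
      ((measurable_armProb hP.propensity.1 j).comp (measurable_obsS S)).mul hm1
    rw [integral_map measurable_observe.aemeasurable
      (hm1.indicator (measurableSet_arm j)).aestronglyMeasurable,
      integral_map measurable_observe.aemeasurable hm2.aestronglyMeasurable]
    have h1 := hP.setIntegral_treat j (F := fun x => k (subPart S x.1))
      (hk.comp ((measurable_subPart S).comp measurable_fst))
    rw [← integral_indicator (measurableSet_treat_eq j)] at h1
    exact h1
  · have hm1 : Measurable fun o : Obs l q => o.2.2 * k (obsS S o) :=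
      measurable_obsY.mul (hk.comp (measurable_obsS S))
    have hpm := measurable_armProb hP.propensity.1 j
    have hm2 : Measurable fun o : Obs l q =>
        armProb p j (obsS S o) * m j (obsS S o) * k (obsS S o) :=
      ((hpm.comp (measurable_obsS S)).mul ((hP.regression j).1.comp (measurable_obsS S))).mul
        (hk.comp (measurable_obsS S))
    rw [integral_map measurable_observe.aemeasurable
      (hm1.indicator (measurableSet_arm j)).aestronglyMeasurable,
      integral_map measurable_observe.aemeasurable hm2.aestronglyMeasurable]
    have hF : Measurable fun x : Cov l q × ℝ × ℝ =>
        (bif j then x.2.2 else x.2.1) * k (subPart S x.1) := by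
      refine Measurable.mul ?_ (hk.comp ((measurable_subPart S).comp measurable_fst))
      cases j <;> simp only [cond_true, cond_false] <;> fun_prop
    have h1 := hP.setIntegral_treat j hF
    rw [← integral_indicator (measurableSet_treat_eq j)] at h1
    have hval : ∀ w : Subject l q, (bif j then potential true w else potential false w) =
        potential j w := by intro w; cases j <;> rfl
    simp only [hval] at h1
    have e1 : ∀ w : Subject l q, {o : Obs l q | o.2.1 = j}.indicator
        (fun o => o.2.2 * k (obsS S o)) (observe w) =
        {w | treat w = j}.indicator (fun w => potential j w * k (covS S w)) w := by
      intro w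
      by_cases hw : treat w = j
      · simp [indicator, observe, hw, outcome, obsS, covS, covX]
      · simp [indicator, observe, hw]
    simp_rw [e1]
    refine h1.trans ?_
    have hkY : Integrable (fun w => potential j w * k (covS S w)) P := by
      obtain ⟨C, hC⟩ := hkb
      exact (hP.regression j).2.1.mul_bdd (c := C)
        (hk.comp (measurable_covS S)).aestronglyMeasurable (Eventually.of_forall fun w => hC _)
    have hi : Integrable (fun w => potential j w *
        (fun x => armProb p j x * k x) (covS S w)) P := by
      refine (hP.integrable_armProb_mul j hkY).congr (Eventually.of_forall fun w => ?_)
      simp only; ring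
    have h2 := (hP.regression j).integral_mul (measurable_covS S)
      (k := fun x => armProb p j x * k x) (hpm.mul hk) hi
    refine Eq.trans (integral_congr_ae (Eventually.of_forall fun w => ?_)) (h2.trans
      (integral_congr_ae (Eventually.of_forall fun w => ?_)))
    · simp only [covS, covX]; ring
    · simp only [covS, obsS, observe, covX]; ring

end ObservedLaw

/-! ### Bounds for the compactly supported kernel. -/

section PropensityKernel

variable {ι : Type*} [Fintype ι] {s₁ : ℕ} {L : (ι → ℝ) → ℝ}

lemma IsKernelOfOrder.integrable {s : ℕ} (hL : IsKernelOfOrder s L) : Integrable L := by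
  simpa using hL.1 0 (by simp)

lemma PropensityKernel.measurable (hL : PropensityKernel s₁ L) : Measurable L :=
  hL.smooth.continuous.measurable

lemma PropensityKernel.exists_bound (hL : PropensityKernel s₁ L) :
    ∃ B : ℝ, 0 < B ∧ ∀ u, |L u| ≤ B := by
  obtain ⟨B, hB⟩ := isCompact_Icc.exists_bound_of_continuousOn
    (s := Icc (fun _ : ι => (-1 : ℝ)) fun _ => 1) hL.smooth.continuous.continuousOn
  refine ⟨max B 1, by positivity, fun u => ?_⟩
  by_cases hu : u ∈ Icc (fun _ : ι => (-1 : ℝ)) fun _ => 1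
  · exact (hB u hu).trans (le_max_left _ _)
  · rw [hL.support u hu, abs_zero]; positivity

lemma PropensityKernel.lintegral_sq_ne_top (hL : PropensityKernel s₁ L) :
    ∫⁻ u, ENNReal.ofReal (L u ^ 2) ≠ ⊤ := by
  obtain ⟨B, hB, h⟩ := hL.exists_bound
  refine ne_top_of_le_ne_top (b := ENNReal.ofReal B * ∫⁻ u, ‖L u‖ₑ)
    (ENNReal.mul_ne_top ENNReal.ofReal_ne_top hL.order.integrable.2.ne) ?_
  rw [← lintegral_const_mul _ hL.measurable.enorm]
  refine lintegral_mono fun u => ?_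
  rw [← ofReal_norm, ← ENNReal.ofReal_mul hB.le, Real.norm_eq_abs, ← sq_abs, sq]
  exact ENNReal.ofReal_le_ofReal (mul_le_mul_of_nonneg_right (h u) (abs_nonneg _))

lemma abs_rescale_le {B : ℝ} (hB : ∀ u, |L u| ≤ B) {h : ℝ} (hh : 0 < h) (x x' : ι → ℝ) :
    |rescale L h x x'| ≤ B / h ^ Fintype.card ι := by
  unfold rescale
  rw [abs_mul, abs_of_pos (by positivity : 0 < (h ^ Fintype.card ι)⁻¹), div_eq_inv_mul]
  gcongr
  exact hB _

end PropensityKernel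

/-! ### Means of the kernel sums in each arm. -/

section ArmMeans

variable {l q : ℕ} {Q : Measure (Obs l q)} {S : Finset (Fin (l + q))}
  {A B : S → ℝ} {p : (S → ℝ) → ℝ} {m : Bool → (S → ℝ) → ℝ} {fS : (S → ℝ) → ℝ}
  {L : (S → ℝ) → ℝ} {s₁ : ℕ}

/-- The contribution of an observation to the kernel density estimator at `x` for arm `j`. -/
noncomputable def armKernel (L : (S → ℝ) → ℝ) (j : Bool) (h : ℝ) (x : S → ℝ) (o : Obs l q) : ℝ :=
  {o : Obs l q | o.2.1 = j}.indicator (fun o => rescale L h x (obsS S o)) o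

/-- The mean of the kernel density estimator of `X̃` at `x`. -/
noncomputable def smoothedDensity (Q : Measure (Obs l q)) (L : (S → ℝ) → ℝ) (h : ℝ)
    (x : S → ℝ) : ℝ :=
  ∫ o, rescale L h x (obsS S o) ∂Q

lemma measurable_rescale_obsS (hL : Measurable L) (h : ℝ) :
    Measurable fun v : (S → ℝ) × Obs l q => rescale L h v.1 (obsS S v.2) :=
  (measurable_rescale hL h).comp (measurable_fst.prodMk ((measurable_obsS S).comp measurable_snd))

lemma measurable_armKernel (hL : Measurable L) (j : Bool) (h : ℝ) :
    Measurable fun v : (S → ℝ) × Obs l q => armKernel L j h v.1 v.2 :=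
  (measurable_rescale_obsS hL h).indicator (measurable_snd (measurableSet_arm j))

lemma abs_armKernel_le_abs_rescale (j : Bool) (h : ℝ) (x : S → ℝ) (o : Obs l q) :
    |armKernel L j h x o| ≤ |rescale L h x (obsS S o)| :=
  norm_indicator_le_norm_self (E := ℝ) _ _

/-- Squaring a rescaled kernel costs one factor `h ^ (-card)`; the weight `1 + Y²` costs only a
constant. This is the variance bound for the density sums and for the regression numerators alike.
-/
lemma ObservedLaw.lintegral_weighted_rescale_sq_le (hQ : ObservedLaw Q S A B p m fS)
    (hL : PropensityKernel s₁ L) : ∃ C : ℝ, 0 < C ∧ ∀ h, 0 < h → ∀ x,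
      ∫⁻ o, ENNReal.ofReal (obsW o * rescale L h x (obsS S o) ^ 2) ∂Q ≤
        ENNReal.ofReal (C / h ^ S.card) := by
  obtain ⟨C, hC, hle⟩ := hQ.moment_S
  have hCL : C * ∫⁻ u, ENNReal.ofReal (L u ^ 2) ≠ ⊤ := ENNReal.mul_ne_top hC hL.lintegral_sq_ne_top
  refine ⟨(C * ∫⁻ u, ENNReal.ofReal (L u ^ 2)).toReal + 1, by positivity, fun h hh x => ?_⟩
  have hm : Measurable fun x' => ENNReal.ofReal (rescale L h x x' ^ 2) :=
    (((measurable_rescale hL.measurable h).comp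
      (measurable_const.prodMk measurable_id)).pow_const 2).ennreal_ofReal
  have h2 := lintegral_mul_comp_le (measurable_obsS S) measurable_obsW.ennreal_ofReal
    (ν := C • (volume : Measure (S → ℝ))) (C := 1) (by rwa [one_smul]) hm
  have h3 := lintegral_rescale_sq_le hL.measurable hh x (le_refl (C • (volume : Measure (S → ℝ))))
  rw [one_mul] at h2
  calc _ = ∫⁻ o, ENNReal.ofReal (obsW o) * ENNReal.ofReal (rescale L h x (obsS S o) ^ 2) ∂Q :=
        lintegral_congr fun o => ENNReal.ofReal_mul (obsW_pos o).le
    _ ≤ _ := h2.trans h3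
    _ = ENNReal.ofReal (h ^ Fintype.card S)⁻¹ * (C * ∫⁻ u, ENNReal.ofReal (L u ^ 2)) := by ring
    _ ≤ ENNReal.ofReal (h ^ Fintype.card S)⁻¹ *
        ENNReal.ofReal ((C * ∫⁻ u, ENNReal.ofReal (L u ^ 2)).toReal + 1) := by
        gcongr
        conv_lhs => rw [← ENNReal.ofReal_toReal hCL]
        exact ENNReal.ofReal_le_ofReal (by linarith)
    _ = _ := by
        rw [← ENNReal.ofReal_mul (by positivity), Fintype.card_coe, div_eq_inv_mul]

lemma ObservedLaw.ae_mem (hQ : ObservedLaw Q S A B p m fS) : ∀ᵐ o ∂Q, obsS S o ∈ Icc A B :=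
  ae_of_ae_map (measurable_obsS S).aemeasurable hQ.density.ae_mem

lemma ObservedLaw.armProb_mem (hQ : ObservedLaw Q S A B p m fS) :
    ∃ c : ℝ, 0 < c ∧ c < 1 ∧ ∀ j, ∀ x ∈ Icc A B, c < armProb p j x ∧ armProb p j x < 1 := by
  obtain ⟨c, hc, h⟩ := hQ.overlap
  have hc1 : c < 1 := by
    have := h A ⟨le_rfl, fun i => (hQ.box i).le⟩
    linarith
  refine ⟨c, hc, hc1, fun j x hx => ?_⟩
  have := h x hx
  cases j <;> simp only [armProb, cond_true, cond_false] <;> constructor <;> linarith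

lemma ObservedLaw.continuousOn_armProb (hQ : ObservedLaw Q S A B p m fS) (j : Bool) :
    ContinuousOn (armProb p j) (Icc A B) := by
  cases j
  · exact continuousOn_const.sub hQ.cont_p
  · exact hQ.cont_p

/-- The kernel may take negative values, so a pointwise lower bound on the density is not enough.
The density is frozen at `x`, where the truncated kernel mass bounds the main term below by `d * c`;
its oscillation over the support of the rescaled kernel costs at most half of that. -/
lemma ObservedLaw.exists_le_smoothedDensity (hQ : ObservedLaw Q S A B p m fS)
    (hL : PropensityKernel s₁ L) : ∃ c : ℝ, 0 < c ∧ ∃ h₀ : ℝ, 0 < h₀ ∧ ∀ h, 0 < h → h < h₀ →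
      ∀ x ∈ Icc A B, c ≤ smoothedDensity Q L h x := by
  obtain ⟨c, hc, h₁, hh₁, hmass⟩ :=
    exists_le_setIntegral_rescale hL.order.integrable hL.support hL.truncated hQ.box
  obtain ⟨d, D, hd, hfS⟩ := hQ.density.bounds
  let I := ∫ u, |L u|
  have hI : 0 ≤ I := integral_nonneg fun u => abs_nonneg _
  -- The tolerated oscillation: multiplied by `I`, the integral of `|L|`, it is at most `d * c / 2`.
  -- The `+ 1` makes the denominator positive.
  have hω : 0 < d * c / (2 * (I + 1)) := by positivity
  obtain ⟨δ, hδ, hmod⟩ := uniform_modulus hQ.density.continuousOn hω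
  refine ⟨d * c / 2, by positivity, min h₁ δ, by positivity, fun h hh hlt x hx => ?_⟩
  have hri : Integrable (rescale L h x) := integrable_rescale hL.order.integrable hh x
  have hm : AEStronglyMeasurable (rescale L h x) (Q.map (obsS S)) :=
    ((measurable_rescale hL.measurable h).comp
      (measurable_const.prodMk measurable_id)).aestronglyMeasurable
  have hfi : IntegrableOn (fun x' => fS x' * rescale L h x x') (Icc A B) := by
    refine hri.integrableOn.bdd_mul (c := D) (hQ.density.continuousOn.aestronglyMeasurable
      measurableSet_Icc) ((ae_restrict_iff' measurableSet_Icc).2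
        (Eventually.of_forall fun x' hx' => ?_))
    have := hfS x' hx'
    rw [Real.norm_eq_abs, abs_of_nonneg (hd.le.trans this.1)]
    exact this.2
  have e1 : smoothedDensity Q L h x = ∫ x' in Icc A B, fS x' * rescale L h x x' := by
    rw [smoothedDensity, ← integral_map (measurable_obsS S).aemeasurable hm,
      hQ.density.integral_map_eq, ← integral_indicator measurableSet_Icc]
    congr 1
    ext x'
    by_cases hx' : x' ∈ Icc A B <;> simp [hx']
  have e2 : ∫ x' in Icc A B, fS x' * rescale L h x x' =
      fS x * (∫ x' in Icc A B, rescale L h x x') +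
        ∫ x' in Icc A B, (fS x' - fS x) * rescale L h x x' := by
    simp_rw [sub_mul]
    rw [integral_sub hfi (hri.integrableOn.const_mul _), integral_const_mul]
    ring
  have e3 : |∫ x' in Icc A B, (fS x' - fS x) * rescale L h x x'| ≤
      d * c / (2 * (I + 1)) * I := by
    calc _ ≤ ∫ x' in Icc A B, d * c / (2 * (I + 1)) * |rescale L h x x'| := by
          refine (Real.norm_eq_abs _).symm.le.trans (norm_integral_le_of_norm_le
            (hri.abs.const_mul _).integrableOn
            ((ae_restrict_iff' measurableSet_Icc).2 (Eventually.of_forall fun x' hx' => ?_)))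
          rw [norm_mul, Real.norm_eq_abs, Real.norm_eq_abs]
          by_cases hne : rescale L h x x' = 0
          · simp [hne]
          · gcongr
            exact hmod x hx x' hx' ((norm_sub_le_of_rescale_ne_zero hL.support hh hne).trans
              (hlt.le.trans (min_le_right _ _)))
      _ ≤ ∫ x', d * c / (2 * (I + 1)) * |rescale L h x x'| :=
          setIntegral_le_integral (hri.abs.const_mul _)
            (Eventually.of_forall fun x' => by positivity)
      _ = d * c / (2 * (I + 1)) * I := by
          rw [integral_const_mul]
          have : ∀ x', |rescale L h x x'| = rescale (fun u => |L u|) h x x' := fun x' => by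
            rw [rescale, rescale, abs_mul, abs_of_pos (by positivity : 0 < (h ^ _)⁻¹)]
          simp_rw [this]
          rw [integral_rescale hh]
  have e4 : d * c / (2 * (I + 1)) * I ≤ d * c / 2 := by
    rw [div_mul_eq_mul_div, div_le_div_iff₀ (by positivity) (by positivity)]
    nlinarith [mul_pos hd hc]
  have e5 : d * c ≤ fS x * ∫ x' in Icc A B, rescale L h x x' := by
    have h6 := hmass h hh (hlt.trans_le (min_le_left _ _)) x hx
    have h7 := (hfS x hx).1
    exact mul_le_mul h7 h6 hc.le (hd.le.trans h7)
  rw [e1, e2]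
  linarith [(abs_le.1 e3).1]

variable [IsProbabilityMeasure Q]

lemma measurable_smoothedDensity (hL : Measurable L) (h : ℝ) :
    Measurable (smoothedDensity Q L h) :=
  (measurable_rescale_obsS hL h).stronglyMeasurable.integral_prod_right.measurable

lemma integrable_rescale_obsS (hL : PropensityKernel s₁ L) {h : ℝ} (hh : 0 < h) (x : S → ℝ) :
    Integrable (fun o => rescale L h x (obsS S o)) Q := by
  obtain ⟨B, hB, hLB⟩ := hL.exists_bound
  exact Integrable.of_bound ((measurable_rescale_obsS hL.measurable h).comp
    (measurable_const.prodMk measurable_id)).aestronglyMeasurable (B / h ^ Fintype.card S)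
    (Eventually.of_forall fun o => abs_rescale_le hLB hh _ _)

lemma integrable_armKernel (hL : PropensityKernel s₁ L) (j : Bool) {h : ℝ} (hh : 0 < h)
    (x : S → ℝ) : Integrable (armKernel L j h x) Q :=
  (integrable_rescale_obsS hL hh x).indicator (measurableSet_arm j)

lemma ObservedLaw.exists_integral_abs_rescale_le (hQ : ObservedLaw Q S A B p m fS)
    (hL : PropensityKernel s₁ L) : ∃ C : ℝ, 0 < C ∧ ∀ h, 0 < h → ∀ x,
      ∫ o, |rescale L h x (obsS S o)| ∂Q ≤ C := by
  obtain ⟨C, hC, hle⟩ := hQ.density.exists_map_le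
  have hCL : C * ∫⁻ u, ‖L u‖ₑ ≠ ⊤ := ENNReal.mul_ne_top hC hL.order.integrable.2.ne
  refine ⟨(C * ∫⁻ u, ‖L u‖ₑ).toReal + 1, by positivity, fun h hh x => ?_⟩
  have hm : Measurable fun x' => ‖rescale L h x x'‖ₑ :=
    ((measurable_rescale hL.measurable h).comp (measurable_const.prodMk measurable_id)).enorm
  have h3 := lintegral_rescale_le hL.measurable hh x hle
  rw [lintegral_map hm (measurable_obsS S)] at h3
  have h4 : ∫ o, |rescale L h x (obsS S o)| ∂Q =
      (∫⁻ o, ‖rescale L h x (obsS S o)‖ₑ ∂Q).toReal :=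
    integral_norm_eq_lintegral_enorm (integrable_rescale_obsS hL hh x).1
  rw [h4]
  exact (ENNReal.toReal_mono hCL h3).trans (by linarith)

/-- Near a point of the box, a function that is small on the support of the rescaled kernel has a
small kernel average. -/
lemma ObservedLaw.abs_integral_mul_rescale_le (hQ : ObservedLaw Q S A B p m fS)
    (hL : PropensityKernel s₁ L) {C : ℝ}
    (hC : ∀ h, 0 < h → ∀ x : S → ℝ, ∫ o, |rescale L h x (obsS S o)| ∂Q ≤ C) {h ω : ℝ} (hh : 0 < h)
    (hω : 0 ≤ ω) {x : S → ℝ} {φ : (S → ℝ) → ℝ}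
    (hφ : ∀ x' ∈ Icc A B, ‖x' - x‖ ≤ h → |φ x'| ≤ ω) :
    |∫ o, φ (obsS S o) * rescale L h x (obsS S o) ∂Q| ≤ ω * C := by
  calc |∫ o, φ (obsS S o) * rescale L h x (obsS S o) ∂Q|
      ≤ ∫ o, ω * |rescale L h x (obsS S o)| ∂Q := by
        refine (Real.norm_eq_abs _).symm.le.trans (norm_integral_le_of_norm_le
          ((integrable_rescale_obsS (Q := Q) hL hh x).abs.const_mul ω) ?_)
        filter_upwards [hQ.ae_mem] with o ho
        rw [norm_mul, Real.norm_eq_abs, Real.norm_eq_abs]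
        by_cases hne : rescale L h x (obsS S o) = 0
        · simp [hne]
        · gcongr
          exact hφ _ ho (norm_sub_le_of_rescale_ne_zero hL.support hh hne)
    _ ≤ ω * C := by
        rw [integral_const_mul]
        gcongr
        exact hC h hh x

/-- The comparison is with `armProb` times the smoothed density, not times the density itself: near
the boundary the kernel loses mass and the smoothed density need not approach the density. With this
target only the uniform continuity of `armProb` on the box matters. -/
lemma ObservedLaw.exists_armKernel_bias_le (hQ : ObservedLaw Q S A B p m fS)
    (hL : PropensityKernel s₁ L) {η : ℝ} (hη : 0 < η) : ∃ h₀ : ℝ, 0 < h₀ ∧ ∀ h, 0 < h → h < h₀ →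
      ∀ x ∈ Icc A B, ∀ j,
        |∫ o, armKernel L j h x o ∂Q - armProb p j x * smoothedDensity Q L h x| ≤ η := by
  obtain ⟨C, hC, hCL⟩ := hQ.exists_integral_abs_rescale_le hL
  obtain ⟨BL, hBL, hLB⟩ := hL.exists_bound
  have hω : 0 < η / C := by positivity
  obtain ⟨δ₀, hδ₀, h0⟩ := uniform_modulus (hQ.continuousOn_armProb false) hω
  obtain ⟨δ₁, hδ₁, h1⟩ := uniform_modulus (hQ.continuousOn_armProb true) hω
  have hj : ∀ j, ∀ x ∈ Icc A B, ∀ x' ∈ Icc A B, ‖x' - x‖ ≤ min δ₀ δ₁ →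
      |armProb p j x' - armProb p j x| ≤ η / C := by
    intro j x hx x' hx' hd
    cases j
    · exact h0 x hx x' hx' (hd.trans (min_le_left _ _))
    · exact h1 x hx x' hx' (hd.trans (min_le_right _ _))
  refine ⟨min δ₀ δ₁, by positivity, fun h hh hlt x hx j => ?_⟩
  have hr := integrable_rescale_obsS (Q := Q) hL hh x
  obtain ⟨c, hc, hc1, harm⟩ := hQ.armProb_mem
  have hpr : Integrable (fun o => armProb p j (obsS S o) * rescale L h x (obsS S o)) Q := by
    refine hr.bdd_mul (c := 1) ((measurable_armProb hQ.measurable_p j).comp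
      (measurable_obsS S)).aestronglyMeasurable ?_
    filter_upwards [hQ.ae_mem] with o ho
    have := harm j _ ho
    rw [Real.norm_eq_abs, abs_of_pos (by linarith)]; exact this.2.le
  have e1 : ∫ o, armKernel L j h x o ∂Q =
      ∫ o, armProb p j (obsS S o) * rescale L h x (obsS S o) ∂Q :=
    hQ.arm j _ ((measurable_rescale hL.measurable h).comp (measurable_const.prodMk measurable_id))
      ⟨_, fun x' => abs_rescale_le hLB hh x x'⟩
  rw [e1, smoothedDensity, ← integral_const_mul, ← integral_sub hpr (hr.const_mul _)]
  simp_rw [← sub_mul]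
  refine (hQ.abs_integral_mul_rescale_le hL hCL hh hω.le
    (φ := fun x' => armProb p j x' - armProb p j x)
    fun x' hx' hd => hj j x hx x' hx' (hd.trans hlt.le)).trans (le_of_eq ?_)
  field_simp

end ArmMeans

/-! ### Uniform concentration of the leave-one-out kernel sums. -/

section Concentration

variable {l q : ℕ} {Q : Measure (Obs l q)} [IsProbabilityMeasure Q] {S : Finset (Fin (l + q))}
  {A B : S → ℝ} {p : (S → ℝ) → ℝ} {m : Bool → (S → ℝ) → ℝ} {fS : (S → ℝ) → ℝ}
  {L : (S → ℝ) → ℝ} {s₁ : ℕ}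

/-- The unnormalised kernel density estimator at `x` for arm `j`. -/
noncomputable def armSum (L : (S → ℝ) → ℝ) (j : Bool) (h : ℝ) (x : S → ℝ) {n : ℕ}
    (u : Fin n → Obs l q) : ℝ :=
  ∑ t, armKernel L j h x (u t)

/-- All observations lie in the box, and at each of them the leave-one-out kernel density
estimators for both arms are within `η` of their limits. -/
def Concentrated (Q : Measure (Obs l q)) (A B : S → ℝ) (p : (S → ℝ) → ℝ) (L : (S → ℝ) → ℝ)
    (h η : ℝ) {n : ℕ} (v : Fin (n + 1) → Obs l q) : Prop :=
  ∀ i, obsS S (v i) ∈ Icc A B ∧ ∀ j,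
    |armSum L j h (obsS S (v i)) (fun t => v (i.succAbove t)) -
      n * (armProb p j (obsS S (v i)) * smoothedDensity Q L h (obsS S (v i)))| < n * η

/-- Half of `η` pays for the bias. The other half is a Bernstein deviation, with sup bound and
second moment both of order `h ^ (-card)`. -/
lemma ObservedLaw.measure_armSum_deviation_le (hQ : ObservedLaw Q S A B p m fS)
    (hL : PropensityKernel s₁ L) {η : ℝ} (hη : 0 < η) :
    ∃ κ : ℝ, 0 < κ ∧ ∃ h₀ : ℝ, 0 < h₀ ∧ ∀ h, 0 < h → h < h₀ → ∀ x ∈ Icc A B, ∀ j, ∀ n : ℕ,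
      Measure.pi (fun _ : Fin n => Q) {u | n * η ≤
        |armSum L j h x u - n * (armProb p j x * smoothedDensity Q L h x)|} ≤
      2 * ENNReal.ofReal (Real.exp (-(κ * (n * h ^ S.card)))) := by
  obtain ⟨h₀, hh₀, hbias⟩ := hQ.exists_armKernel_bias_le hL (half_pos hη)
  obtain ⟨b, hb, hLb⟩ := hL.exists_bound
  obtain ⟨C, hC, hsq⟩ := hQ.lintegral_weighted_rescale_sq_le hL
  -- Bernstein is applied with `t = θ * h ^ card`. The first bound on `θ` gives `t * B ≤ 1`; the
  -- second makes the quadratic term at most half of the linear one, so the exponent is at most `-(θ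
  -- * η / 4) * n * h ^ card`.
  let θ := min (1 / b) (η / (4 * C))
  have hθ : 0 < θ := by positivity
  refine ⟨θ * η / 4, by positivity, h₀, hh₀, fun h hh hlt x hx j n => ?_⟩
  have hp : 0 < h ^ S.card := by positivity
  have hfm : Measurable (armKernel (l := l) (q := q) L j h x) :=
    (measurable_armKernel hL.measurable j h).comp (measurable_const.prodMk measurable_id)
  have hB : ∀ o : Obs l q, |armKernel L j h x o| ≤ b / h ^ S.card := fun o => by
    have := (abs_armKernel_le_abs_rescale j h x o).trans (abs_rescale_le hLb hh x (obsS S o))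
    rwa [Fintype.card_coe] at this
  have hV : ∫ o, armKernel L j h x o ^ 2 ∂Q ≤ C / h ^ S.card := by
    rw [integral_eq_lintegral_of_nonneg_ae (Eventually.of_forall fun o => sq_nonneg _)
      (hfm.pow_const 2).aestronglyMeasurable]
    refine ENNReal.toReal_le_of_le_ofReal (by positivity) (le_trans (lintegral_mono fun o => ?_)
      (hsq h hh x))
    refine ENNReal.ofReal_le_ofReal ?_
    have h1 := abs_armKernel_le_abs_rescale j h x o (L := L)
    have h2 := sq_le_sq.2 h1
    nlinarith [one_le_obsW o, sq_nonneg (rescale L h x (obsS S o))]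
  have hbern := measure_abs_sum_ge_le Q (n := n) (ε := η / 2) (t := θ * h ^ S.card) hfm hB hV
    (by positivity) (by
      have : θ ≤ 1 / b := min_le_left _ _
      rw [mul_assoc, mul_div_cancel₀ _ hp.ne']
      rwa [le_div_iff₀ hb] at this)
  refine (measure_mono ?_).trans (hbern.trans ?_)
  · intro u hu
    simp only [mem_ofPred_eq] at hu ⊢
    have h1 := hbias h hh hlt x hx j
    have h2 : |(n : ℝ) * (∫ o, armKernel L j h x o ∂Q) -
        n * (armProb p j x * smoothedDensity Q L h x)| ≤ n * (η / 2) := by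
      rw [← mul_sub, abs_mul, Nat.abs_cast]; gcongr
    have h3 := abs_sub_le (armSum L j h x u) ((n : ℝ) * (∫ o, armKernel L j h x o ∂Q))
      (n * (armProb p j x * smoothedDensity Q L h x))
    unfold armSum at hu h3
    linarith
  · gcongr
    have h1 : θ ≤ η / (4 * C) := min_le_right _ _
    rw [le_div_iff₀ (by positivity)] at h1
    have h2 : (θ * h ^ S.card) ^ 2 * (C / h ^ S.card) = θ * h ^ S.card * (θ * C) := by
      field_simp
    rw [h2]
    have hn : (0 : ℝ) ≤ n * (θ * h ^ S.card) := by positivity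
    nlinarith [mul_le_mul_of_nonneg_left h1 hn]

lemma measurable_armSum (hL : Measurable L) (j : Bool) (h : ℝ) (n : ℕ) :
    Measurable fun v : Obs l q × (Fin n → Obs l q) => armSum L j h (obsS S v.1) v.2 := by
  unfold armSum
  refine Finset.measurable_sum _ fun t _ => (measurable_armKernel hL j h).comp
    (((measurable_obsS S).comp measurable_fst).prodMk ?_)
  exact (measurable_pi_apply t).comp measurable_snd

/-- A union bound over `n + 1` evaluation points and two arms. Given observation `i`, the
leave-one-out sum consists of `n` draws independent of the evaluation point, so the bound for a
fixed `x` applies. -/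
lemma ObservedLaw.measure_not_concentrated_le (hQ : ObservedLaw Q S A B p m fS)
    (hL : PropensityKernel s₁ L) {η : ℝ} (hη : 0 < η) :
    ∃ κ : ℝ, 0 < κ ∧ ∃ h₀ : ℝ, 0 < h₀ ∧ ∀ h, 0 < h → h < h₀ → ∀ n : ℕ,
      Measure.pi (fun _ : Fin (n + 1) => Q) {v | ¬ Concentrated Q A B p L h η v} ≤
      (n + 1) * (4 * ENNReal.ofReal (Real.exp (-(κ * (n * h ^ S.card))))) := by
  obtain ⟨κ, hκ, h₀, hh₀, hdev⟩ := hQ.measure_armSum_deviation_le hL hη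
  refine ⟨κ, hκ, h₀, hh₀, fun h hh hlt n => ?_⟩
  let D : Bool → Set (Obs l q × (Fin n → Obs l q)) := fun j => {v | obsS S v.1 ∈ Icc A B ∧
    n * η ≤ |armSum L j h (obsS S v.1) v.2 -
      n * (armProb p j (obsS S v.1) * smoothedDensity Q L h (obsS S v.1))|}
  have hD : ∀ j, MeasurableSet (D j) := by
    intro j
    have hs : Measurable fun v : Obs l q × (Fin n → Obs l q) => obsS S v.1 :=
      (measurable_obsS S).comp measurable_fst
    have hdiff : Measurable fun v : Obs l q × (Fin n → Obs l q) =>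
        |armSum L j h (obsS S v.1) v.2 -
          n * (armProb p j (obsS S v.1) * smoothedDensity Q L h (obsS S v.1))| :=
              ((measurable_armSum hL.measurable j h n).sub
      ((((measurable_armProb hQ.measurable_p j).comp hs).mul
        ((measurable_smoothedDensity hL.measurable h).comp hs)).const_mul (n : ℝ))).abs
    have hle : MeasurableSet {v : Obs l q × (Fin n → Obs l q) | n * η ≤
        |armSum L j h (obsS S v.1) v.2 -
          n * (armProb p j (obsS S v.1) * smoothedDensity Q L h (obsS S v.1))|} :=
      measurableSet_le measurable_const hdiff
    exact (hs measurableSet_Icc).inter hle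
  let π := Measure.pi fun _ : Fin (n + 1) => Q
  let e := fun i : Fin (n + 1) => MeasurableEquiv.piFinSuccAbove (fun _ => Obs l q) i
  have hDi : ∀ i j, π (e i ⁻¹' D j) ≤ 2 * ENNReal.ofReal (Real.exp (-(κ * (n * h ^ S.card)))) := by
    intro i j
    have hmp := measurePreserving_piFinSuccAbove (fun _ : Fin (n + 1) => Q) i
    rw [hmp.measure_preimage (hD j).nullMeasurableSet, Measure.prod_apply (hD j)]
    calc _ ≤ ∫⁻ _, 2 * ENNReal.ofReal (Real.exp (-(κ * (n * h ^ S.card)))) ∂Q := by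
          refine lintegral_mono fun o => ?_
          by_cases ho : obsS S o ∈ Icc A B
          · exact (measure_mono fun u hu => hu.2).trans (hdev h hh hlt _ ho j n)
          · have : Prod.mk o ⁻¹' D j = ∅ := by
              ext u
              exact iff_of_false (fun hu => ho hu.1) (notMem_empty u)
            rw [this, measure_empty]
            exact zero_le
      _ = _ := by simp
  have hsub : {v | ¬ Concentrated Q A B p L h η v} ⊆
      {v | ¬ ∀ i, obsS S (v i) ∈ Icc A B} ∪ ⋃ i, ⋃ j, e i ⁻¹' D j := by
    intro v hv
    by_cases hbox : ∀ i, obsS S (v i) ∈ Icc A B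
    · right
      simp only [Concentrated, mem_ofPred_eq, not_forall] at hv
      obtain ⟨i, hi⟩ := hv
      rw [not_and] at hi
      have h2 := hi (hbox i)
      push Not at h2
      obtain ⟨j, hj⟩ := h2
      exact mem_iUnion.2 ⟨i, mem_iUnion.2 ⟨j, hbox i, hj⟩⟩
    · exact Or.inl hbox
  have hnull : π {v | ¬ ∀ i, obsS S (v i) ∈ Icc A B} = 0 :=
    ae_pi_eval Q hQ.ae_mem
  refine (measure_mono hsub).trans ((measure_union_le _ _).trans ?_)
  rw [hnull, zero_add]
  refine (measure_iUnion_fintype_le _ _).trans ?_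
  calc ∑ i, π (⋃ j, e i ⁻¹' D j)
      ≤ ∑ _ : Fin (n + 1), 4 * ENNReal.ofReal (Real.exp (-(κ * (n * h ^ S.card)))) := by
        refine Finset.sum_le_sum fun i _ => (measure_iUnion_fintype_le _ _).trans ?_
        refine (Finset.sum_le_sum fun j _ => hDi i j).trans (le_of_eq ?_)
        rw [Finset.sum_const, Finset.card_univ, Fintype.card_bool, nsmul_eq_mul, ← mul_assoc]
        norm_num
    _ = _ := by simp

/-- Eventually `h₁ < 1`, so dropping `s₁` from the exponent only enlarges the denominator. Replacing
`n + 1` by the leave-one-out size `n` costs a factor two. -/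
lemma Bandwidths.tendsto_inv_mul_pow {l kt s s₁ : ℕ} {h h₁ : ℕ → ℝ}
    (hh : Bandwidths l kt s s₁ h h₁) :
    Tendsto (fun n : ℕ => Real.log (n + 1) / (n * h₁ (n + 1) ^ kt)) atTop (𝓝 0) := by
  have h1 := (tendsto_add_atTop_iff_nat 1).2 hh.log_zero
  have h2 := (tendsto_add_atTop_iff_nat 1).2 hh.h₁_zero
  have h3 := h1.const_mul 2
  rw [mul_zero] at h3
  refine tendsto_of_tendsto_of_tendsto_of_le_of_le' tendsto_const_nhds h3 ?_ ?_
  · filter_upwards [eventually_ge_atTop 1] with n hn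
    have := hh.h₁_pos (n + 1)
    have : 0 ≤ Real.log ((n : ℝ) + 1) := Real.log_nonneg (by linarith [n.cast_nonneg (α := ℝ)])
    positivity
  · filter_upwards [eventually_ge_atTop 1, h2.eventually (gt_mem_nhds one_pos)] with n hn hlt
    have hpos := hh.h₁_pos (n + 1)
    have hlog : 0 ≤ Real.log ((n : ℝ) + 1) :=
      Real.log_nonneg (by linarith [n.cast_nonneg (α := ℝ)])
    have hn' : (1 : ℝ) ≤ n := by exact_mod_cast hn
    have hpow : h₁ (n + 1) ^ (kt + s₁) ≤ h₁ (n + 1) ^ kt :=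
      pow_le_pow_of_le_one hpos.le hlt.le (by omega)
    push_cast
    rw [mul_div_assoc', div_le_div_iff₀ (by positivity) (by positivity)]
    have h5 : ((n : ℝ) + 1) * h₁ (n + 1) ^ (kt + s₁) ≤ 2 * (n * h₁ (n + 1) ^ kt) := by
      have h6 : ((n : ℝ) + 1) * h₁ (n + 1) ^ (kt + s₁) ≤ (2 * n) * h₁ (n + 1) ^ kt := by
        gcongr; linarith
      linarith
    nlinarith [mul_le_mul_of_nonneg_left h5 hlog]

/-- The observations are concentrated with probability tending to one. -/
lemma ObservedLaw.tendsto_measure_not_concentrated (hQ : ObservedLaw Q S A B p m fS)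
    (hL : PropensityKernel s₁ L) {s : ℕ} {h h₁ : ℕ → ℝ} (hh : Bandwidths l S.card s s₁ h h₁)
    {η : ℝ} (hη : 0 < η) :
    Tendsto (fun n : ℕ => Measure.pi (fun _ : Fin (n + 1) => Q)
      {v | ¬ Concentrated Q A B p L (h₁ (n + 1)) η v}) atTop (𝓝 0) := by
  obtain ⟨κ, hκ, h₀, hh₀, hle⟩ := hQ.measure_not_concentrated_le hL hη
  have h2 := (tendsto_add_atTop_iff_nat 1).2 hh.h₁_zero
  have hlim : Tendsto (fun n : ℕ => ENNReal.ofReal (4 / ((n : ℝ) + 1))) atTop (𝓝 0) := by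
    rw [← ENNReal.ofReal_zero]
    refine ENNReal.tendsto_ofReal ?_
    exact tendsto_const_nhds.div_atTop
        (tendsto_atTop_add_const_right _ _ tendsto_natCast_atTop_atTop)
  refine tendsto_of_tendsto_of_tendsto_of_le_of_le' tendsto_const_nhds hlim
    (Eventually.of_forall fun _ => zero_le) ?_
  filter_upwards [eventually_ge_atTop 1, h2.eventually (gt_mem_nhds hh₀),
    hh.tendsto_inv_mul_pow.eventually (gt_mem_nhds (half_pos hκ))] with n hn hlt hlog
  have hpos := hh.h₁_pos (n + 1)
  have hn' : (1 : ℝ) ≤ n := by exact_mod_cast hn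
  refine (hle _ hpos hlt n).trans ?_
  rw [div_lt_iff₀ (by positivity)] at hlog
  -- The logarithm is below `κ / 2` times `n * h₁ ^ card`, so the exponential beats the `n + 1`
  -- terms of the union bound with a power to spare.
  have hexp : Real.exp (-(κ * (n * h₁ (n + 1) ^ S.card))) ≤ (((n : ℝ) + 1) ^ 2)⁻¹ := by
    rw [← Real.exp_log (by positivity : (0 : ℝ) < ((n : ℝ) + 1) ^ 2), ← Real.exp_neg,
      Real.exp_le_exp, Real.log_pow]
    push_cast
    linarith
  calc _ ≤ ((n : ENNReal) + 1) * (4 * ENNReal.ofReal ((((n : ℝ) + 1) ^ 2)⁻¹)) := by gcongr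
    _ = ENNReal.ofReal (4 / ((n : ℝ) + 1)) := by
        have e1 : ((n : ENNReal) + 1) = ENNReal.ofReal ((n : ℝ) + 1) := by
          rw [ENNReal.ofReal_add (by positivity) zero_le_one]; simp
        have e2 : (4 : ENNReal) = ENNReal.ofReal 4 := by simp
        rw [e1, e2, ← ENNReal.ofReal_mul (by norm_num), ← ENNReal.ofReal_mul (by positivity)]
        congr 1
        field_simp

end Concentration

/-! ### Mean squared error of the kernel regression. -/

section Residuals

variable {l q : ℕ} {Q : Measure (Obs l q)} {S : Finset (Fin (l + q))}
  {A B : S → ℝ} {p : (S → ℝ) → ℝ} {m : Bool → (S → ℝ) → ℝ} {fS : (S → ℝ) → ℝ}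
  {L : (S → ℝ) → ℝ} {s₁ : ℕ}

/-- The contribution of an observation to the numerator of the error of the kernel regression
estimator at `x` for arm `j`. -/
noncomputable def armResidual (L : (S → ℝ) → ℝ) (m : Bool → (S → ℝ) → ℝ) (j : Bool) (h : ℝ)
    (x : S → ℝ) (o : Obs l q) : ℝ :=
  armKernel L j h x o * (o.2.2 - m j x)

lemma measurable_armResidual (hL : Measurable L) (hm : ∀ j, Measurable (m j)) (j : Bool) (h : ℝ) :
    Measurable fun v : (S → ℝ) × Obs l q => armResidual L m j h v.1 v.2 :=
  (measurable_armKernel hL j h).mul ((measurable_obsY.comp measurable_snd).sub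
    ((hm j).comp measurable_fst))

lemma ObservedLaw.exists_regression_bound (hQ : ObservedLaw Q S A B p m fS) :
    ∃ M : ℝ, 0 ≤ M ∧ ∀ j, ∀ x ∈ Icc A B, |m j x| ≤ M := by
  obtain ⟨M₀, h0⟩ := isCompact_Icc.exists_bound_of_continuousOn (hQ.cont_m false)
  obtain ⟨M₁, h1⟩ := isCompact_Icc.exists_bound_of_continuousOn (hQ.cont_m true)
  refine ⟨max 0 (max M₀ M₁), le_max_left _ _, fun j x hx => ?_⟩
  cases j
  · exact (h0 x hx).trans ((le_max_left _ _).trans (le_max_right _ _))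
  · exact (h1 x hx).trans ((le_max_right _ _).trans (le_max_right _ _))

lemma armResidual_sq_le {M : ℝ} {x : S → ℝ} {j : Bool} (hM : |m j x| ≤ M) (h : ℝ) (o : Obs l q) :
    armResidual L m j h x o ^ 2 ≤
      2 * (1 + M ^ 2) * (obsW o * rescale L h x (obsS S o) ^ 2) := by
  have h1 := sq_le_sq.2 (abs_armKernel_le_abs_rescale j h x o (L := L))
  have h2 : m j x ^ 2 ≤ M ^ 2 := by rw [← sq_abs]; exact pow_le_pow_left₀ (abs_nonneg _) hM 2
  have h3 : (o.2.2 - m j x) ^ 2 ≤ 2 * (1 + M ^ 2) * obsW o := by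
    unfold obsW
    nlinarith [sq_nonneg (o.2.2 + m j x), mul_nonneg (sq_nonneg M) (sq_nonneg o.2.2)]
  rw [armResidual, mul_pow]
  calc _ ≤ rescale L h x (obsS S o) ^ 2 * (2 * (1 + M ^ 2) * obsW o) :=
        mul_le_mul h1 h3 (sq_nonneg _) (sq_nonneg _)
    _ = _ := by ring

lemma ObservedLaw.exists_lintegral_armResidual_sq_le (hQ : ObservedLaw Q S A B p m fS)
    (hL : PropensityKernel s₁ L) : ∃ C : ℝ, 0 < C ∧ ∀ h, 0 < h → ∀ x ∈ Icc A B, ∀ j,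
      ∫⁻ o, ENNReal.ofReal (armResidual L m j h x o ^ 2) ∂Q ≤ ENNReal.ofReal (C / h ^ S.card) := by
  obtain ⟨M, hM0, hM⟩ := hQ.exists_regression_bound
  obtain ⟨C, hC, hsq⟩ := hQ.lintegral_weighted_rescale_sq_le hL
  refine ⟨2 * (1 + M ^ 2) * C, by positivity, fun h hh x hx j => ?_⟩
  have hm : Measurable fun o : Obs l q =>
      ENNReal.ofReal (obsW o * rescale L h x (obsS S o) ^ 2) :=
    (measurable_obsW.mul (((measurable_rescale_obsS hL.measurable h).comp
      (measurable_const.prodMk measurable_id)).pow_const 2)).ennreal_ofReal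
  calc _ ≤ ∫⁻ o, ENNReal.ofReal (2 * (1 + M ^ 2)) *
          ENNReal.ofReal (obsW o * rescale L h x (obsS S o) ^ 2) ∂Q := by
        refine lintegral_mono fun o => ?_
        rw [← ENNReal.ofReal_mul (by positivity)]
        exact ENNReal.ofReal_le_ofReal (armResidual_sq_le (hM j x hx) h o)
    _ ≤ ENNReal.ofReal (2 * (1 + M ^ 2)) * ENNReal.ofReal (C / h ^ S.card) := by
        rw [lintegral_const_mul _ hm]
        gcongr
        exact hsq h hh x
    _ = _ := by rw [← ENNReal.ofReal_mul (by positivity), mul_div_assoc]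

lemma ObservedLaw.memLp_armResidual (hQ : ObservedLaw Q S A B p m fS)
    (hL : PropensityKernel s₁ L) {h : ℝ} (hh : 0 < h) {x : S → ℝ} (hx : x ∈ Icc A B) (j : Bool) :
    MemLp (armResidual L m j h x) 2 Q := by
  obtain ⟨C, hC, hle⟩ := hQ.exists_lintegral_armResidual_sq_le hL
  have hm : Measurable (armResidual (l := l) (q := q) L m j h x) :=
    (measurable_armResidual hL.measurable hQ.measurable_m j h).comp
      (measurable_const.prodMk measurable_id)
  rw [memLp_two_iff_integrable_sq hm.aestronglyMeasurable]
  refine ⟨(hm.pow_const 2).aestronglyMeasurable, ?_⟩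
  rw [hasFiniteIntegral_iff_ofReal (Eventually.of_forall fun o => sq_nonneg _)]
  exact (hle h hh x hx j).trans_lt ENNReal.ofReal_lt_top

lemma ObservedLaw.exists_lintegral_weighted_kernel_le (hQ : ObservedLaw Q S A B p m fS)
    {K : (Fin l → ℝ) → ℝ} (hK : Measurable K) (hKi : Integrable K) :
    ∃ C : ENNReal, C ≠ ⊤ ∧ ∀ h, 0 < h → ∀ z,
      ∫⁻ o, ENNReal.ofReal (obsW o) * ‖rescale K h z (obsZ o)‖ₑ ∂Q ≤ C := by
  obtain ⟨C, hC, hle⟩ := hQ.moment_Z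
  refine ⟨C * ∫⁻ u, ‖K u‖ₑ, ENNReal.mul_ne_top hC hKi.2.ne, fun h hh z => ?_⟩
  have hm : Measurable fun x' => ‖rescale K h z x'‖ₑ :=
    ((measurable_rescale hK h).comp (measurable_const.prodMk measurable_id)).enorm
  have h2 := lintegral_mul_comp_le measurable_obsZ measurable_obsW.ennreal_ofReal
    (ν := C • (volume : Measure (Fin l → ℝ))) (C := 1) (by rwa [one_smul]) hm
  rw [one_mul] at h2
  exact h2.trans (lintegral_rescale_le hK hh z le_rfl)

variable [IsProbabilityMeasure Q]

/-- The mean residual is the kernel average of `armProb p j x' * (m j x' - m j x)`. Only `x'` within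
`h` of `x` contribute, and `m j` is uniformly continuous on the box. -/
lemma ObservedLaw.exists_abs_integral_armResidual_le (hQ : ObservedLaw Q S A B p m fS)
    (hL : PropensityKernel s₁ L) {η : ℝ} (hη : 0 < η) : ∃ h₀ : ℝ, 0 < h₀ ∧ ∀ h, 0 < h → h < h₀ →
      ∀ x ∈ Icc A B, ∀ j, |∫ o, armResidual L m j h x o ∂Q| ≤ η := by
  obtain ⟨C, hC, hCL⟩ := hQ.exists_integral_abs_rescale_le hL
  obtain ⟨b, hb, hLb⟩ := hL.exists_bound
  obtain ⟨c, hc, hc1, harm⟩ := hQ.armProb_mem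
  obtain ⟨M, hM0, hM⟩ := hQ.exists_regression_bound
  have hω : 0 < η / C := by positivity
  obtain ⟨δ₀, hδ₀, h0⟩ := uniform_modulus (hQ.cont_m false) hω
  obtain ⟨δ₁, hδ₁, h1⟩ := uniform_modulus (hQ.cont_m true) hω
  have hj : ∀ j, ∀ x ∈ Icc A B, ∀ x' ∈ Icc A B, ‖x' - x‖ ≤ min δ₀ δ₁ →
      |m j x' - m j x| ≤ η / C := by
    intro j x hx x' hx' hd
    cases j
    · exact h0 x hx x' hx' (hd.trans (min_le_left _ _))
    · exact h1 x hx x' hx' (hd.trans (min_le_right _ _))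
  refine ⟨min δ₀ δ₁, by positivity, fun h hh hlt x hx j => ?_⟩
  have hkm : Measurable (rescale L h x) :=
    (measurable_rescale hL.measurable h).comp (measurable_const.prodMk measurable_id)
  have hkb : ∃ C, ∀ x', |rescale L h x x'| ≤ C := ⟨_, fun x' => abs_rescale_le hLb hh x x'⟩
  have hr := integrable_rescale_obsS (Q := Q) hL hh x
  have hak := integrable_armKernel (Q := Q) hL j hh x
  have hres := (hQ.memLp_armResidual hL hh hx j).integrable one_le_two
  have hpm := (measurable_armProb hQ.measurable_p j).comp (measurable_obsS (l := l) (q := q) S)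
  have hmm := (hQ.measurable_m j).comp (measurable_obsS (l := l) (q := q) S)
  have hpr : Integrable (fun o => armProb p j (obsS S o) * rescale L h x (obsS S o)) Q := by
    refine hr.bdd_mul (c := 1) hpm.aestronglyMeasurable ?_
    filter_upwards [hQ.ae_mem] with o ho
    have := harm j _ ho
    rw [Real.norm_eq_abs, abs_of_pos (hc.trans this.1)]; exact this.2.le
  have hpmr : Integrable (fun o => armProb p j (obsS S o) * m j (obsS S o) *
      rescale L h x (obsS S o)) Q := by
    have : Integrable (fun o => m j (obsS S o) *
        (armProb p j (obsS S o) * rescale L h x (obsS S o))) Q := by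
      refine hpr.bdd_mul (c := M) hmm.aestronglyMeasurable ?_
      filter_upwards [hQ.ae_mem] with o ho using hM j _ ho
    refine this.congr (Eventually.of_forall fun o => ?_)
    simp only; ring
  have e0 : ∀ o : Obs l q, {o : Obs l q | o.2.1 = j}.indicator
      (fun o => o.2.2 * rescale L h x (obsS S o)) o =
      armResidual L m j h x o + m j x * armKernel L j h x o := by
    intro o
    by_cases ho : o.2.1 = j
    · simp [indicator, ho, armResidual, armKernel]; ring
    · simp [indicator, ho, armResidual, armKernel]
  have e1 := hQ.arm_outcome j _ hkm hkb
  have e2 := hQ.arm j _ hkm hkb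
  simp_rw [e0] at e1
  rw [integral_add hres (hak.const_mul _), integral_const_mul] at e1
  have e3 : ∫ o, armKernel L j h x o ∂Q =
      ∫ o, armProb p j (obsS S o) * rescale L h x (obsS S o) ∂Q := e2
  have e4 : ∫ o, armResidual L m j h x o ∂Q = ∫ o, (armProb p j (obsS S o) *
      (m j (obsS S o) - m j x)) * rescale L h x (obsS S o) ∂Q := by
    rw [eq_sub_of_add_eq e1, e3, ← integral_const_mul, ← integral_sub hpmr (hpr.const_mul _)]
    refine integral_congr_ae (Eventually.of_forall fun o => ?_)
    simp only; ring
  rw [e4]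
  refine (hQ.abs_integral_mul_rescale_le hL hCL hh hω.le
    (φ := fun x' => armProb p j x' * (m j x' - m j x)) fun x' hx' hd => ?_).trans (le_of_eq ?_)
  · have h2 := hj j x hx x' hx' (hd.trans hlt.le)
    have h3 := harm j x' hx'
    rw [abs_mul, abs_of_pos (hc.trans h3.1)]
    calc _ ≤ 1 * |m j x' - m j x| := by gcongr; exact h3.2.le
      _ ≤ _ := by rwa [one_mul]
  · field_simp

/-- Variance plus squared bias at a fixed point. The variance constant is chosen before the bias
tolerance `η`. -/
lemma ObservedLaw.exists_lintegral_mean_armResidual_sq_le (hQ : ObservedLaw Q S A B p m fS)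
    (hL : PropensityKernel s₁ L) : ∃ C : ℝ, 0 < C ∧ ∀ η : ℝ, 0 < η → ∃ h₀ : ℝ, 0 < h₀ ∧
      ∀ h, 0 < h → h < h₀ → ∀ x ∈ Icc A B, ∀ j, ∀ n : ℕ, 1 ≤ n →
        ∫⁻ u, ENNReal.ofReal (((∑ t, armResidual L m j h x (u t)) / n) ^ 2)
          ∂(Measure.pi fun _ : Fin n => Q) ≤ ENNReal.ofReal (C / (n * h ^ S.card) + η) := by
  obtain ⟨C, hC, hle⟩ := hQ.exists_lintegral_armResidual_sq_le hL
  refine ⟨2 * C, by positivity, fun η hη => ?_⟩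
  -- With the mean `E` bounded by this root, the bias term in `(A + E)² ≤ 2 A² + 2 E²` is at most
  -- `η`.
  have hη' : 0 < √(η / 2) := by positivity
  obtain ⟨h₀, hh₀, hbias⟩ := hQ.exists_abs_integral_armResidual_le hL hη'
  refine ⟨h₀, hh₀, fun h hh hlt x hx j n hn => ?_⟩
  have hn' : (0 : ℝ) < n := by exact_mod_cast hn
  have hmem := hQ.memLp_armResidual hL hh hx j
  have hm : Measurable (armResidual (l := l) (q := q) L m j h x) :=
    (measurable_armResidual hL.measurable hQ.measurable_m j h).comp
      (measurable_const.prodMk measurable_id)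
  set E := ∫ o, armResidual L m j h x o ∂Q with hE
  have hE2 : E ^ 2 ≤ η / 2 := by
    rw [← sq_abs, ← Real.sq_sqrt (by positivity : 0 ≤ η / 2)]
    exact pow_le_pow_left₀ (abs_nonneg _) (hbias h hh hlt x hx j) 2
  have hsq : ∫ o, armResidual L m j h x o ^ 2 ∂Q ≤ C / h ^ S.card := by
    rw [integral_eq_lintegral_of_nonneg_ae (Eventually.of_forall fun o => sq_nonneg _)
      (hm.pow_const 2).aestronglyMeasurable]
    exact ENNReal.toReal_le_of_le_ofReal (by positivity) (hle h hh x hx j)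
  have hvar := lintegral_sum_sq_le Q (n := n) hmem (1 / n : ℝ)
  have hpt : ∀ u : Fin n → Obs l q, ENNReal.ofReal (((∑ t, armResidual L m j h x (u t)) / n) ^ 2) ≤
      2 * ENNReal.ofReal ((1 / n * ∑ t, (armResidual L m j h x (u t) - E)) ^ 2) +
        ENNReal.ofReal η := by
    intro u
    have e1 : (∑ t, armResidual L m j h x (u t)) / n =
        1 / n * ∑ t, (armResidual L m j h x (u t) - E) + E := by
      rw [Finset.sum_sub_distrib, Finset.sum_const, Finset.card_univ, Fintype.card_fin,
          nsmul_eq_mul]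
      field_simp
      ring
    rw [e1, show (2 : ENNReal) = ENNReal.ofReal 2 by simp, ← ENNReal.ofReal_mul (by norm_num),
      ← ENNReal.ofReal_add (by positivity) hη.le]
    refine ENNReal.ofReal_le_ofReal ?_
    nlinarith [sq_nonneg (1 / n * ∑ t, (armResidual L m j h x (u t) - E) - E)]
  calc _ ≤ ∫⁻ u, (2 * ENNReal.ofReal ((1 / n * ∑ t, (armResidual L m j h x (u t) - E)) ^ 2) +
        ENNReal.ofReal η) ∂(Measure.pi fun _ : Fin n => Q) := lintegral_mono hpt
    _ = 2 * ∫⁻ u, ENNReal.ofReal ((1 / n * ∑ t, (armResidual L m j h x (u t) - E)) ^ 2)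
        ∂(Measure.pi fun _ : Fin n => Q) + ENNReal.ofReal η := by
        rw [lintegral_add_right _ measurable_const, lintegral_const_mul' _ _ (by simp)]
        simp
    _ ≤ 2 * ENNReal.ofReal ((1 / n : ℝ) ^ 2 * n * (C / h ^ S.card)) + ENNReal.ofReal η := by
        refine add_le_add (mul_le_mul_right (hvar.trans (ENNReal.ofReal_le_ofReal ?_)) _) le_rfl
        gcongr
    _ = _ := by
        rw [show (2 : ENNReal) = ENNReal.ofReal 2 by simp, ← ENNReal.ofReal_mul (by norm_num),
          ← ENNReal.ofReal_add (by positivity) hη.le]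
        congr 2
        field_simp

/-- The weighted mean squared errors of the kernel regression estimators vanish. -/
lemma ObservedLaw.eventually_lintegral_residual_le (hQ : ObservedLaw Q S A B p m fS)
    (hL : PropensityKernel s₁ L) {s : ℕ} {h h₁ : ℕ → ℝ} (hh : Bandwidths l S.card s s₁ h h₁)
    (hscale : Tendsto (fun n : ℕ => 1 / (n * h₁ (n + 1) ^ S.card)) atTop (𝓝 0))
    {K : (Fin l → ℝ) → ℝ} (hK : Measurable K) (hKi : Integrable K) (z : Fin l → ℝ)
    {ε : ℝ} (hε : 0 < ε) : ∀ᶠ n : ℕ in atTop, ∀ i : Fin (n + 1), ∀ j,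
      ∫⁻ v, ‖rescale K (h (n + 1)) z (obsZ (v i))‖ₑ * ENNReal.ofReal
        (((∑ t, armResidual L m j (h₁ (n + 1)) (obsS S (v i)) (v t)) / n) ^ 2)
          ∂(Measure.pi fun _ : Fin (n + 1) => Q) ≤ ENNReal.ofReal ε := by
  obtain ⟨CK, hCK, hKle⟩ := hQ.exists_lintegral_weighted_kernel_le hK hKi
  obtain ⟨C, hC, hmean⟩ := hQ.exists_lintegral_mean_armResidual_sq_le hL
  obtain ⟨M, hM0, hM⟩ := hQ.exists_regression_bound
  obtain ⟨b, hb, hLb⟩ := hL.exists_bound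
  let c := CK.toReal + 1
  have hc : 0 < c := by positivity
  have hη : 0 < ε / (8 * c) := by positivity
  obtain ⟨h₀, hh₀, hmean⟩ := hmean _ hη
  -- `D / 2` bounds the squared self-term relative to `r² * obsW`; the factor two comes from
  -- squaring a sum of two terms.
  let D := 2 * (2 * (1 + M ^ 2) * b ^ 2)
  have hlim : Tendsto (fun n : ℕ => D * (1 / (n * h₁ (n + 1) ^ S.card)) ^ 2 +
      2 * (C * (1 / (n * h₁ (n + 1) ^ S.card)) + ε / (8 * c))) atTop
      (𝓝 (D * 0 ^ 2 + 2 * (C * 0 + ε / (8 * c)))) :=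
    ((hscale.pow 2).const_mul D).add (((hscale.const_mul C).add_const _).const_mul 2)
  have hlt : D * 0 ^ 2 + 2 * (C * 0 + ε / (8 * c)) < ε / c := by
    have : 2 * (ε / (8 * c)) = ε / c / 4 := by field_simp; norm_num
    have h2 : 0 < ε / c := by positivity
    simp only [mul_zero, zero_add, ne_eq, OfNat.ofNat_ne_zero, not_false_eq_true, zero_pow]
    linarith
  filter_upwards [hlim.eventually (gt_mem_nhds hlt), eventually_ge_atTop 1,
    ((tendsto_add_atTop_iff_nat 1).2 hh.h₁_zero).eventually (gt_mem_nhds hh₀)]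
    with n hn1 hn2 hn3 i j
  have hpos := hh.h₁_pos (n + 1)
  have hn' : (0 : ℝ) < n := by exact_mod_cast hn2
  have hp : 0 < h₁ (n + 1) ^ S.card := by positivity
  set r := 1 / (n * h₁ (n + 1) ^ S.card) with hr
  have hres : Measurable fun v : (S → ℝ) × Obs l q => armResidual L m j (h₁ (n + 1)) v.1 v.2 :=
    measurable_armResidual hL.measurable hQ.measurable_m j _
  have hKm : Measurable fun o : Obs l q => ‖rescale K (h (n + 1)) z (obsZ o)‖ₑ :=
    ((measurable_rescale hK _).comp (measurable_const.prodMk measurable_obsZ)).enorm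
  -- Unlike `p̂`, the regression estimator includes the observation at which it is evaluated. That
  -- term depends on the evaluation point and is split off; it is of order `1 / (n * h₁ ^ card)`.
  -- The rest is a sum over `n` fresh draws.
  let F : Obs l q → (Fin n → Obs l q) → ENNReal := fun o u =>
    ‖rescale K (h (n + 1)) z (obsZ o)‖ₑ * ENNReal.ofReal
      (((armResidual L m j (h₁ (n + 1)) (obsS S o) o +
        ∑ t, armResidual L m j (h₁ (n + 1)) (obsS S o) (u t)) / n) ^ 2)
  have hs : Measurable fun v : Obs l q × (Fin n → Obs l q) => obsS S v.1 :=
    (measurable_obsS S).comp measurable_fst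
  have hF : Measurable (Function.uncurry F) := by
    refine (hKm.comp measurable_fst).mul (Measurable.ennreal_ofReal (Measurable.pow_const
      (Measurable.div_const (Measurable.add ?_ (Finset.measurable_sum _ fun t _ => ?_)) _) 2))
    · exact hres.comp (hs.prodMk measurable_fst)
    · exact hres.comp (hs.prodMk ((measurable_pi_apply t).comp measurable_snd))
  have heq : ∀ v : Fin (n + 1) → Obs l q,
      ‖rescale K (h (n + 1)) z (obsZ (v i))‖ₑ * ENNReal.ofReal
        (((∑ t, armResidual L m j (h₁ (n + 1)) (obsS S (v i)) (v t)) / n) ^ 2) =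
      F (v i) (fun t => v (i.succAbove t)) := by
    intro v
    rw [Fin.sum_univ_succAbove _ i]
  simp_rw [heq]
  rw [lintegral_pi_succAbove Q i hF]
  have hself : ∀ o : Obs l q, obsS S o ∈ Icc A B →
      (armResidual L m j (h₁ (n + 1)) (obsS S o) o / n) ^ 2 ≤ D / 2 * r ^ 2 * obsW o := by
    intro o ho
    have h1 := armResidual_sq_le (L := L) (hM j _ ho) (h₁ (n + 1)) o
    have h2 := abs_rescale_le hLb hpos (obsS S o) (obsS S o)
    rw [Fintype.card_coe] at h2
    have h3 : rescale L (h₁ (n + 1)) (obsS S o) (obsS S o) ^ 2 ≤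
        (b / h₁ (n + 1) ^ S.card) ^ 2 := by
      rw [← sq_abs]; exact pow_le_pow_left₀ (abs_nonneg _) h2 2
    have h4 : armResidual L m j (h₁ (n + 1)) (obsS S o) o ^ 2 ≤
        2 * (1 + M ^ 2) * (obsW o * (b / h₁ (n + 1) ^ S.card) ^ 2) := by
      refine h1.trans ?_
      have := (obsW_pos o).le
      gcongr
    rw [div_pow]
    calc _ ≤ 2 * (1 + M ^ 2) * (obsW o * (b / h₁ (n + 1) ^ S.card) ^ 2) / (n : ℝ) ^ 2 := by gcongr
      _ = _ := by simp only [D, hr]; field_simp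
  calc ∫⁻ o, ∫⁻ u, F o u ∂(Measure.pi fun _ : Fin n => Q) ∂Q
      ≤ ∫⁻ o, ENNReal.ofReal (ε / c) *
          (ENNReal.ofReal (obsW o) * ‖rescale K (h (n + 1)) z (obsZ o)‖ₑ) ∂Q := by
        refine lintegral_mono_ae ?_
        filter_upwards [hQ.ae_mem] with o ho
        have hWpos := obsW_pos o
        have hpt : ∀ u : Fin n → Obs l q, F o u ≤ ‖rescale K (h (n + 1)) z (obsZ o)‖ₑ *
            (ENNReal.ofReal (D * r ^ 2 * obsW o) + 2 * ENNReal.ofReal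
              (((∑ t, armResidual L m j (h₁ (n + 1)) (obsS S o) (u t)) / n) ^ 2)) := by
          intro u
          refine mul_le_mul_right ?_ _
          rw [show (2 : ENNReal) = ENNReal.ofReal 2 by simp, ← ENNReal.ofReal_mul (by norm_num),
            ← ENNReal.ofReal_add (by positivity) (by positivity)]
          refine ENNReal.ofReal_le_ofReal ?_
          rw [add_div]
          nlinarith [hself o ho, sq_nonneg (armResidual L m j (h₁ (n + 1)) (obsS S o) o / n -
            (∑ t, armResidual L m j (h₁ (n + 1)) (obsS S o) (u t)) / n)]
        calc ∫⁻ u, F o u ∂(Measure.pi fun _ : Fin n => Q)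
            ≤ ∫⁻ u, ‖rescale K (h (n + 1)) z (obsZ o)‖ₑ *
              (ENNReal.ofReal (D * r ^ 2 * obsW o) + 2 * ENNReal.ofReal
                (((∑ t, armResidual L m j (h₁ (n + 1)) (obsS S o) (u t)) / n) ^ 2))
              ∂(Measure.pi fun _ : Fin n => Q) := lintegral_mono hpt
          _ = ‖rescale K (h (n + 1)) z (obsZ o)‖ₑ * (ENNReal.ofReal (D * r ^ 2 * obsW o) +
              2 * ∫⁻ u, ENNReal.ofReal
                (((∑ t, armResidual L m j (h₁ (n + 1)) (obsS S o) (u t)) / n) ^ 2)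
              ∂(Measure.pi fun _ : Fin n => Q)) := by
              rw [lintegral_const_mul' _ _ enorm_ne_top, lintegral_add_left measurable_const,
                lintegral_const_mul' _ _ (by simp)]
              simp
          _ ≤ ‖rescale K (h (n + 1)) z (obsZ o)‖ₑ * (ENNReal.ofReal (D * r ^ 2 * obsW o) +
              2 * ENNReal.ofReal (C / (n * h₁ (n + 1) ^ S.card) + ε / (8 * c))) := by
              gcongr
              exact hmean _ hpos hn3 _ ho j n hn2
          _ ≤ ‖rescale K (h (n + 1)) z (obsZ o)‖ₑ * ENNReal.ofReal (ε / c * obsW o) := by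
              -- The constant mean squared error is absorbed into the weight because `obsW` is at
              -- least one.
              refine mul_le_mul_right ?_ _
              rw [show (2 : ENNReal) = ENNReal.ofReal 2 by simp,
                ← ENNReal.ofReal_mul (by norm_num),
                ← ENNReal.ofReal_add (by positivity) (by positivity)]
              refine ENNReal.ofReal_le_ofReal ?_
              have h5 : C / (n * h₁ (n + 1) ^ S.card) = C * r := by rw [hr]; ring
              rw [h5]
              have h6 : 0 ≤ 2 * (C * r + ε / (8 * c)) := by positivity
              nlinarith [one_le_obsW o, mul_le_mul_of_nonneg_left (one_le_obsW o) h6,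
                mul_le_mul_of_nonneg_right hn1.le hWpos.le]
          _ = _ := by
              rw [ENNReal.ofReal_mul (by positivity)]; ring
    _ ≤ ENNReal.ofReal (ε / c) * CK := by
        rw [lintegral_const_mul' _ _ ENNReal.ofReal_ne_top]
        gcongr
        exact hKle _ (hh.h_pos _) z
    _ ≤ ENNReal.ofReal (ε / c) * ENNReal.ofReal c := by
        gcongr
        conv_lhs => rw [← ENNReal.ofReal_toReal hCK]
        exact ENNReal.ofReal_le_ofReal (by simp [c])
    _ = ENNReal.ofReal ε := by
        rw [← ENNReal.ofReal_mul (by positivity), div_mul_cancel₀ _ hc.ne']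

end Residuals

/-! ### Deterministic error bounds for the estimated scores. -/

section PlugIn

variable {l q : ℕ} {Q : Measure (Obs l q)} {S : Finset (Fin (l + q))}
  {A B : S → ℝ} {p : (S → ℝ) → ℝ} {m : Bool → (S → ℝ) → ℝ} {fS : (S → ℝ) → ℝ}
  {L : (S → ℝ) → ℝ} {s₁ : ℕ}

lemma scaledL_eq_rescale (L : (S → ℝ) → ℝ) (h : ℝ) (x x' : S → ℝ) :
    scaledL L h (x' - x) = rescale L h x x' := by
  rw [scaledL, rescale, Fintype.card_coe]

lemma sum_erase_eq_sum_succAbove {n : ℕ} (i : Fin (n + 1)) (f : Fin (n + 1) → ℝ) :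
    ∑ j ∈ Finset.univ.erase i, f j = ∑ t, f (i.succAbove t) := by
  have h1 := Finset.add_sum_erase Finset.univ f (Finset.mem_univ i)
  rw [Fin.sum_univ_succAbove f i] at h1
  linarith

lemma pHat_eq {n : ℕ} (h : ℝ) (v : Fin (n + 1) → Obs l q) (i : Fin (n + 1)) :
    pHat L h v i = armSum L true h (obsS S (v i)) (fun t => v (i.succAbove t)) /
      (armSum L true h (obsS S (v i)) (fun t => v (i.succAbove t)) +
        armSum L false h (obsS S (v i)) (fun t => v (i.succAbove t))) := by
  unfold pHat armSum
  rw [sum_erase_eq_sum_succAbove, sum_erase_eq_sum_succAbove, ← Finset.sum_add_distrib]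
  congr 1
  · refine Finset.sum_congr rfl fun t _ => ?_
    rw [scaledL_eq_rescale]
    cases hd : (v (i.succAbove t)).2.1 <;> simp [armKernel, indicator, hd, dnum, obsS]
  · refine Finset.sum_congr rfl fun t _ => ?_
    rw [scaledL_eq_rescale]
    cases hd : (v (i.succAbove t)).2.1 <;> simp [armKernel, indicator, hd, obsS]

lemma mHat_eq {n : ℕ} (h : ℝ) (v : Fin n → Obs l q) (j : Bool) (x : S → ℝ) :
    mHat L h v j x = (∑ t, armKernel L j h x (v t) * (v t).2.2) / ∑ t, armKernel L j h x (v t) := by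
  unfold mHat
  rw [Finset.sum_filter, Finset.sum_filter]
  congr 1
  · refine Finset.sum_congr rfl fun t _ => ?_
    by_cases hd : (v t).2.1 = j <;> simp [armKernel, indicator, hd, obsS, scaledL_eq_rescale]
  · refine Finset.sum_congr rfl fun t _ => ?_
    by_cases hd : (v t).2.1 = j <;> simp [armKernel, indicator, hd, obsS, scaledL_eq_rescale]

/-- Centring the outcomes at `m j x` puts the whole error in the numerator, so the denominator only
has to be bounded below. -/
lemma mHat_sub_eq {n : ℕ} (h : ℝ) (v : Fin n → Obs l q) (j : Bool) (x : S → ℝ)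
    (h0 : ∑ t, armKernel L j h x (v t) ≠ 0) :
    mHat L h v j x - m j x =
      (∑ t, armResidual L m j h x (v t)) / ∑ t, armKernel L j h x (v t) := by
  rw [mHat_eq, eq_div_iff h0, sub_mul, div_mul_cancel₀ _ h0, Finset.mul_sum,
    ← Finset.sum_sub_distrib]
  refine Finset.sum_congr rfl fun t _ => ?_
  rw [armResidual]; ring

/-- The condition `δ ≤ c / 2` keeps the perturbed denominator above `c / 2`. The error in `r` is
multiplied by the outcome, which is why `|y|` appears. -/
lemma abs_div_sub_div_le {c M r r' x x' y δ : ℝ} (hc : 0 < c) (hr : c < r) (hrr : |r' - r| ≤ δ)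
    (hδc : δ ≤ c / 2) (hx : |x| ≤ M) :
    |(y - x') / r' - (y - x) / r| ≤ 2 / c * |x' - x| + 2 / c ^ 2 * δ * (|y| + M) := by
  have hr' : c / 2 ≤ r' := by linarith [(abs_le.1 hrr).1]
  have hrpos : 0 < r := hc.trans hr
  have hrpos' : 0 < r' := by linarith
  have hM : 0 ≤ M := (abs_nonneg _).trans hx
  have hδ0 : 0 ≤ δ := (abs_nonneg _).trans hrr
  have e1 : (y - x') / r' - (y - x) / r = -(x' - x) / r' + (y - x) * ((r - r') / (r' * r)) := by
    field_simp; ring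
  rw [e1]
  refine (abs_add_le _ _).trans (add_le_add ?_ ?_)
  · rw [abs_div, abs_neg, abs_of_pos hrpos', div_le_iff₀ hrpos', mul_right_comm]
    refine le_mul_of_one_le_left (abs_nonneg _) ?_
    rw [div_mul_eq_mul_div, le_div_iff₀ hc]; linarith
  · rw [abs_mul, abs_div, abs_of_pos (mul_pos hrpos' hrpos), abs_sub_comm r r', mul_comm]
    have hyx : |y - x| ≤ |y| + M := (abs_sub _ _).trans (by linarith)
    have h4 : c / 2 * c ≤ r' * r := mul_le_mul hr' hr.le hc.le hrpos'.le
    have h3 : |r' - r| / (r' * r) ≤ 2 / c ^ 2 * δ := by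
      rw [div_le_iff₀ (mul_pos hrpos' hrpos)]
      calc |r' - r| ≤ δ := hrr
        _ = 2 / c ^ 2 * δ * (c / 2 * c) := by field_simp
        _ ≤ _ := mul_le_mul_of_nonneg_left h4 (by positivity)
    exact mul_le_mul h3 hyx (abs_nonneg _) (by positivity)

lemma abs_psiStar_sub_le {c M p₀ m₀ m₁ δ p₁ n₀ n₁ y : ℝ} {d : Bool} (hc : 0 < c)
    (hp : c < p₀ ∧ p₀ < 1 - c) (h0 : |m₀| ≤ M) (h1 : |m₁| ≤ M) (hδ : |p₁ - p₀| ≤ δ)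
    (hδc : δ ≤ c / 2) :
    |psiStar p₁ n₀ n₁ d y - psiStar p₀ m₀ m₁ d y| ≤
      (2 / c + 1) * (|n₀ - m₀| + |n₁ - m₁|) + 2 / c ^ 2 * δ * (|y| + M) := by
  have hc2 : 0 < 2 / c := by positivity
  have hp0 := mul_nonneg hc2.le (abs_nonneg (n₀ - m₀))
  have hp1 := mul_nonneg hc2.le (abs_nonneg (n₁ - m₁))
  have h3 := abs_sub (n₁ - m₁) (n₀ - m₀)
  cases d
  · have e1 : psiStar p₁ n₀ n₁ false y - psiStar p₀ m₀ m₁ false y =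
        -((y - n₀) / (1 - p₁) - (y - m₀) / (1 - p₀)) + ((n₁ - m₁) - (n₀ - m₀)) := by
      simp only [psiStar, dnum, cond_false]; ring
    have hδ' : |(1 - p₁) - (1 - p₀)| ≤ δ := by rw [← abs_neg]; simpa using hδ
    have h2 := abs_div_sub_div_le (y := y) (x' := n₀) hc (by linarith [hp.2]) hδ' hδc h0
    rw [e1]
    refine (abs_add_le _ _).trans ?_
    rw [abs_neg]
    linarith
  · have e1 : psiStar p₁ n₀ n₁ true y - psiStar p₀ m₀ m₁ true y =
        ((y - n₁) / p₁ - (y - m₁) / p₀) + ((n₁ - m₁) - (n₀ - m₀)) := by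
      simp only [psiStar, dnum, cond_true]; ring
    have h2 := abs_div_sub_div_le (y := y) (x' := n₁) hc hp.1 hδ hδc h1
    rw [e1]
    refine (abs_add_le _ _).trans ?_
    linarith

/-- The augmented score depends continuously on the nuisance parameters. -/
lemma psiStar_sub_sq_le {c M p₀ m₀ m₁ δ p₁ n₀ n₁ y : ℝ} {d : Bool} (hc : 0 < c)
    (hp : c < p₀ ∧ p₀ < 1 - c) (h0 : |m₀| ≤ M) (h1 : |m₁| ≤ M) (hδ : |p₁ - p₀| ≤ δ)
    (hδc : δ ≤ c / 2) :
    (psiStar p₁ n₀ n₁ d y - psiStar p₀ m₀ m₁ d y) ^ 2 ≤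
      (4 * (2 / c + 1) ^ 2 + 16 * (1 + M ^ 2) / c ^ 4) *
        (δ ^ 2 * (1 + y ^ 2) + ((n₀ - m₀) ^ 2 + (n₁ - m₁) ^ 2)) := by
  have hδ0 : 0 ≤ δ := (abs_nonneg _).trans hδ
  have habs := abs_psiStar_sub_le (n₀ := n₀) (n₁ := n₁) (y := y) (d := d) hc hp h0 h1 hδ hδc
  have hsq := pow_le_pow_left₀ (abs_nonneg _) habs 2
  rw [sq_abs] at hsq
  rw [← sq_abs (n₀ - m₀), ← sq_abs (n₁ - m₁)]
  generalize psiStar p₁ n₀ n₁ d y - psiStar p₀ m₀ m₁ d y = T at hsq ⊢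
  generalize |n₀ - m₀| = D₀ at hsq ⊢
  generalize |n₁ - m₁| = D₁ at hsq ⊢
  have h5 : (|y| + M) ^ 2 ≤ 2 * ((1 + M ^ 2) * (1 + y ^ 2)) := by
    nlinarith [sq_nonneg (|y| - M), sq_abs y, sq_nonneg (M * y)]
  have s3 : 2 * (2 / c ^ 2 * δ * (|y| + M)) ^ 2 ≤
      16 * (1 + M ^ 2) / c ^ 4 * (δ ^ 2 * (1 + y ^ 2)) := by
    calc 2 * (2 / c ^ 2 * δ * (|y| + M)) ^ 2 = 8 / c ^ 4 * δ ^ 2 * (|y| + M) ^ 2 := by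
          field_simp; ring
      _ ≤ 8 / c ^ 4 * δ ^ 2 * (2 * ((1 + M ^ 2) * (1 + y ^ 2))) :=
          mul_le_mul_of_nonneg_left h5 (by positivity)
      _ = _ := by ring
  have t1 : 0 ≤ 4 * (2 / c + 1) ^ 2 * (δ ^ 2 * (1 + y ^ 2)) := by positivity
  have t2 : 0 ≤ 16 * (1 + M ^ 2) / c ^ 4 * (D₀ ^ 2 + D₁ ^ 2) := by positivity
  generalize 2 / c + 1 = a at *
  generalize 2 / c ^ 2 * δ * (|y| + M) = e at *
  have s1 : (a * (D₀ + D₁) + e) ^ 2 ≤ 2 * (a * (D₀ + D₁)) ^ 2 + 2 * e ^ 2 := by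
    linarith [sq_nonneg (a * (D₀ + D₁) - e)]
  have s2 : 2 * (a * (D₀ + D₁)) ^ 2 ≤ 4 * a ^ 2 * (D₀ ^ 2 + D₁ ^ 2) := by
    linarith [sq_nonneg (a * (D₀ - D₁))]
  linarith

/-- The common factor `lam` cancels: the error of the ratio is a combination of the two deviations,
with weights `1 - P₀` and `P₀`, over a denominator of at least `N * c / 2`. This is what makes `p̂`
reliable up to the boundary. -/
lemma abs_ratio_sub_le {P₀ lam c N η a₁ a₀ : ℝ} (hP : 0 < P₀ ∧ P₀ < 1) (hN : 0 < N) (hc : 0 < c)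
    (hlam : c ≤ lam) (hη : η ≤ c / 4) (h1 : |a₁ - N * (P₀ * lam)| < N * η)
    (h0 : |a₀ - N * ((1 - P₀) * lam)| < N * η) :
    |a₁ / (a₁ + a₀) - P₀| ≤ 6 * η / c := by
  have hη0 : 0 < η := pos_of_mul_pos_right ((abs_nonneg _).trans_lt h1) hN.le
  rw [abs_lt] at h1 h0
  have hden : N * (c / 2) ≤ a₁ + a₀ := by nlinarith
  have hdpos : 0 < a₁ + a₀ := lt_of_lt_of_le (by positivity) hden
  have e1 : a₁ / (a₁ + a₀) - P₀ = ((a₁ - N * (P₀ * lam)) * (1 - P₀) -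
      P₀ * (a₀ - N * ((1 - P₀) * lam))) / (a₁ + a₀) := by
    field_simp; ring
  rw [e1, abs_div, abs_of_pos hdpos, div_le_iff₀ hdpos]
  have hnum : |(a₁ - N * (P₀ * lam)) * (1 - P₀) - P₀ * (a₀ - N * ((1 - P₀) * lam))| ≤
      N * η := by
    rw [abs_le]
    constructor <;> nlinarith
  refine hnum.trans ?_
  calc N * η ≤ 6 * η / c * (N * (c / 2)) := by
        have : 6 * η / c * (N * (c / 2)) = 3 * (N * η) := by field_simp; norm_num
        rw [this]; nlinarith
    _ ≤ _ := by gcongr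

/-- On the event of concentration the errors of both estimated scores are controlled by the
deviation parameter and the mean residuals. -/
lemma ObservedLaw.exists_score_error_le (hQ : ObservedLaw Q S A B p m fS)
    (hL : PropensityKernel s₁ L) : ∃ C : ℝ, 0 < C ∧ ∀ δ : ℝ, 0 < δ → ∃ η : ℝ, 0 < η ∧
      ∃ h₀ : ℝ, 0 < h₀ ∧ ∃ r₀ : ℝ, 0 < r₀ ∧ ∀ h, 0 < h → h < h₀ → ∀ n : ℕ, 1 ≤ n →
        1 / (n * h ^ S.card) < r₀ → ∀ v : Fin (n + 1) → Obs l q, Concentrated Q A B p L h η v →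
          ∀ i, (psiHat L h v i - score S p (fun _ _ => 0) (v i)) ^ 2 ≤
              C * (δ * obsW (v i) +
                (((∑ t, armResidual L m false h (obsS S (v i)) (v t)) / n) ^ 2 +
                  ((∑ t, armResidual L m true h (obsS S (v i)) (v t)) / n) ^ 2)) ∧
            (psiStarHat L h v i - score S p m (v i)) ^ 2 ≤
              C * (δ * obsW (v i) +
                (((∑ t, armResidual L m false h (obsS S (v i)) (v t)) / n) ^ 2 +
                  ((∑ t, armResidual L m true h (obsS S (v i)) (v t)) / n) ^ 2)) := by
  obtain ⟨c, hc, hover⟩ := hQ.overlap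
  have hc1 : c < 1 := by
    have := hover A ⟨le_rfl, fun i => (hQ.box i).le⟩
    linarith
  obtain ⟨c₂, hc₂, h₀, hh₀, hlam⟩ := hQ.exists_le_smoothedDensity hL
  obtain ⟨M, hM0, hM⟩ := hQ.exists_regression_bound
  obtain ⟨b, hb, hLb⟩ := hL.exists_bound
  let G := 4 * (2 / c + 1) ^ 2 + 16 * (1 + M ^ 2) / c ^ 4
  have hG : 0 < G := by positivity
  let k := 2 / (c * c₂)
  have hk : 0 < k := by positivity
  refine ⟨G * (1 + k ^ 2), by positivity, fun δ hδ => ?_⟩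
  -- The precision asked of `p̂`: the root yields `d ^ 2 ≤ δ`, and `c / 2` keeps `p̂` away from zero
  -- and one.
  let d := min (√δ) (c / 2)
  have hd : 0 < d := by positivity
  have hd2 : d ^ 2 ≤ δ := by
    rw [← Real.sq_sqrt hδ.le]; exact pow_le_pow_left₀ hd.le (min_le_left _ _) 2
  -- The first bound lets deviations use up at most a quarter of each arm's mass; the second makes
  -- the error of the ratio at most `d`.
  let η := min (c * c₂ / 4) (d * c₂ / 6)
  have hη : 0 < η := by positivity
  have hη1 : η ≤ c * c₂ / 4 := min_le_left _ _
  have hη2 : 6 * η / c₂ ≤ d := by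
    rw [div_le_iff₀ hc₂]; linarith [min_le_right (c * c₂ / 4) (d * c₂ / 6)]
  refine ⟨η, hη, h₀, hh₀, c * c₂ / (4 * b), by positivity,
    fun h hh hlt n hn hr v hv i => ?_⟩
  have hn' : (0 : ℝ) < n := by exact_mod_cast hn
  obtain ⟨hbox, harm⟩ := hv i
  set x := obsS S (v i) with hx
  have hl := hlam h hh hlt x hbox
  have hpx := hover x hbox
  have hpHat : |pHat L h v i - p x| ≤ d := by
    rw [pHat_eq]
    refine (abs_ratio_sub_le (P₀ := p x) (N := n) (lam := smoothedDensity Q L h x) (c := c₂)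
        (η := η)
      ⟨by linarith, by linarith⟩ hn' hc₂ hl ?_ (harm true) (harm false)).trans hη2
    refine hη1.trans ?_
    nlinarith
  have hden : ∀ j, n * (c * c₂ / 2) ≤ ∑ t, armKernel L j h x (v t) := by
    intro j
    have h1 := (abs_lt.1 (harm j)).1
    have h2 : c * c₂ ≤ armProb p j x * smoothedDensity Q L h x := by
      have : c ≤ armProb p j x := by
        cases j <;> simp only [armProb, cond_true, cond_false] <;> linarith
      exact mul_le_mul this hl hc₂.le (hc.le.trans this)
    -- The regression denominator contains observation `i` itself, with a possibly negative kernel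
    -- value. The threshold `r₀` limits it to another quarter, so half of the mass remains.
    have h3 : |armKernel L j h x (v i)| ≤ n * (c * c₂ / 4) := by
      refine (abs_armKernel_le_abs_rescale j h x (v i)).trans
        ((abs_rescale_le hLb hh x (obsS S (v i))).trans ?_)
      rw [Fintype.card_coe]
      rw [div_lt_div_iff₀ (by positivity) (by positivity)] at hr
      rw [div_le_iff₀ (by positivity)]
      nlinarith
    rw [Fin.sum_univ_succAbove _ i]
    have h4 : ∑ t, armKernel L j h x (v (i.succAbove t)) =
      armSum L j h x (fun t => v (i.succAbove t)) := rfl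
    rw [h4]
    nlinarith [(abs_le.1 h3).1]
  have hmHat : ∀ j, (mHat L h v j x - m j x) ^ 2 ≤
      k ^ 2 * ((∑ t, armResidual L m j h x (v t)) / n) ^ 2 := by
    intro j
    have hdj := hden j
    have hpos : 0 < n * (c * c₂ / 2) := by positivity
    have hne : 0 < ∑ t, armKernel L j h x (v t) := hpos.trans_le hdj
    rw [mHat_sub_eq h v j x hne.ne', div_pow, ← mul_pow]
    have e1 : (k * ((∑ t, armResidual L m j h x (v t)) / n)) ^ 2 =
        (∑ t, armResidual L m j h x (v t)) ^ 2 / (n * (c * c₂ / 2)) ^ 2 := by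
      simp only [k]; field_simp
    rw [e1]
    gcongr
  have hW : obsW (v i) = 1 + (v i).2.2 ^ 2 := rfl
  have hWpos := obsW_pos (v i)
  set R₀ := ((∑ t, armResidual L m false h x (v t)) / n) ^ 2
  set R₁ := ((∑ t, armResidual L m true h x (v t)) / n) ^ 2
  have hR₀ : 0 ≤ R₀ := sq_nonneg _
  have hR₁ : 0 ≤ R₁ := sq_nonneg _
  have hfin : ∀ e : ℝ, e ≤ k ^ 2 * (R₀ + R₁) →
      G * (d ^ 2 * (1 + (v i).2.2 ^ 2) + e) ≤ G * (1 + k ^ 2) * (δ * obsW (v i) + (R₀ + R₁)) := by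
    intro e he
    rw [mul_assoc, ← hW]
    refine mul_le_mul_of_nonneg_left ?_ hG.le
    have h1 : d ^ 2 * obsW (v i) ≤ δ * obsW (v i) := by gcongr
    nlinarith [mul_nonneg (sq_nonneg k) (mul_nonneg hδ.le hWpos.le)]
  constructor
  · have e1 : psiHat L h v i = psiStar (pHat L h v i) 0 0 (v i).2.1 (v i).2.2 := by
      simp [psiHat, psi, psiStar]
    have h1 := psiStar_sub_sq_le (m₀ := 0) (m₁ := 0) (M := M) (n₀ := 0) (n₁ := 0) (y := (v i).2.2)
        (d := (v i).2.1) hc hpx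
      (by simpa using hM0) (by simpa using hM0) hpHat (min_le_right _ _)
    rw [e1]
    refine h1.trans (hfin _ ?_)
    have := mul_nonneg (sq_nonneg k) (add_nonneg hR₀ hR₁)
    linarith
  · refine (psiStar_sub_sq_le hc hpx (hM false x hbox) (hM true x hbox) hpHat
      (min_le_right _ _)).trans (hfin _ ?_)
    have := add_le_add (hmHat false) (hmHat true)
    rw [mul_add]
    exact this

end PlugIn

/-! ### Kernel weighted mean squared error of the estimated scores. -/

section WeightedError

variable {l q : ℕ} {Q : Measure (Obs l q)} [IsProbabilityMeasure Q] {S : Finset (Fin (l + q))}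
  {A B : S → ℝ} {p : (S → ℝ) → ℝ} {m : Bool → (S → ℝ) → ℝ} {fS : (S → ℝ) → ℝ}
  {L : (S → ℝ) → ℝ} {s₁ : ℕ}

lemma Bandwidths.tendsto_one_div_mul_pow {l kt s s₁ : ℕ} {h h₁ : ℕ → ℝ}
    (hh : Bandwidths l kt s s₁ h h₁) :
    Tendsto (fun n : ℕ => 1 / (n * h₁ (n + 1) ^ kt)) atTop (𝓝 0) := by
  have h3 := hh.tendsto_inv_mul_pow.const_mul (1 / Real.log 2)
  rw [mul_zero] at h3
  refine tendsto_of_tendsto_of_tendsto_of_le_of_le' tendsto_const_nhds h3 ?_ ?_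
  · refine Eventually.of_forall fun n => ?_
    have := hh.h₁_pos (n + 1)
    positivity
  · filter_upwards [eventually_ge_atTop 1] with n hn
    have hpos := hh.h₁_pos (n + 1)
    have hn' : (1 : ℝ) ≤ n := by exact_mod_cast hn
    have hlog2 : 0 < Real.log 2 := Real.log_pos (by norm_num)
    have hlog : Real.log 2 ≤ Real.log ((n : ℝ) + 1) := Real.log_le_log (by norm_num) (by linarith)
    rw [mul_div_assoc']
    gcongr
    rw [one_div, inv_mul_eq_div, one_le_div hlog2]
    exact hlog

/-- The errors of both estimated scores vanish in kernel weighted mean square. -/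
lemma ObservedLaw.convProb_weighted_score_error (hQ : ObservedLaw Q S A B p m fS)
    (hL : PropensityKernel s₁ L) {s : ℕ} {h h₁ : ℕ → ℝ} (hh : Bandwidths l S.card s s₁ h h₁)
    {K : (Fin l → ℝ) → ℝ} (hK : Measurable K) (hKi : Integrable K) (z : Fin l → ℝ) :
    ConvProb Q (fun n v => (∑ i, |rescale K (h n) z (obsZ (v i))| *
      ((psiHat L (h₁ n) v i - score S p (fun _ _ => 0) (v i)) ^ 2 +
        (psiStarHat L (h₁ n) v i - score S p m (v i)) ^ 2)) / n) 0 := by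
  refine convProb_of_eventually_le fun ε hε η hη => ?_
  -- Leave-one-out sums are indexed by samples of size `n + 1`, so the limit is taken along the
  -- shifted sequence.
  suffices hs : ∀ᶠ n : ℕ in atTop, Measure.pi (fun _ : Fin (n + 1) => Q)
      {v | ε ≤ dist ((∑ i, |rescale K (h (n + 1)) z (obsZ (v i))| *
      ((psiHat L (h₁ (n + 1)) v i - score S p (fun _ _ => 0) (v i)) ^ 2 +
        (psiStarHat L (h₁ (n + 1)) v i - score S p m (v i)) ^ 2)) / ((n + 1 : ℕ) : ℝ)) 0}
        ≤ ENNReal.ofReal η by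
    obtain ⟨N, hN⟩ := eventually_atTop.1 hs
    refine eventually_atTop.2 ⟨N + 1, fun n hn => ?_⟩
    obtain ⟨k, rfl⟩ : ∃ k, n = k + 1 := ⟨n - 1, by omega⟩
    exact hN k (by omega)
  obtain ⟨C, hC, hscore⟩ := hQ.exists_score_error_le hL
  obtain ⟨CK, hCK, hKle⟩ := hQ.exists_lintegral_weighted_kernel_le hK hKi
  let c := CK.toReal + 1
  have hc : 0 < c := by positivity
  have hCKc : CK ≤ ENNReal.ofReal c := by
    conv_lhs => rw [← ENNReal.ofReal_toReal hCK]
    exact ENNReal.ofReal_le_ofReal (by simp [c])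
  -- Each of the three terms of `g` has expectation at most `e`, so Markov's inequality at level `ε
  -- * (n + 1) / (2 * C)` gives exactly `η / 2`.
  let δ := ε * η / (12 * C * c)
  have hδ : 0 < δ := by positivity
  let e := ε * η / (12 * C)
  have he : 0 < e := by positivity
  obtain ⟨θ, hθ, h₀, hh₀, r₀, hr₀, hscore⟩ := hscore δ hδ
  have hconc := hQ.tendsto_measure_not_concentrated hL hh hθ
  have hb := (tendsto_add_atTop_iff_nat 1).2 hh.h₁_zero
  filter_upwards [eventually_ge_atTop 1, hb.eventually (gt_mem_nhds hh₀),
    hh.tendsto_one_div_mul_pow.eventually (gt_mem_nhds hr₀),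
    hQ.eventually_lintegral_residual_le hL hh hh.tendsto_one_div_mul_pow hK hKi z he,
    (ENNReal.tendsto_nhds_zero.1 hconc) (ENNReal.ofReal (η / 2)) (by simpa using hη)]
    with n hn hlt hr hres hcn
  set π := Measure.pi fun _ : Fin (n + 1) => Q
  let R : Bool → Fin (n + 1) → (Fin (n + 1) → Obs l q) → ℝ := fun j i v =>
    ((∑ t, armResidual L m j (h₁ (n + 1)) (obsS S (v i)) (v t)) / n) ^ 2
  let g : Fin (n + 1) → (Fin (n + 1) → Obs l q) → ENNReal := fun i v =>
    (ENNReal.ofReal δ * (ENNReal.ofReal (obsW (v i)) * ‖rescale K (h (n + 1)) z (obsZ (v i))‖ₑ) +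
      (‖rescale K (h (n + 1)) z (obsZ (v i))‖ₑ * ENNReal.ofReal (R false i v) +
      ‖rescale K (h (n + 1)) z (obsZ (v i))‖ₑ * ENNReal.ofReal (R true i v)))
  let G : (Fin (n + 1) → Obs l q) → ENNReal := fun v => ∑ i, g i v
  have hKm : Measurable fun o : Obs l q => ‖rescale K (h (n + 1)) z (obsZ o)‖ₑ :=
    ((measurable_rescale hK _).comp (measurable_const.prodMk measurable_obsZ)).enorm
  have hRm : ∀ j i, Measurable (R j i) := fun j i =>
    ((Finset.measurable_sum _ fun t _ =>
      (measurable_armResidual hL.measurable hQ.measurable_m j _).comp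
        (((measurable_obsS S).comp (measurable_pi_apply i)).prodMk
          (measurable_pi_apply t))).div_const _).pow_const 2
  have hKmi : ∀ i, Measurable fun v : Fin (n + 1) → Obs l q =>
      ‖rescale K (h (n + 1)) z (obsZ (v i))‖ₑ := fun i => hKm.comp (measurable_pi_apply i)
  have hWmi : ∀ i, Measurable fun v : Fin (n + 1) → Obs l q => ENNReal.ofReal (obsW (v i)) :=
    fun i => (measurable_obsW.comp (measurable_pi_apply i)).ennreal_ofReal
  have hWK : ∀ i, Measurable fun v : Fin (n + 1) → Obs l q =>
      ENNReal.ofReal (obsW (v i)) * ‖rescale K (h (n + 1)) z (obsZ (v i))‖ₑ :=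
    fun i => (hWmi i).mul (hKmi i)
  have hRK : ∀ j i, Measurable fun v : Fin (n + 1) → Obs l q =>
      ‖rescale K (h (n + 1)) z (obsZ (v i))‖ₑ * ENNReal.ofReal (R j i v) :=
    fun j i => (hKmi i).mul (hRm j i).ennreal_ofReal
  have hgm : ∀ i, Measurable (g i) := fun i =>
    ((hWK i).const_mul _).add ((hRK false i).add (hRK true i))
  have hGm : Measurable G := Finset.measurable_sum _ fun i _ => hgm i
  have hGint : ∫⁻ v, G v ∂π ≤ (n + 1 : ℕ) * ENNReal.ofReal (3 * e) := by
    rw [lintegral_finsetSum _ fun i _ => hgm i]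
    refine (Finset.sum_le_card_nsmul _ _ (ENNReal.ofReal (3 * e)) fun i _ => ?_).trans
      (by rw [Finset.card_univ, Fintype.card_fin, nsmul_eq_mul])
    simp only [g]
    rw [lintegral_add_left ((hWK i).const_mul _), lintegral_add_left (hRK false i),
      lintegral_const_mul _ (hWK i),
      lintegral_pi_eval Q i (f := fun o => ENNReal.ofReal (obsW o) *
        ‖rescale K (h (n + 1)) z (obsZ o)‖ₑ) (measurable_obsW.ennreal_ofReal.mul hKm)]
    have h1 : ENNReal.ofReal δ * ∫⁻ o, ENNReal.ofReal (obsW o) *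
        ‖rescale K (h (n + 1)) z (obsZ o)‖ₑ ∂Q ≤ ENNReal.ofReal e := by
      calc _ ≤ ENNReal.ofReal δ * ENNReal.ofReal c := by
            gcongr; exact (hKle _ (hh.h_pos _) z).trans hCKc
        _ = ENNReal.ofReal e := by
            rw [← ENNReal.ofReal_mul hδ.le]; congr 1; simp only [δ, e]; field_simp
    refine (add_le_add h1 (add_le_add (hres i false) (hres i true))).trans (le_of_eq ?_)
    rw [← ENNReal.ofReal_add he.le he.le, ← ENNReal.ofReal_add he.le (by positivity)]
    congr 1; ring
  -- On the concentration event the weighted error is at most `2 * C` times the sum represented by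
  -- `G`, the two coming from the two scores. Only `G` is integrated.
  have hsub : {v | ε ≤ dist ((∑ i, |rescale K (h (n + 1)) z (obsZ (v i))| *
      ((psiHat L (h₁ (n + 1)) v i - score S p (fun _ _ => 0) (v i)) ^ 2 +
        (psiStarHat L (h₁ (n + 1)) v i - score S p m (v i)) ^ 2)) / ((n + 1 : ℕ) : ℝ)) 0} ⊆
      {v | ¬ Concentrated Q A B p L (h₁ (n + 1)) θ v} ∪
        {v | ENNReal.ofReal (ε * (n + 1 : ℕ) / (2 * C)) ≤ G v} := by
    intro v hv
    by_cases hcv : Concentrated Q A B p L (h₁ (n + 1)) θ v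
    · right
      have hsc := hscore _ (hh.h₁_pos (n + 1)) hlt n hn hr v hcv
      simp only [mem_ofPred_eq] at hv ⊢
      rw [Real.dist_0_eq_abs, abs_of_nonneg (by positivity), le_div_iff₀ (by positivity)] at hv
      have hG : G v = ENNReal.ofReal (∑ i, |rescale K (h (n + 1)) z (obsZ (v i))| *
          (δ * obsW (v i) + (R false i v + R true i v))) := by
        rw [ENNReal.ofReal_sum_of_nonneg fun i _ => mul_nonneg (abs_nonneg _)
          (add_nonneg (mul_nonneg hδ.le (obsW_pos _).le)
            (add_nonneg (sq_nonneg _) (sq_nonneg _)))]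
        refine Finset.sum_congr rfl fun i _ => ?_
        have hW := (obsW_pos (v i)).le
        rw [ENNReal.ofReal_mul (abs_nonneg _), ENNReal.ofReal_add (mul_nonneg hδ.le hW)
          (add_nonneg (sq_nonneg _) (sq_nonneg _)), ENNReal.ofReal_add (sq_nonneg _) (sq_nonneg _),
          ENNReal.ofReal_mul hδ.le, ← Real.norm_eq_abs, ofReal_norm]
        ring
      rw [hG]
      refine ENNReal.ofReal_le_ofReal ?_
      rw [div_le_iff₀ (by positivity), mul_comm _ (2 * C), Finset.mul_sum]
      refine hv.trans (Finset.sum_le_sum fun i _ => ?_)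
      rw [mul_left_comm]
      refine mul_le_mul_of_nonneg_left ?_ (abs_nonneg _)
      have := hsc i
      simp only [R]
      linarith [this.1, this.2]
    · exact Or.inl hcv
  refine (measure_mono hsub).trans ((measure_union_le _ _).trans ?_)
  have hpos : 0 < ε * (n + 1 : ℕ) / (2 * C) := by positivity
  have hmark : π {v | ENNReal.ofReal (ε * (n + 1 : ℕ) / (2 * C)) ≤ G v} ≤
      ENNReal.ofReal (η / 2) := by
    refine (meas_ge_le_lintegral_div hGm.aemeasurable (by simpa using hpos)
      ENNReal.ofReal_ne_top).trans ?_
    refine (ENNReal.div_le_div_right hGint _).trans (le_of_eq ?_)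
    rw [← ENNReal.ofReal_natCast, ← ENNReal.ofReal_mul (by positivity),
      ← ENNReal.ofReal_div_of_pos hpos]
    congr 1
    simp only [e]
    field_simp
    norm_num
  calc _ ≤ ENNReal.ofReal (η / 2) + ENNReal.ofReal (η / 2) := add_le_add hcn hmark
    _ = ENNReal.ofReal η := by
      rw [← ENNReal.ofReal_add (by positivity) (by positivity), add_halves]

end WeightedError

/-! ### Kernel averages at Lebesgue points. -/

section SmallDensity

variable {ι : Type*} [Fintype ι]

/-- Stated for a family of measures because it serves twice: with one measure `|G - G z| dx` for the
bias, and with the tail measures indexed by truncation level. -/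
lemma exists_eventually_lintegral_rescale_le {κ : Type*} {K : (ι → ℝ) → ℝ} (hK : Measurable K)
    (hKi : Integrable K) {C : ENNReal} (hC : C ≠ ⊤) {ν : κ → Measure (ι → ℝ)}
    (hν : ∀ M, ν M ≤ C • volume) {z : ι → ℝ}
    (hz : ∀ ε : ℝ, 0 < ε → ∃ M, ∀ᶠ r in 𝓝[>] (0 : ℝ),
      ν M (Metric.closedBall z r) ≤ ENNReal.ofReal (ε * r ^ Fintype.card ι))
    {h : ℕ → ℝ} (hpos : ∀ n, 0 < h n) (h0 : Tendsto h atTop (𝓝 0)) {η : ℝ} (hη : 0 < η) :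
    ∃ M, ∀ᶠ n in atTop, ∫⁻ x, ‖rescale K (h n) z x‖ₑ ∂(ν M) ≤ ENNReal.ofReal η := by
  obtain ⟨R, hR, hle⟩ := exists_lintegral_rescale_le hK hKi hC
    (η := ENNReal.ofReal (η / 2)) (by simpa using hη)
  -- Multiplied by the kernel height `R / h ^ card` and by `(R * h) ^ card`, this constant becomes
  -- `η / 2`.
  obtain ⟨M, hM⟩ := hz (η / (2 * (R * R ^ Fintype.card ι))) (by positivity)
  refine ⟨M, ?_⟩
  have hRh : Tendsto (fun n => R * h n) atTop (𝓝[>] 0) := by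
    refine tendsto_nhdsWithin_iff.2 ⟨by simpa using h0.const_mul R, ?_⟩
    exact Eventually.of_forall fun n => mul_pos hR (hpos n)
  filter_upwards [hRh.eventually hM] with n hn
  have hp := hpos n
  refine (hle _ (hν M) _ hp z).trans ?_
  calc _ ≤ ENNReal.ofReal (η / 2) + ENNReal.ofReal (R / h n ^ Fintype.card ι) *
        ENNReal.ofReal (η / (2 * (R * R ^ Fintype.card ι)) * (R * h n) ^ Fintype.card ι) := by
        gcongr
    _ = ENNReal.ofReal η := by
        rw [← ENNReal.ofReal_mul (by positivity), ← ENNReal.ofReal_add (by positivity)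
          (by positivity)]
        congr 1
        rw [mul_pow]
        field_simp
        norm_num

/-- Kernel averages of a bounded function converge at its Lebesgue points. -/
lemma tendsto_integral_mul_rescale {K : (ι → ℝ) → ℝ} (hK : Measurable K) (hKi : Integrable K)
    (hK1 : ∫ u, K u = 1) {G : (ι → ℝ) → ℝ} (hG : Measurable G) {B : ℝ}
    (hB : ∀ᵐ x, |G x| ≤ B) {z : ι → ℝ} (hz : IsLebesguePoint G z)
    {h : ℕ → ℝ} (hpos : ∀ n, 0 < h n) (h0 : Tendsto h atTop (𝓝 0)) :
    Tendsto (fun n => ∫ x, G x * rescale K (h n) z x) atTop (𝓝 (G z)) := by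
  have hgm : Measurable fun x => ‖G x - G z‖ₑ := (hG.sub_const _).enorm
  let ν : Unit → Measure (ι → ℝ) := fun _ => volume.withDensity fun x => ‖G x - G z‖ₑ
  have hν : ∀ M, ν M ≤ ENNReal.ofReal (B + |G z|) • volume := by
    intro M
    rw [← withDensity_const]
    refine withDensity_mono ?_
    filter_upwards [hB] with x hx
    rw [← ofReal_norm, Real.norm_eq_abs]
    exact ENNReal.ofReal_le_ofReal ((abs_sub _ _).trans (by linarith))
  have hkm : ∀ n, Measurable (rescale K (h n) z) := fun n =>
    (measurable_rescale hK (h n)).comp (measurable_const.prodMk measurable_id)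
  rw [tendsto_iff_edist_tendsto_0, ENNReal.tendsto_nhds_zero]
  intro η hη
  by_cases htop : η = ⊤
  · simp [htop]
  obtain ⟨_, hev⟩ := exists_eventually_lintegral_rescale_le hK hKi ENNReal.ofReal_ne_top hν
    (z := z) (fun ε hε => ⟨(), by
      filter_upwards [hz ε hε] with r hr
      rwa [withDensity_apply _ Metric.isClosed_closedBall.measurableSet]⟩) hpos h0
    (ENNReal.toReal_pos hη.ne' htop)
  rw [ENNReal.ofReal_toReal htop] at hev
  filter_upwards [hev] with n hn
  refine le_trans ?_ hn
  have hki := integrable_rescale hKi (hpos n) z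
  have hGk : Integrable fun x => G x * rescale K (h n) z x :=
    hki.bdd_mul hG.aestronglyMeasurable (c := B) (by simpa using hB)
  have e1 : (∫ x, G x * rescale K (h n) z x) - G z =
      ∫ x, (G x - G z) * rescale K (h n) z x := by
    simp_rw [sub_mul]
    rw [integral_sub hGk (hki.const_mul _), integral_const_mul, integral_rescale (hpos n), hK1,
      mul_one]
  rw [edist_eq_enorm_sub, e1]
  refine (enorm_integral_le_lintegral_enorm _).trans (le_of_eq ?_)
  rw [lintegral_withDensity_eq_lintegral_mul _ hgm (hkm n).enorm]
  simp [enorm_mul]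

end SmallDensity

/-! ### A weak law for kernel averages under second moments of the outcome. -/

section KernelAverage

variable {l q : ℕ} {Q : Measure (Obs l q)}

/-- The second moment of the outcomes that exceed `M`, as a measure on the values of `Z`. -/
noncomputable def tailMeasure (Q : Measure (Obs l q)) (M : ℝ) : Measure (Fin l → ℝ) :=
  (Q.withDensity fun o =>
    ENNReal.ofReal ({o : Obs l q | M < |o.2.2|}.indicator (fun o => o.2.2 ^ 2) o)).map obsZ

lemma measurable_tail (M : ℝ) : Measurable fun o : Obs l q =>
    ENNReal.ofReal ({o : Obs l q | M < |o.2.2|}.indicator (fun o => o.2.2 ^ 2) o) :=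
  ((measurable_obsY.pow_const 2).indicator
    (measurableSet_lt measurable_const measurable_obsY.abs)).ennreal_ofReal

lemma tailMeasure_le {C : ENNReal}
    (hC : (Q.withDensity fun o => ENNReal.ofReal (obsW o)).map obsZ ≤ C • volume) (M : ℝ) :
    tailMeasure Q M ≤ C • volume := by
  refine le_trans (Measure.map_mono (withDensity_mono (Eventually.of_forall fun o => ?_))
    measurable_obsZ) hC
  refine ENNReal.ofReal_le_ofReal ?_
  refine (indicator_le_self' (fun _ _ => sq_nonneg _) _).trans ?_
  unfold obsW; linarith

lemma tailMeasure_anti {M M' : ℝ} (h : M ≤ M') : tailMeasure Q M' ≤ tailMeasure Q M := by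
  refine Measure.map_mono (withDensity_mono (Eventually.of_forall fun o => ?_)) measurable_obsZ
  refine ENNReal.ofReal_le_ofReal (indicator_le_indicator_of_subset ?_ (fun _ => sq_nonneg _) o)
  exact fun o ho => h.trans_lt ho

/-- The squared outcomes are uniformly integrable near `z`. -/
def TailSmall (Q : Measure (Obs l q)) (z : Fin l → ℝ) : Prop :=
  ∀ ε : ℝ, 0 < ε → ∃ M : ℝ, ∀ᶠ r in 𝓝[>] (0 : ℝ),
    tailMeasure Q M (Metric.closedBall z r) ≤ ENNReal.ofReal (ε * r ^ Fintype.card (Fin l))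

lemma map_obsZ_le {C : ENNReal}
    (hC : (Q.withDensity fun o => ENNReal.ofReal (obsW o)).map obsZ ≤ C • volume) :
    Q.map obsZ ≤ C • volume := by
  refine le_trans (Measure.map_mono ?_ measurable_obsZ) hC
  conv_lhs => rw [← withDensity_one (μ := Q)]
  exact withDensity_mono (Eventually.of_forall fun o => by
    simpa using ENNReal.one_le_ofReal.2 (one_le_obsW o))

lemma enorm_le_ofReal_add_sq (x : ℝ) {ε : ℝ} (hε : 0 < ε) :
    ‖x‖ₑ ≤ ENNReal.ofReal ε + ENNReal.ofReal (1 / ε) * ENNReal.ofReal (x ^ 2) := by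
  rw [← ENNReal.ofReal_mul (by positivity), ← ENNReal.ofReal_add hε.le (by positivity),
    ← ofReal_norm, Real.norm_eq_abs]
  refine ENNReal.ofReal_le_ofReal ?_
  rw [one_div, inv_mul_eq_div, ← sub_le_iff_le_add', le_div_iff₀ hε]
  nlinarith [sq_nonneg (|x| - ε), sq_abs x, abs_nonneg x]

/-- The part `f` is controlled by its variance through `|x| ≤ ε + x² / ε`. The part `g` is merely
integrable and counts twice, once in the sample mean and once in the expectation. -/
lemma lintegral_abs_mean_sub_le [IsProbabilityMeasure Q] {n : ℕ} (hn : 0 < n) {f g : Obs l q → ℝ}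
    (hfm : Measurable f) (hgm : Measurable g) (hf : MemLp f 2 Q) (hg : Integrable g Q) {c ε : ℝ}
    (hε : 0 < ε) :
    ∫⁻ v, ‖(∑ i, (f (v i) + g (v i))) / n - c‖ₑ ∂(Measure.pi fun _ : Fin n => Q) ≤
      ENNReal.ofReal ε + ENNReal.ofReal (1 / ε) * ENNReal.ofReal ((∫ o, f o ^ 2 ∂Q) / n) +
        2 * ∫⁻ o, ‖g o‖ₑ ∂Q + ‖(∫ o, (f o + g o) ∂Q) - c‖ₑ := by
  have hn' : (0 : ℝ) < n := by exact_mod_cast hn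
  set π := Measure.pi fun _ : Fin n => Q
  set A : (Fin n → Obs l q) → ℝ := fun v => 1 / n * ∑ j, (f (v j) - ∫ o, f o ∂Q)
  have hAm : Measurable A := (Finset.measurable_sum _ fun j _ =>
    (hfm.comp (measurable_pi_apply j)).sub_const _).const_mul _
  have hgi : ∀ i, Measurable fun v : Fin n → Obs l q => ‖g (v i)‖ₑ := fun i =>
    (hgm.comp (measurable_pi_apply i)).enorm
  have hsplit : ∀ v, (∑ i, (f (v i) + g (v i))) / n - c =
      A v + (1 / n * ∑ i, g (v i)) + -(∫ o, g o ∂Q) + ((∫ o, (f o + g o) ∂Q) - c) := by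
    intro v
    rw [integral_add (hf.integrable (by norm_num)) hg]
    simp only [A, Finset.sum_sub_distrib, Finset.sum_add_distrib, Finset.sum_const,
      Finset.card_univ, Fintype.card_fin, nsmul_eq_mul]
    field_simp
    ring
  have hpt : ∀ v, ‖(∑ i, (f (v i) + g (v i))) / n - c‖ₑ ≤
      (ENNReal.ofReal ε + ENNReal.ofReal (1 / ε) * ENNReal.ofReal (A v ^ 2)) +
        ENNReal.ofReal (1 / n) * (∑ i, ‖g (v i)‖ₑ) + ∫⁻ o, ‖g o‖ₑ ∂Q +
          ‖(∫ o, (f o + g o) ∂Q) - c‖ₑ := by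
    intro v
    rw [hsplit]
    refine (enorm_add_le _ _).trans (add_le_add_left ((enorm_add_le _ _).trans
      (add_le_add ((enorm_add_le _ _).trans (add_le_add (enorm_le_ofReal_add_sq _ hε) ?_)) ?_)) _)
    · rw [enorm_mul, Real.enorm_of_nonneg (by positivity)]
      gcongr
      exact enorm_sum_le _ _
    · rw [enorm_neg]; exact enorm_integral_le_lintegral_enorm _
  refine (lintegral_mono hpt).trans ?_
  have hsum : ∫⁻ v, ENNReal.ofReal (1 / n) * (∑ i, ‖g (v i)‖ₑ) ∂π = ∫⁻ o, ‖g o‖ₑ ∂Q := by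
    rw [lintegral_const_mul _ (Finset.measurable_sum _ fun i _ => hgi i),
      lintegral_finsetSum _ fun i _ => hgi i]
    have : ∀ i : Fin n, ∫⁻ v, ‖g (v i)‖ₑ ∂π = ∫⁻ o, ‖g o‖ₑ ∂Q := fun i =>
      lintegral_pi_eval Q i (f := fun o => ‖g o‖ₑ) hgm.enorm
    simp only [this, Finset.sum_const, Finset.card_univ, Fintype.card_fin, nsmul_eq_mul]
    rw [← mul_assoc, ← ENNReal.ofReal_natCast, ← ENNReal.ofReal_mul (by positivity),
      one_div_mul_cancel hn'.ne', ENNReal.ofReal_one, one_mul]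
  have hA2 : ∫⁻ v, ENNReal.ofReal (A v ^ 2) ∂π ≤ ENNReal.ofReal ((∫ o, f o ^ 2 ∂Q) / n) := by
    refine (lintegral_sum_sq_le Q hf (1 / n)).trans (ENNReal.ofReal_le_ofReal (le_of_eq ?_))
    field_simp
  have hm1 : Measurable fun v => ENNReal.ofReal ε +
      ENNReal.ofReal (1 / ε) * ENNReal.ofReal (A v ^ 2) :=
    measurable_const.add ((hAm.pow_const 2).ennreal_ofReal.const_mul _)
  rw [lintegral_add_right _ measurable_const, lintegral_add_right _ measurable_const,
    lintegral_add_left hm1, hsum, lintegral_add_left measurable_const,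
    lintegral_const_mul _ (hAm.pow_const 2).ennreal_ofReal]
  simp only [lintegral_const, measure_univ, mul_one]
  rw [two_mul, ← add_assoc]
  gcongr

/-- Kernel averages of a function of at most quadratic growth in the outcome converge in
probability to the density weighted conditional mean. -/
lemma convProb_kernel_average [IsProbabilityMeasure Q] {C : ENNReal} (hC : C ≠ ⊤)
    (hν : (Q.withDensity fun o => ENNReal.ofReal (obsW o)).map obsZ ≤ C • volume)
    {K : (Fin l → ℝ) → ℝ} (hK : Measurable K) (hKi : Integrable K)
    (hK2 : Integrable fun u => K u ^ 2) (hK1 : ∫ u, K u = 1)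
    {h : ℕ → ℝ} (hpos : ∀ n, 0 < h n) (h0 : Tendsto h atTop (𝓝 0))
    (hnh : Tendsto (fun n : ℕ => n * h n ^ l) atTop atTop)
    {T : Obs l q → ℝ} (hT : Measurable T) {B : ℝ} (hB0 : 0 ≤ B)
    (hTB : ∀ᵐ o ∂Q, |T o| ≤ B * obsW o)
    {G : (Fin l → ℝ) → ℝ} (hG : Measurable G) {B' : ℝ} (hGB : ∀ᵐ x, |G x| ≤ B')
    (hTG : ∀ k : (Fin l → ℝ) → ℝ, Measurable k → Integrable k →
      ∫ o, T o * k (obsZ o) ∂Q = ∫ x, G x * k x)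
    {z : Fin l → ℝ} (hz : IsLebesguePoint G z) (htail : TailSmall Q z) :
    ConvProb Q (fun n v => (∑ i, rescale K (h n) z (obsZ (v i)) * T (v i)) / n) (G z) := by
  have hkm : ∀ n, Measurable (rescale K (h n) z) := fun n =>
    (measurable_rescale hK (h n)).comp (measurable_const.prodMk measurable_id)
  have hkZ : ∀ n, Measurable fun o : Obs l q => rescale K (h n) z (obsZ o) := fun n =>
    (hkm n).comp measurable_obsZ
  refine convProb_of_tendsto_lintegral (fun n => (Finset.measurable_sum _ fun i _ =>
    ((hkZ n).mul hT).comp (measurable_pi_apply i)).div_const _) ?_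
  rw [ENNReal.tendsto_nhds_zero]
  intro η hη
  by_cases htop : η = ⊤
  · simp [htop]
  have hη' : 0 < η.toReal := ENNReal.toReal_pos hη.ne' htop
  obtain ⟨t, ht⟩ : ∃ t, t = η.toReal := ⟨_, rfl⟩
  rw [← ht] at hη'
  have hηt : η = ENNReal.ofReal t := by rw [ht, ENNReal.ofReal_toReal htop]
  have hB1 : 0 < B + 1 := by linarith
  obtain ⟨M, hM⟩ := exists_eventually_lintegral_rescale_le hK hKi hC
    (ν := tailMeasure Q) (tailMeasure_le hν) htail hpos h0
    (η := t / (16 * (B + 1))) (by positivity)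
  -- `T` may grow like `Y²` and have no second moment, so it is split according to whether `|Y|`
  -- exceeds `M'`. The lower bound one gives `obsW ≤ 2 * Y²` on the tail, where `tailMeasure` takes
  -- over.
  let M' := max M 1
  let s : Set (Obs l q) := {o | M' < |o.2.2|}
  have hs : MeasurableSet s := measurableSet_lt measurable_const measurable_obsY.abs
  let f : ℕ → Obs l q → ℝ := fun n o => rescale K (h n) z (obsZ o) * sᶜ.indicator T o
  let g : ℕ → Obs l q → ℝ := fun n o => rescale K (h n) z (obsZ o) * s.indicator T o
  have hfg : ∀ n o, rescale K (h n) z (obsZ o) * T o = f n o + g n o := by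
    intro n o
    simp only [f, g]
    rw [← mul_add, add_comm, ← Pi.add_apply, indicator_self_add_compl]
  have hfm : ∀ n, Measurable (f n) := fun n => (hkZ n).mul (hT.indicator hs.compl)
  have hgm : ∀ n, Measurable (g n) := fun n => (hkZ n).mul (hT.indicator hs)
  have hM1 : 1 ≤ M' := le_max_right _ _
  let V := (B * (1 + M' ^ 2)) ^ 2
  let V' := V * (C.toReal * ∫ u, K u ^ 2)
  have hV' : 0 ≤ V' := mul_nonneg (sq_nonneg _)
    (mul_nonneg ENNReal.toReal_nonneg (integral_nonneg fun _ => sq_nonneg _))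
  have hf2 : ∀ n, ∫⁻ o, ENNReal.ofReal (f n o ^ 2) ∂Q ≤ ENNReal.ofReal (V' * (h n ^ l)⁻¹) := by
    intro n
    have hp := hpos n
    have hm : Measurable fun x => ENNReal.ofReal (rescale K (h n) z x ^ 2) :=
      ((hkm n).pow_const 2).ennreal_ofReal
    calc ∫⁻ o, ENNReal.ofReal (f n o ^ 2) ∂Q
        ≤ ∫⁻ o, ENNReal.ofReal V * ENNReal.ofReal (rescale K (h n) z (obsZ o) ^ 2) ∂Q := by
          refine lintegral_mono_ae ?_
          filter_upwards [hTB] with o ho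
          rw [← ENNReal.ofReal_mul (sq_nonneg _)]
          refine ENNReal.ofReal_le_ofReal ?_
          simp only [f]
          rw [mul_pow, mul_comm]
          refine mul_le_mul_of_nonneg_right ?_ (sq_nonneg _)
          rw [← sq_abs]
          refine pow_le_pow_left₀ (abs_nonneg _) ?_ 2
          by_cases hos : o ∈ s
          · rw [indicator_of_notMem (by simpa using hos), abs_zero]; positivity
          · rw [indicator_of_mem (by simpa using hos)]
            refine ho.trans ?_
            have h1 : |o.2.2| ≤ M' := not_lt.1 hos
            have h2 : o.2.2 ^ 2 ≤ M' ^ 2 := by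
              rw [← sq_abs]; exact pow_le_pow_left₀ (abs_nonneg _) h1 2
            unfold obsW
            gcongr
      _ = ENNReal.ofReal V * ∫⁻ x, ENNReal.ofReal (rescale K (h n) z x ^ 2) ∂(Q.map obsZ) := by
          rw [lintegral_const_mul' _ _ ENNReal.ofReal_ne_top, lintegral_map hm measurable_obsZ]
      _ ≤ ENNReal.ofReal V * (C * (ENNReal.ofReal (h n ^ Fintype.card (Fin l))⁻¹ *
            ∫⁻ u, ENNReal.ofReal (K u ^ 2))) := by
          gcongr
          exact lintegral_rescale_sq_le hK hp z (map_obsZ_le hν)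
      _ = ENNReal.ofReal (V' * (h n ^ l)⁻¹) := by
          rw [← ofReal_integral_eq_lintegral_ofReal hK2 (Eventually.of_forall fun _ => sq_nonneg _)]
          conv_lhs => rw [← ENNReal.ofReal_toReal hC]
          rw [← ENNReal.ofReal_mul (by positivity), ← ENNReal.ofReal_mul ENNReal.toReal_nonneg,
            ← ENNReal.ofReal_mul (sq_nonneg _), Fintype.card_fin]
          congr 1
          simp only [V']
          ring
  have hf2i : ∀ n, Integrable (fun o => f n o ^ 2) Q := fun n =>
    ⟨((hfm n).pow_const 2).aestronglyMeasurable,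
      (hasFiniteIntegral_iff_ofReal (Eventually.of_forall fun _ => sq_nonneg _)).2
        ((hf2 n).trans_lt ENNReal.ofReal_lt_top)⟩
  have hfL : ∀ n, MemLp (f n) 2 Q := fun n =>
    (memLp_two_iff_integrable_sq (hfm n).aestronglyMeasurable).2 (hf2i n)
  have hf2' : ∀ n, ∫ o, f n o ^ 2 ∂Q ≤ V' * (h n ^ l)⁻¹ := by
    intro n
    have hp := hpos n
    rw [← ENNReal.ofReal_le_ofReal_iff (by positivity), ofReal_integral_eq_lintegral_ofReal
      (hf2i n) (Eventually.of_forall fun _ => sq_nonneg _)]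
    exact hf2 n
  have hgle : ∀ n, ∫⁻ o, ‖g n o‖ₑ ∂Q ≤ ENNReal.ofReal (2 * B) *
      ∫⁻ x, ‖rescale K (h n) z x‖ₑ ∂(tailMeasure Q M) := by
    intro n
    have h1 : (Q.withDensity fun o => ENNReal.ofReal
        ({o : Obs l q | M' < |o.2.2|}.indicator (fun o => o.2.2 ^ 2) o)).map obsZ ≤
        (1 : ENNReal) • tailMeasure Q M := by
      rw [one_smul]; exact tailMeasure_anti (le_max_left _ _)
    have h2 := lintegral_mul_comp_le measurable_obsZ (measurable_tail M') h1 (hkm n).enorm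
    rw [one_mul] at h2
    refine le_trans ?_ (mul_le_mul_right h2 _)
    rw [← lintegral_const_mul' _ _ ENNReal.ofReal_ne_top]
    refine lintegral_mono_ae ?_
    filter_upwards [hTB] with o ho
    simp only [g]
    rw [enorm_mul, mul_comm, ← mul_assoc, ← ENNReal.ofReal_mul (by positivity)]
    refine mul_le_mul_left ?_ _
    rw [← ofReal_norm, Real.norm_eq_abs]
    refine ENNReal.ofReal_le_ofReal ?_
    by_cases hos : o ∈ s
    · rw [indicator_of_mem hos, indicator_of_mem hos]
      refine ho.trans ?_
      have h3 : 1 ≤ o.2.2 ^ 2 := by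
        rw [← sq_abs]; exact one_le_pow₀ (hM1.trans hos.le)
      unfold obsW
      nlinarith
    · rw [indicator_of_notMem hos, indicator_of_notMem hos]
      simp
  have hgi : ∀ n, Integrable (g n) Q := by
    intro n
    refine ⟨(hgm n).aestronglyMeasurable, (hgle n).trans_lt (ENNReal.mul_lt_top
      ENNReal.ofReal_lt_top ?_)⟩
    exact (lintegral_rescale_le hK (hpos n) z (tailMeasure_le hν M)).trans_lt
      (ENNReal.mul_lt_top hC.lt_top hKi.2)
  have hbias := tendsto_integral_mul_rescale hK hKi hK1 hG hGB hz hpos h0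
  rw [tendsto_iff_edist_tendsto_0, ENNReal.tendsto_nhds_zero] at hbias
  have hvar : Tendsto (fun n : ℕ => V' / (n * h n ^ l)) atTop (𝓝 0) :=
    tendsto_const_nhds.div_atTop hnh
  -- The four summands of the mean error bound (the free `ε`, the variance, the tail and the bias)
  -- receive `t / 4` each.
  filter_upwards [hM, hbias (ENNReal.ofReal (t / 4)) (by simpa using hη'),
    hvar.eventually (gt_mem_nhds (by positivity : 0 < t / 4 * (t / 4))), eventually_gt_atTop 0]
    with n hn1 hn2 hn3 hn
  have hn' : (0 : ℝ) < n := by exact_mod_cast hn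
  have hp := hpos n
  have key := lintegral_abs_mean_sub_le (Q := Q) hn (hfm n) (hgm n) (hfL n) (hgi n) (c := G z)
    (ε := t / 4) (by positivity)
  simp_rw [← hfg] at key
  refine key.trans ?_
  have b1 : ENNReal.ofReal (1 / (t / 4)) * ENNReal.ofReal ((∫ o, f n o ^ 2 ∂Q) / n) ≤
      ENNReal.ofReal (t / 4) := by
    rw [← ENNReal.ofReal_mul (by positivity)]
    refine ENNReal.ofReal_le_ofReal ?_
    rw [one_div, inv_mul_le_iff₀ (by positivity)]
    refine le_trans ?_ hn3.le
    calc (∫ o, f n o ^ 2 ∂Q) / n ≤ V' * (h n ^ l)⁻¹ / n := by gcongr; exact hf2' n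
      _ = _ := by field_simp
  have b2 : 2 * ∫⁻ o, ‖g n o‖ₑ ∂Q ≤ ENNReal.ofReal (t / 4) := by
    calc 2 * ∫⁻ o, ‖g n o‖ₑ ∂Q ≤ 2 * (ENNReal.ofReal (2 * B) *
          ENNReal.ofReal (t / (16 * (B + 1)))) := by
          gcongr; exact (hgle n).trans (by gcongr)
      _ ≤ ENNReal.ofReal (t / 4) := by
          rw [show (2 : ENNReal) = ENNReal.ofReal 2 by simp, ← ENNReal.ofReal_mul (by positivity),
            ← ENNReal.ofReal_mul (by norm_num)]
          refine ENNReal.ofReal_le_ofReal ?_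
          rw [mul_div_assoc', mul_div_assoc', div_le_div_iff₀ (by positivity) (by norm_num)]
          nlinarith
  have b3 : ‖(∫ o, rescale K (h n) z (obsZ o) * T o ∂Q) - G z‖ₑ ≤ ENNReal.ofReal (t / 4) := by
    have e1 : ∫ o, rescale K (h n) z (obsZ o) * T o ∂Q = ∫ x, G x * rescale K (h n) z x := by
      rw [← hTG _ (hkm n) (integrable_rescale hKi hp z)]
      simp_rw [mul_comm]
    rw [e1, ← edist_eq_enorm_sub]
    exact hn2
  refine (add_le_add (add_le_add (add_le_add le_rfl b1) b2) b3).trans (le_of_eq ?_)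
  rw [← ENNReal.ofReal_add (by positivity) (by positivity),
    ← ENNReal.ofReal_add (by positivity) (by positivity),
    ← ENNReal.ofReal_add (by positivity) (by positivity), hηt]
  congr 1
  ring

end KernelAverage

/-! ### Stability of limits in probability. -/

section Perturbation

variable {α : Type*} [MeasurableSpace α] {Q : Measure α}

/-- Statistics that differ by a small multiple of a tight statistic and a multiple of a vanishing
one have the same limit in probability. -/
lemma ConvProb.of_perturbation {F G U E : ∀ n : ℕ, (Fin n → α) → ℝ} {c : ℝ} (hF : ConvProb Q F c)
    (hE : ConvProb Q E 0)
    (hU : ∀ η : ℝ, 0 < η → ∃ R : ℝ, 0 < R ∧ ∀ n,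
      Measure.pi (fun _ : Fin n => Q) {v | R ≤ U n v} ≤ ENNReal.ofReal η)
    (hb : ∀ η : ℝ, 0 < η → ∃ D : ℝ, 0 < D ∧ ∀ n, ∀ᵐ v ∂(Measure.pi fun _ : Fin n => Q),
      |G n v - F n v| ≤ η * U n v + D * E n v) : ConvProb Q G c := by
  refine convProb_of_eventually_le fun ε hε η hη => ?_
  obtain ⟨R, hR, hUR⟩ := hU (η / 3) (by positivity)
  -- Where `U < R` the tight term stays below `ε / 4`. With `ε / 4` for the vanishing term and `ε /
  -- 2` for `F`, the total is below `ε`.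
  obtain ⟨D, hD, hGF⟩ := hb (ε / (4 * R)) (by positivity)
  have h1 := ENNReal.tendsto_nhds_zero.1 (hF (ε / 2) (by positivity)) (ENNReal.ofReal (η / 3))
    (by simpa using hη)
  have h2 := ENNReal.tendsto_nhds_zero.1 (hE (ε / (4 * D)) (by positivity)) (ENNReal.ofReal (η / 3))
    (by simpa using hη)
  filter_upwards [h1, h2] with n hn1 hn2
  have hsub : ({v | ε ≤ dist (G n v) c} : Set (Fin n → α)) ≤ᵐ[Measure.pi fun _ : Fin n => Q]
      ({v | ε / 2 ≤ dist (F n v) c} ∪ {v | ε / (4 * D) ≤ dist (E n v) 0} ∪ {v | R ≤ U n v} :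
        Set (Fin n → α)) := by
    filter_upwards [hGF n] with v hv hmem
    by_contra hcon
    have hcon' : ¬ ((ε / 2 ≤ dist (F n v) c ∨ ε / (4 * D) ≤ dist (E n v) 0) ∨ R ≤ U n v) := hcon
    have hmem' : ε ≤ dist (G n v) c := hmem
    push Not at hcon'
    obtain ⟨⟨a1, a2⟩, a3⟩ := hcon'
    rw [Real.dist_0_eq_abs, lt_div_iff₀ (by positivity)] at a2
    have b1 : D * E n v < ε / 4 := by nlinarith [le_abs_self (E n v)]
    have b2 : ε / (4 * R) * U n v < ε / 4 := by
      calc _ < ε / (4 * R) * R := by gcongr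
        _ = _ := by field_simp
    have b3 := dist_triangle (G n v) (F n v) c
    rw [Real.dist_eq (G n v) (F n v)] at b3
    linarith
  refine (measure_mono_ae hsub).trans ((measure_union_le _ _).trans
    ((add_le_add ((measure_union_le _ _).trans (add_le_add hn1 hn2)) (hUR n)).trans (le_of_eq ?_)))
  rw [← ENNReal.ofReal_add (by positivity) (by positivity),
    ← ENNReal.ofReal_add (by positivity) (by positivity)]
  congr 1
  ring

end Perturbation

/-! ### Kernel averages of estimated quantities. -/

section PlugInAverages

variable {l q : ℕ} {Q : Measure (Obs l q)} [IsProbabilityMeasure Q] {S : Finset (Fin (l + q))}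
  {A B : S → ℝ} {p : (S → ℝ) → ℝ} {m : Bool → (S → ℝ) → ℝ} {fS : (S → ℝ) → ℝ}

/-- Tightness by Markov's inequality: the expectation of `|K_h| (1 + Y²)` is bounded uniformly in
the bandwidth. -/
lemma ObservedLaw.exists_measure_weighted_moment_le (hQ : ObservedLaw Q S A B p m fS)
    {K : (Fin l → ℝ) → ℝ} (hK : Measurable K) (hKi : Integrable K) {h : ℕ → ℝ}
    (hpos : ∀ n, 0 < h n) (z : Fin l → ℝ) {η : ℝ} (hη : 0 < η) : ∃ R : ℝ, 0 < R ∧ ∀ n : ℕ,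
      Measure.pi (fun _ : Fin n => Q)
        {v | R ≤ (∑ i, |rescale K (h n) z (obsZ (v i))| * obsW (v i)) / n} ≤ ENNReal.ofReal η := by
  obtain ⟨C, hC, hle⟩ := hQ.exists_lintegral_weighted_kernel_le hK hKi
  refine ⟨(C.toReal + 1) / η, by positivity, fun n => ?_⟩
  have hm : Measurable fun o : Obs l q => ENNReal.ofReal (obsW o) *
      ‖rescale K (h n) z (obsZ o)‖ₑ := measurable_obsW.ennreal_ofReal.mul
    ((measurable_rescale hK _).comp (measurable_const.prodMk measurable_obsZ)).enorm
  let G : (Fin n → Obs l q) → ENNReal := fun v =>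
    ∑ i, ENNReal.ofReal (obsW (v i)) * ‖rescale K (h n) z (obsZ (v i))‖ₑ
  have hgm : ∀ i, Measurable fun v : Fin n → Obs l q =>
      ENNReal.ofReal (obsW (v i)) * ‖rescale K (h n) z (obsZ (v i))‖ₑ := fun i =>
    hm.comp (measurable_pi_apply i)
  have hGint : ∫⁻ v, G v ∂(Measure.pi fun _ : Fin n => Q) ≤ n * C := by
    rw [lintegral_finsetSum _ fun i _ => hgm i]
    refine (Finset.sum_le_card_nsmul _ _ C fun i _ => ?_).trans
      (by rw [Finset.card_univ, Fintype.card_fin, nsmul_eq_mul])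
    rw [lintegral_pi_eval Q i hm]
    exact hle _ (hpos n) z
  -- For an empty sample the average is `0 / 0 = 0`, which lies below the positive threshold.
  rcases Nat.eq_zero_or_pos n with rfl | hn
  · have : {v : Fin 0 → Obs l q | (C.toReal + 1) / η ≤
        (∑ i, |rescale K (h 0) z (obsZ (v i))| * obsW (v i)) / ((0 : ℕ) : ℝ)} = ∅ := by
      ext v
      simp only [mem_ofPred_eq, mem_empty_iff_false, iff_false, not_le, Nat.cast_zero, div_zero]
      positivity
    rw [this, measure_empty]
    exact zero_le
  have hn' : (0 : ℝ) < n := by exact_mod_cast hn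
  have hR : 0 < (C.toReal + 1) / η * n := by positivity
  refine (measure_mono (t := {v | ENNReal.ofReal ((C.toReal + 1) / η * n) ≤ G v})
    fun v hv => ?_).trans ((meas_ge_le_lintegral_div (Finset.measurable_sum _ fun i _ =>
      hgm i).aemeasurable (by simpa using hR) ENNReal.ofReal_ne_top).trans
        ((ENNReal.div_le_div_right hGint _).trans ?_))
  · have hv' : (C.toReal + 1) / η ≤ (∑ i, |rescale K (h n) z (obsZ (v i))| * obsW (v i)) / n := hv
    rw [le_div_iff₀ hn'] at hv'
    refine (ENNReal.ofReal_le_ofReal hv').trans (le_of_eq ?_)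
    rw [ENNReal.ofReal_sum_of_nonneg fun i _ => mul_nonneg (abs_nonneg _) (obsW_pos _).le]
    refine Finset.sum_congr rfl fun i _ => ?_
    rw [ENNReal.ofReal_mul (abs_nonneg _), ← Real.norm_eq_abs, ofReal_norm, mul_comm]
  · have hCt : C = ENNReal.ofReal C.toReal := (ENNReal.ofReal_toReal hC).symm
    generalize C.toReal = C' at hCt hR ⊢
    subst hCt
    rw [← ENNReal.ofReal_natCast, ← ENNReal.ofReal_mul (by positivity),
        ← ENNReal.ofReal_div_of_pos hR]
    refine ENNReal.ofReal_le_ofReal ?_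
    rw [div_le_iff₀ hR]
    have : η * ((C' + 1) / η * n) = (C' + 1) * n := by field_simp
    rw [this]
    nlinarith

/-- Kernel averages of estimated quantities, when the estimation errors vanish in weighted mean. -/
lemma ObservedLaw.convProb_plugIn (hQ : ObservedLaw Q S A B p m fS)
    {K : (Fin l → ℝ) → ℝ} (hK : Measurable K) (hKi : Integrable K) {h : ℕ → ℝ}
    (hpos : ∀ n, 0 < h n) {z : Fin l → ℝ} {T : Obs l q → ℝ} {c : ℝ}
    (hT : ConvProb Q (fun n v => (∑ i, rescale K (h n) z (obsZ (v i)) * T (v i)) / n) c)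
    {E est : ∀ n : ℕ, (Fin n → Obs l q) → Fin n → ℝ}
    (hE : ConvProb Q (fun n v => (∑ i, |rescale K (h n) z (obsZ (v i))| * E n v i) / n) 0)
    (hb : ∀ η : ℝ, 0 < η → ∃ D : ℝ, 0 < D ∧ ∀ n v, (∀ i, obsS S (v i) ∈ Icc A B) →
      ∀ i, |est n v i - T (v i)| ≤ η * obsW (v i) + D * E n v i) :
    ConvProb Q (fun n v => (∑ i, rescale K (h n) z (obsZ (v i)) * est n v i) / n) c := by
  refine hT.of_perturbation hE
    (fun η hη => hQ.exists_measure_weighted_moment_le hK hKi hpos z hη) fun η hη => ?_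
  obtain ⟨D, hD, hle⟩ := hb η hη
  refine ⟨D, hD, fun n => ?_⟩
  filter_upwards [ae_pi_eval Q hQ.ae_mem] with v hv
  rw [← sub_div, ← Finset.sum_sub_distrib, abs_div, Nat.abs_cast, mul_div_assoc', mul_div_assoc',
    ← add_div, Finset.mul_sum, Finset.mul_sum, ← Finset.sum_add_distrib]
  refine div_le_div_of_nonneg_right ?_ (Nat.cast_nonneg _)
  refine (Finset.abs_sum_le_sum_abs _ _).trans (Finset.sum_le_sum fun i _ => ?_)
  rw [← mul_sub, abs_mul]
  calc _ ≤ |rescale K (h n) z (obsZ (v i))| * (η * obsW (v i) + D * E n v i) := by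
        gcongr; exact hle n v hv i
    _ = _ := by ring

/-- Trades a linear error for a squared one at the price of an arbitrarily small multiple of the
weight. -/
lemma abs_sub_le_of_sq_le {x y e W η : ℝ} (hη : 0 < η) (hW : 1 ≤ W) (he : (x - y) ^ 2 ≤ e) :
    |x - y| ≤ η * W + 1 / η * e := by
  have h1 : |x - y| ≤ η + 1 / η * (x - y) ^ 2 := by
    rw [one_div, inv_mul_eq_div, ← sub_le_iff_le_add', le_div_iff₀ hη]
    nlinarith [sq_nonneg (|x - y| - η), sq_abs (x - y), abs_nonneg (x - y)]
  have h2 : 1 / η * (x - y) ^ 2 ≤ 1 / η * e := by gcongr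
  nlinarith

/-- The cross term in `x² - y² = (x - y)² + 2 (x - y) y` is split by the weighted
arithmetic-geometric inequality; the ratio `η / C` leaves exactly `η * W`. -/
lemma abs_sq_sub_sq_le {x y e W η C : ℝ} (hη : 0 < η) (hC : 0 < C) (hy : y ^ 2 ≤ C * W)
    (he : (x - y) ^ 2 ≤ e) : |x ^ 2 - y ^ 2| ≤ η * W + (1 + C / η) * e := by
  have h0 : x ^ 2 - y ^ 2 = (x - y) ^ 2 + 2 * ((x - y) * y) := by ring
  have h1 : |2 * ((x - y) * y)| ≤ C / η * (x - y) ^ 2 + η / C * y ^ 2 := by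
    have e1 : C / η * (x - y) ^ 2 + η / C * y ^ 2 - 2 * ((x - y) * y) =
        C / η * ((x - y) - η / C * y) ^ 2 := by field_simp; ring
    have e2 : C / η * (x - y) ^ 2 + η / C * y ^ 2 + 2 * ((x - y) * y) =
        C / η * ((x - y) + η / C * y) ^ 2 := by field_simp; ring
    have p1 : 0 ≤ C / η * ((x - y) - η / C * y) ^ 2 := by positivity
    have p2 : 0 ≤ C / η * ((x - y) + η / C * y) ^ 2 := by positivity
    rw [abs_le]; constructor <;> linarith
  have h2 : η / C * y ^ 2 ≤ η * W := by
    calc _ ≤ η / C * (C * W) := by gcongr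
      _ = _ := by field_simp
  have h3 : (1 + C / η) * (x - y) ^ 2 ≤ (1 + C / η) * e := by gcongr
  rw [h0]
  refine (abs_add_le _ _).trans ?_
  rw [abs_of_nonneg (sq_nonneg (x - y))]
  linarith

end PlugInAverages

/-! ### Limits of the variance estimators. -/

section VarianceLimit

variable {l q : ℕ} {P : Measure (Subject l q)} [IsProbabilityMeasure P]
  {a b : Cov l q} {s s₁ : ℕ} {fX : Cov l q → ℝ} {fZ : (Fin l → ℝ) → ℝ}
  {S : Finset (Fin (l + q))} {p : (S → ℝ) → ℝ} {m : Bool → (S → ℝ) → ℝ}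
  {K : (Fin l → ℝ) → ℝ} {L : (S → ℝ) → ℝ} {h h₁ : ℕ → ℝ}

lemma SmoothingKernel.measurable (hK : SmoothingKernel s K) : Measurable K :=
  hK.smooth.continuous.measurable

/-- A bound holding almost surely at `Z` holds Lebesgue almost everywhere on the box, where the
density is positive; off the box the product vanishes. -/
lemma Population.exists_ae_abs_density_mul_le (hP : Population P a b s fX fZ S p m)
    {r : (Fin l → ℝ) → ℝ} (hr : ∃ B : ℝ, ∀ᵐ w ∂P, |r (covZ w)| ≤ B) (hrm : Measurable r) :
    ∃ B : ℝ, ∀ᵐ x, |(Icc (zPart a) (zPart b)).indicator fZ x * r x| ≤ B := by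
  obtain ⟨B, hB⟩ := hr
  obtain ⟨C, hC, hf⟩ := hP.density_Z.exists_bound
  have hB' : ∀ᵐ x ∂(P.map covZ), |r x| ≤ B := by
    rwa [ae_map_iff measurable_covZ.aemeasurable (measurableSet_le hrm.abs measurable_const)]
  refine ⟨C * max B 0, ?_⟩
  filter_upwards [hP.density_Z.ae_of_ae_map hB'] with x hx
  by_cases hmem : x ∈ Icc (zPart a) (zPart b)
  · rw [abs_mul, abs_of_nonneg (hP.density_Z.indicator_nonneg x)]
    exact mul_le_mul (hf x) ((hx hmem).trans (le_max_left _ _)) (abs_nonneg _) hC.le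
  · rw [indicator_of_notMem hmem, zero_mul, abs_zero]
    positivity

/-- Kernel averages of a function of the observation converge to its conditional mean times the
density. -/
lemma Population.convProb_average (hP : Population P a b s fX fZ S p m)
    (hK : SmoothingKernel s K) (hh : Bandwidths l S.card s s₁ h h₁)
    {T : Obs l q → ℝ} (hT : Measurable T) {B : ℝ} (hB0 : 0 ≤ B)
    (hTB : ∀ o : Obs l q, subPart S o.1 ∈ Icc (subPart S a) (subPart S b) → |T o| ≤ B * obsW o)
    {r : (Fin l → ℝ) → ℝ} (hrm : Measurable r) (hr : ∃ B : ℝ, ∀ᵐ w ∂P, |r (covZ w)| ≤ B)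
    (hTr : ∀ k : (Fin l → ℝ) → ℝ, Measurable k → Integrable (fun w => k (covZ w)) P →
      ∫ w, T (observe w) * k (covZ w) ∂P = ∫ w, r (covZ w) * k (covZ w) ∂P)
    {z : Fin l → ℝ}
    (hz : IsLebesguePoint (fun x => (Icc (zPart a) (zPart b)).indicator fZ x * r x) z)
    (htail : TailSmall (P.map observe) z) :
    ConvProb (P.map observe)
      (fun n v => (∑ i, rescale K (h n) z (obsZ (v i)) * T (v i)) / n)
      ((Icc (zPart a) (zPart b)).indicator fZ z * r z) := by
  obtain ⟨fS, hQ⟩ := hP.exists_observedLaw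
  have : IsProbabilityMeasure (P.map (observe : Subject l q → Obs l q)) :=
    Measure.isProbabilityMeasure_map measurable_observe.aemeasurable
  obtain ⟨C, hC, hν⟩ := hQ.moment_Z
  obtain ⟨B', hB'⟩ := hP.exists_ae_abs_density_mul_le hr hrm
  refine convProb_kernel_average hC hν hK.measurable hK.order.integrable hK.sq_integrable
    hK.order.2.1 hh.h_pos hh.h_zero hh.nh_top hT hB0 ?_
    (hP.density_Z.measurable_indicator.mul hrm) hB' ?_ hz htail
  · filter_upwards [hQ.ae_mem] with o ho using hTB o ho
  · intro k hk hki
    have hkZ : Integrable (fun w => k (covZ w)) P :=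
      (hP.density_Z.integrable_map hki).comp_measurable measurable_covZ
    have hrk : AEStronglyMeasurable (fun x => r x * k x) (P.map covZ) :=
      (hrm.mul hk).aestronglyMeasurable
    have hTk : AEStronglyMeasurable (fun o : Obs l q => T o * k (obsZ o)) (P.map observe) :=
      (hT.mul (hk.comp measurable_obsZ)).aestronglyMeasurable
    rw [integral_map measurable_observe.aemeasurable hTk]
    refine (hTr k hk hkZ).trans ?_
    rw [← integral_map (f := fun x => r x * k x) measurable_covZ.aemeasurable hrk,
      hP.density_Z.integral_map_eq]
    exact integral_congr_ae (Eventually.of_forall fun x => (mul_assoc _ _ _).symm)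

lemma inv_mul_kerWeight_eq (K : (Fin l → ℝ) → ℝ) (h : ℝ) (z : Fin l → ℝ) (o : Obs l q) :
    (h ^ l)⁻¹ * kerWeight K h z o = rescale K h z (obsZ o) := by
  rw [rescale, Fintype.card_fin]; rfl

lemma fHat_eq {n : ℕ} (h : ℝ) (z : Fin l → ℝ) (v : Fin n → Obs l q) :
    fHat K h z v = (∑ i, rescale K h z (obsZ (v i)) * 1) / n := by
  simp_rw [fHat, inv_mul_kerWeight_eq, mul_one]

lemma tauHat_eq {n : ℕ} (h η : ℝ) (z : Fin l → ℝ) (v : Fin n → Obs l q) :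
    tauHat K L h η z v = ((∑ i, rescale K h z (obsZ (v i)) * psiHat L η v i) / n) /
      ((∑ i, rescale K h z (obsZ (v i)) * 1) / n) := by
  simp_rw [tauHat, inv_mul_kerWeight_eq, mul_one, mul_comm (psiHat L η v _)]
  rcases Nat.eq_zero_or_pos n with rfl | hn
  · simp
  · have : (n : ℝ) ≠ 0 := by exact_mod_cast hn.ne'
    rw [div_div_div_cancel_right₀ this]

/-- An algebraic identity in `t`, so it applies with `t` the random centre `τ̂(z)`. It reduces `σ̂²`
to averages of powers zero, one and two of the score. -/
lemma weighted_deviation_eq {n : ℕ} (h t F : ℝ) (z : Fin l → ℝ) (v : Fin n → Obs l q)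
    (x : Fin n → ℝ) :
    1 / (n * h ^ l) * ∑ i, (x i - t) ^ 2 * kerWeight K h z (v i) / F =
      ((∑ i, rescale K h z (obsZ (v i)) * x i ^ 2) / n -
        2 * t * ((∑ i, rescale K h z (obsZ (v i)) * x i) / n) +
          t ^ 2 * ((∑ i, rescale K h z (obsZ (v i)) * 1) / n)) / F := by
  have e : ∀ i, (x i - t) ^ 2 * kerWeight K h z (v i) / F * (h ^ l)⁻¹ =
      (rescale K h z (obsZ (v i)) * x i ^ 2 - 2 * t * (rescale K h z (obsZ (v i)) * x i) +
        t ^ 2 * (rescale K h z (obsZ (v i)) * 1)) / F := by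
    intro i
    rw [← inv_mul_kerWeight_eq]; ring
  rw [one_div, mul_inv, mul_assoc, mul_comm ((h ^ l)⁻¹), Finset.sum_mul]
  simp_rw [e]
  rw [← Finset.sum_div, Finset.sum_add_distrib, Finset.sum_sub_distrib, ← Finset.mul_sum,
    ← Finset.mul_sum]
  ring

/-- The limit of the variance estimator, from the limits of its building blocks. -/
lemma convProb_variance {Q : Measure (Obs l q)} {A0 A1 A2 : ∀ n : ℕ, (Fin n → Obs l q) → ℝ}
    {f τ σ κ : ℝ} (hf : f ≠ 0) (h0 : ConvProb Q A0 f) (h1 : ConvProb Q A1 (f * τ))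
    (h2 : ConvProb Q A2 (f * (σ + τ ^ 2))) {B1 : ∀ n : ℕ, (Fin n → Obs l q) → ℝ}
    (hB1 : ConvProb Q B1 (f * τ)) :
    ConvProb Q (fun n v => κ * ((A2 n v - 2 * (A1 n v / A0 n v) * B1 n v +
      (A1 n v / A0 n v) ^ 2 * A0 n v) / A0 n v) / A0 n v) (κ * σ / f) := by
  -- Two first-moment averages enter: `A1` gives the centre `A1 / A0`, always built from `ψ̂`, while
  -- `B1` belongs to the score whose variance is estimated. They share a limit because both scores
  -- have conditional mean `τ`.
  have hc : ContinuousAt (fun x : (ℝ × ℝ) × (ℝ × ℝ) =>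
      κ * ((x.1.1 - 2 * (x.1.2 / x.2.1) * x.2.2 + (x.1.2 / x.2.1) ^ 2 * x.2.1) / x.2.1) / x.2.1)
      ((f * (σ + τ ^ 2), f * τ), (f, f * τ)) := by
    fun_prop (disch := exact hf)
  have := ((h2.prodMk h1).prodMk (h0.prodMk hB1)).map hc
  have e : κ * ((f * (σ + τ ^ 2) - 2 * (f * τ / f) * (f * τ) + (f * τ / f) ^ 2 * f) / f) / f =
      κ * σ / f := by
    field_simp
    ring
  simpa only [e] using this

lemma Population.exists_ae_second_moment_le (hP : Population P a b s fX fZ S p m)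
    {τ σ : (Fin l → ℝ) → ℝ} (hτ : IsCATE P τ) {g : Bool → (S → ℝ) → ℝ} {M : ℝ}
    (hM : ∀ j, ∀ x ∈ Icc (subPart S a) (subPart S b), |g j x| ≤ M)
    (hσ : IsCondMean P (fun w => (score S p g (observe w) - τ (covZ w)) ^ 2) covZ σ) :
    ∃ B : ℝ, ∀ᵐ w ∂P, |σ (covZ w) + τ (covZ w) ^ 2| ≤ B := by
  obtain ⟨D, hD⟩ := hP.exists_ae_cate_le hτ
  obtain ⟨C, hC, hdev⟩ := hP.ae_deviation_le hM hτ
  obtain ⟨B, hB⟩ := hP.ae_abs_le hdev hσ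
  refine ⟨B + D ^ 2, ?_⟩
  filter_upwards [hB, hD] with w h1 h2
  refine (abs_add_le _ _).trans (add_le_add h1 ?_)
  rw [abs_pow]
  exact pow_le_pow_left₀ (abs_nonneg _) h2 2

lemma score_zero_observe (w : Subject l q) : score S p (fun _ _ => 0) (observe w) =
    psi (p (covS S w)) (treat w) (outcome w) := by
  simp [score, psi, psiStar, observe, covS, covX]

lemma IsSigmaSq.isCondMean_score {P : Measure (Subject l q)} {τ σ2 : (Fin l → ℝ) → ℝ}
    (hσ : IsSigmaSq P S p τ σ2) :
    IsCondMean P (fun w => (score S p (fun _ _ => 0) (observe w) - τ (covZ w)) ^ 2) covZ σ2 := by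
  simp_rw [score_zero_observe]
  exact hσ

lemma Population.exists_ae_limits_le (hP : Population P a b s fX fZ S p m)
    {τ σ2 σs2 : (Fin l → ℝ) → ℝ} (hτ : IsCATE P τ) (hσ : IsSigmaSq P S p τ σ2)
    (hσs : IsSigmaStarSq P S p m τ σs2) : (∃ B : ℝ, ∀ᵐ w ∂P, |τ (covZ w)| ≤ B) ∧
      (∃ B : ℝ, ∀ᵐ w ∂P, |σ2 (covZ w) + τ (covZ w) ^ 2| ≤ B) ∧
      ∃ B : ℝ, ∀ᵐ w ∂P, |σs2 (covZ w) + τ (covZ w) ^ 2| ≤ B := by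
  obtain ⟨fS, hQ⟩ := hP.exists_observedLaw
  obtain ⟨M, hM0, hM⟩ := hQ.exists_regression_bound
  exact ⟨hP.exists_ae_cate_le hτ,
    hP.exists_ae_second_moment_le hτ (M := 0) (fun _ _ _ => by simp) hσ.isCondMean_score,
    hP.exists_ae_second_moment_le hτ hM hσs⟩

/-- Kernel averages of the first two powers of an estimated score. -/
lemma Population.convProb_score (hP : Population P a b s fX fZ S p m)
    {τ σ : (Fin l → ℝ) → ℝ} (hτ : IsCATE P τ) (hK : SmoothingKernel s K)
    (hh : Bandwidths l S.card s s₁ h h₁) {g : Bool → (S → ℝ) → ℝ} {M : ℝ}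
    (hg : ∀ j, Measurable (g j)) (hM : ∀ j, ∀ x ∈ Icc (subPart S a) (subPart S b), |g j x| ≤ M)
    (hσ : IsCondMean P (fun w => (score S p g (observe w) - τ (covZ w)) ^ 2) covZ σ)
    {z : Fin l → ℝ}
    (z1 : IsLebesguePoint (fun x => (Icc (zPart a) (zPart b)).indicator fZ x * τ x) z)
    (z2 : IsLebesguePoint
      (fun x => (Icc (zPart a) (zPart b)).indicator fZ x * (σ x + τ x ^ 2)) z)
    (htail : TailSmall (P.map observe) z) {est E : ∀ n : ℕ, (Fin n → Obs l q) → Fin n → ℝ}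
    (hE : ConvProb (P.map observe)
      (fun n v => (∑ i, |rescale K (h n) z (obsZ (v i))| * E n v i) / n) 0)
    (hest : ∀ n v i, (est n v i - score S p g (v i)) ^ 2 ≤ E n v i) :
    ConvProb (P.map observe)
      (fun n v => (∑ i, rescale K (h n) z (obsZ (v i)) * est n v i) / n)
      ((Icc (zPart a) (zPart b)).indicator fZ z * τ z) ∧
    ConvProb (P.map observe)
      (fun n v => (∑ i, rescale K (h n) z (obsZ (v i)) * est n v i ^ 2) / n)
      ((Icc (zPart a) (zPart b)).indicator fZ z * (σ z + τ z ^ 2)) := by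
  obtain ⟨fS, hQ⟩ := hP.exists_observedLaw
  have : IsProbabilityMeasure (P.map (observe : Subject l q → Obs l q)) :=
    Measure.isProbabilityMeasure_map measurable_observe.aemeasurable
  obtain ⟨D, hD⟩ := hP.exists_ae_cate_le hτ
  have hbd := hP.exists_ae_second_moment_le hτ hM hσ
  obtain ⟨C, hC, hs⟩ := exists_abs_score_le (l := l) (q := q) hP.overlap hM
  have hsm := measurable_score hP.propensity.1 hg
  have a1 := hP.convProb_average hK hh hsm hC.le (fun o ho => (hs o ho).1) hτ.1 ⟨D, hD⟩
    (fun k hk hi => hP.integral_score_mul hg hM hτ hk hi) z1 htail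
  have a2 := hP.convProb_average hK hh (T := fun o => score S p g o ^ 2) (hsm.pow_const 2) hC.le
    (fun o ho => by rw [abs_of_nonneg (sq_nonneg _)]; exact (hs o ho).2)
    (r := fun x => σ x + τ x ^ 2) (hσ.1.add (hτ.1.pow_const 2)) hbd
    (fun k hk hi => hP.integral_score_sq_mul hg hM hτ hσ hk hi) z2 htail
  refine ⟨hQ.convProb_plugIn hK.measurable hK.order.integrable hh.h_pos a1 hE fun η hη => ?_,
    hQ.convProb_plugIn hK.measurable hK.order.integrable hh.h_pos
      (T := fun o => score S p g o ^ 2) (est := fun n v i => est n v i ^ 2) a2 hE fun η hη => ?_⟩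
  · exact ⟨1 / η, by positivity, fun n v _ i =>
      abs_sub_le_of_sq_le hη (one_le_obsW _) (hest n v i)⟩
  · refine ⟨1 + C / η, by positivity, fun n v hv i => ?_⟩
    exact abs_sq_sub_sq_le (y := score S p g (v i)) (x := est n v i) hη hC
      (hs (v i) (hv i)).2 (hest n v i)

/-- Both variance estimators are consistent at Lebesgue points of the limits of their building
blocks, under uniform integrability. -/
lemma Population.convProb_SigmaHat (hP : Population P a b s fX fZ S p m)
    {τ σ2 σs2 : (Fin l → ℝ) → ℝ} (hτ : IsCATE P τ) (hσ : IsSigmaSq P S p τ σ2)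
    (hσs : IsSigmaStarSq P S p m τ σs2) (hK : SmoothingKernel s K) (hL : PropensityKernel s₁ L)
    (hh : Bandwidths l S.card s s₁ h h₁) {z : Fin l → ℝ} (hz : z ∈ Icc (zPart a) (zPart b))
    (z0 : IsLebesguePoint (fun x => (Icc (zPart a) (zPart b)).indicator fZ x * 1) z)
    (z1 : IsLebesguePoint (fun x => (Icc (zPart a) (zPart b)).indicator fZ x * τ x) z)
    (z2 : IsLebesguePoint
      (fun x => (Icc (zPart a) (zPart b)).indicator fZ x * (σ2 x + τ x ^ 2)) z)
    (z3 : IsLebesguePoint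
      (fun x => (Icc (zPart a) (zPart b)).indicator fZ x * (σs2 x + τ x ^ 2)) z)
    (htail : TailSmall (P.map observe) z) :
    ConvProb (P.map observe) (fun n v => SigmaHat K L (h n) (h₁ n) z v) (asymVar K fZ σ2 z) ∧
    ConvProb (P.map observe) (fun n v => SigmaStarHat K L (h n) (h₁ n) z v)
      (asymVar K fZ σs2 z) := by
  obtain ⟨fS, hQ⟩ := hP.exists_observedLaw
  have : IsProbabilityMeasure (P.map (observe : Subject l q → Obs l q)) :=
    Measure.isProbabilityMeasure_map measurable_observe.aemeasurable
  obtain ⟨M, hM0, hM⟩ := hQ.exists_regression_bound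
  have hm : ∀ j, Measurable (m j) := fun j => (hP.regression j).1
  have hzero : ∀ j : Bool, Measurable ((fun _ _ => 0 : Bool → (S → ℝ) → ℝ) j) :=
    fun _ => measurable_const
  have hM' : ∀ j : Bool, ∀ x ∈ Icc (subPart S a) (subPart S b),
      |(fun _ _ => 0 : Bool → (S → ℝ) → ℝ) j x| ≤ M := fun _ _ _ => by simpa using hM0
  have hσ' := hσ.isCondMean_score
  have hσs' : IsCondMean P (fun w => (score S p m (observe w) - τ (covZ w)) ^ 2) covZ σs2 := hσs
  have a0 := hP.convProb_average hK hh (T := fun _ => 1) measurable_const zero_le_one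
    (fun o _ => by simpa using one_le_obsW o) (r := fun _ => 1) measurable_const
    ⟨1, Eventually.of_forall fun _ => by simp⟩ (fun _ _ _ => rfl) z0 htail
  -- The sum of the two squared errors dominates each of them, so one vanishing statement serves
  -- both scores.
  have herr := hQ.convProb_weighted_score_error hL hh hK.measurable hK.order.integrable z
  obtain ⟨b1, b2⟩ := hP.convProb_score hτ hK hh hzero hM' hσ' z1 z2 htail
    (est := fun n v i => psiHat L (h₁ n) v i) herr
    fun n v i => le_add_of_nonneg_right (sq_nonneg _)
  obtain ⟨b1s, b3⟩ := hP.convProb_score hτ hK hh hm hM hσs' z1 z3 htail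
    (est := fun n v i => psiStarHat L (h₁ n) v i) herr
    fun n v i => le_add_of_nonneg_left (sq_nonneg _)
  rw [indicator_of_mem hz, mul_one] at a0
  rw [indicator_of_mem hz] at b1 b1s b2 b3
  have hf : fZ z ≠ 0 := by
    obtain ⟨c, C, hc, hb⟩ := hP.density_Z.bounds
    exact (hc.trans_le (hb z hz).1).ne'
  constructor
  · refine (convProb_variance (κ := kerNormSq K) hf a0 b1 b2 b1).congr fun n v => ?_
    rw [SigmaHat, sigmaSqHat, weighted_deviation_eq, tauHat_eq, fHat_eq]
  · refine (convProb_variance (κ := kerNormSq K) hf a0 b1 b3 b1s).congr fun n v => ?_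
    rw [SigmaStarHat, sigmaStarSqHat, weighted_deviation_eq, tauHat_eq, fHat_eq]

end VarianceLimit

/-! ### From product measures to samples. -/

section Transfer

variable {l q : ℕ} {P : Measure (Subject l q)}

/-- Convergence in probability for independent draws carries over to samples. -/
lemma ConvProb.tendstoInMeasure {Ω : Type*} [MeasurableSpace Ω] {μ : Measure Ω}
    [IsProbabilityMeasure μ] {w : ℕ → Ω → Obs l q} (hw : IsSample μ P w)
    {F : ∀ n : ℕ, (Fin n → Obs l q) → ℝ} {c : ℝ} (hF : ConvProb (P.map observe) F c) :
    TendstoInMeasure μ (fun (n : ℕ) ω => F n (fun i : Fin n => w i ω)) atTop (fun _ => c) := by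
  rw [tendstoInMeasure_iff_dist]
  intro ε hε
  refine tendsto_of_tendsto_of_tendsto_of_le_of_le tendsto_const_nhds (hF ε hε)
    (fun _ => zero_le) fun n => ?_
  have hm : Measurable fun ω => fun i : Fin n => w i ω :=
    measurable_pi_lambda _ fun i => hw.measurable i
  have hind : iIndepFun (fun i : Fin n => w i) μ := hw.indep.precomp Fin.val_injective
  have hlaw : μ.map (fun ω => fun i : Fin n => w i ω) =
      Measure.pi fun _ : Fin n => P.map observe := by
    rw [(iIndepFun_iff_map_fun_eq_pi_map (f := fun i : Fin n => w i)
      fun i : Fin n => (hw.measurable i).aemeasurable).1 hind]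
    congr 1
    funext i
    exact hw.law i
  rw [← hlaw]
  -- This inequality holds for arbitrary sets, so the statistics `F` need not be measurable.
  exact Measure.le_map_apply hm.aemeasurable {v | ε ≤ dist (F n v) c}

end Transfer

/-! ### Points at which the variance estimators are consistent. -/

section Points

variable {l q : ℕ} {P : Measure (Subject l q)} [IsProbabilityMeasure P]
  {a b : Cov l q} {s : ℕ} {fX : Cov l q → ℝ} {fZ : (Fin l → ℝ) → ℝ}
  {S : Finset (Fin (l + q))} {p : (S → ℝ) → ℝ} {m : Bool → (S → ℝ) → ℝ}

lemma Population.ae_isLebesguePoint_density_mul (hP : Population P a b s fX fZ S p m)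
    {r : (Fin l → ℝ) → ℝ} (hr : ∃ B : ℝ, ∀ᵐ w ∂P, |r (covZ w)| ≤ B) (hrm : Measurable r) :
    ∀ᵐ z, IsLebesguePoint (fun x => (Icc (zPart a) (zPart b)).indicator fZ x * r x) z := by
  obtain ⟨B, hB⟩ := hP.exists_ae_abs_density_mul_le hr hrm
  refine ae_isLebesguePoint (MemLp.locallyIntegrable (p := ⊤) ?_ le_top)
  exact memLp_top_of_bound (hP.density_Z.measurable_indicator.mul hrm).aestronglyMeasurable B hB

lemma tendsto_tailMeasure_univ {Q : Measure (Obs l q)} (hY : Integrable (fun o => o.2.2 ^ 2) Q) :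
    Tendsto (fun M : ℕ => tailMeasure Q M univ) atTop (𝓝 0) := by
  have h1 : ∀ M : ℕ, tailMeasure Q M univ = ∫⁻ o, ENNReal.ofReal
      ({o : Obs l q | (M : ℝ) < |o.2.2|}.indicator (fun o => o.2.2 ^ 2) o) ∂Q := fun M => by
    rw [tailMeasure, Measure.map_apply measurable_obsZ MeasurableSet.univ, preimage_univ,
      withDensity_apply _ MeasurableSet.univ, Measure.restrict_univ]
  simp_rw [h1]
  rw [← lintegral_zero (μ := Q)]
  refine tendsto_lintegral_of_dominated_convergence (fun o => ENNReal.ofReal (o.2.2 ^ 2))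
    (fun M => measurable_tail (M : ℝ)) (fun M => Eventually.of_forall fun o =>
      ENNReal.ofReal_le_ofReal (indicator_le_self' (fun _ _ => sq_nonneg _) _)) ?_
    (Eventually.of_forall fun o => ?_)
  · rw [← ofReal_integral_eq_lintegral_ofReal hY (Eventually.of_forall fun _ => sq_nonneg _)]
    exact ENNReal.ofReal_ne_top
  · refine tendsto_const_nhds.congr' ?_
    obtain ⟨N, hN⟩ := exists_nat_ge |o.2.2|
    filter_upwards [eventually_ge_atTop N] with M hM
    have hM' : (N : ℝ) ≤ M := by exact_mod_cast hM
    rw [indicator_of_notMem (by simpa using hN.trans hM'), ENNReal.ofReal_zero]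

/-- Integrability of `Y²` sends the total tail masses to zero, so `ae_small_density` applies.
Integer truncation levels keep the family countable. -/
lemma Population.ae_tailSmall (hP : Population P a b s fX fZ S p m) :
    ∀ᵐ z, TailSmall (P.map observe) z := by
  obtain ⟨fS, hQ⟩ := hP.exists_observedLaw
  have hfin := tendsto_tailMeasure_univ hQ.sq_integrable
  have : ∀ M : ℕ, IsFiniteMeasure (tailMeasure (P.map observe) (M : ℝ)) := fun M => by
    refine ⟨lt_of_le_of_lt (?_ : _ ≤ tailMeasure (P.map observe) ((0 : ℕ) : ℝ) univ) ?_⟩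
    · exact tailMeasure_anti (by simp) univ
    · rw [tailMeasure, Measure.map_apply measurable_obsZ MeasurableSet.univ, preimage_univ,
        withDensity_apply _ MeasurableSet.univ, Measure.restrict_univ]
      refine lt_of_le_of_lt (lintegral_mono fun o => ENNReal.ofReal_le_ofReal
        (indicator_le_self' (fun _ _ => sq_nonneg _) _)) ?_
      rw [← ofReal_integral_eq_lintegral_ofReal hQ.sq_integrable
        (Eventually.of_forall fun _ => sq_nonneg _)]
      exact ENNReal.ofReal_lt_top
  filter_upwards [ae_small_density hfin] with z hz ε hε
  obtain ⟨M, hM⟩ := hz ε hε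
  exact ⟨M, hM⟩

lemma Population.isLebesguePoint_density_mul (hP : Population P a b s fX fZ S p m)
    {r : (Fin l → ℝ) → ℝ} {z : Fin l → ℝ} (hz : z ∈ interior (Icc (zPart a) (zPart b)))
    (hr : ContinuousAt r z) :
    IsLebesguePoint (fun x => (Icc (zPart a) (zPart b)).indicator fZ x * r x) z := by
  refine isLebesguePoint_of_continuousAt (ContinuousAt.mul ?_ hr)
  have hmem := mem_interior_iff_mem_nhds.1 hz
  refine (hP.density_Z.continuousOn.continuousAt hmem).congr ?_
  filter_upwards [hmem] with x hx
  rw [indicator_of_mem hx]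

/-- The event that `Z` falls in the closed ball is measurable with respect to `Z`, so the tail may
be replaced by its conditional expectation; `t < r` keeps the closed ball inside the open one where
that is at most `ε`. -/
lemma setLIntegral_tail_le (hP : Population P a b s fX fZ S p m) {j : Bool} {ε M r : ℝ}
    (hε : 0 ≤ ε) {z : Fin l → ℝ} (h : ∀ᵐ w ∂P, covZ w ∈ Metric.ball z r →
      (P[{w | M < |potential j w|}.indicator (fun w => potential j w ^ 2) |
        MeasurableSpace.comap covZ inferInstance]) w ≤ ε) {t : ℝ} (ht : t < r) :
    ∫⁻ w in covZ ⁻¹' Metric.closedBall z t, ENNReal.ofReal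
      ({w | M < |potential j w|}.indicator (fun w => potential j w ^ 2) w) ∂P ≤
        ENNReal.ofReal ε * P.map covZ (Metric.closedBall z t) := by
  have hcb := (Metric.isClosed_closedBall (x := z) (ε := t)).measurableSet
  have hm : MeasurableSpace.comap (covZ : Subject l q → Fin l → ℝ) inferInstance ≤
      (inferInstance : MeasurableSpace (Subject l q)) := measurable_covZ.comap_le
  have hφ : Integrable ({w : Subject l q | M < |potential j w|}.indicator
      (fun w => potential j w ^ 2)) P :=
    (hP.sq_integrable j).indicator (measurableSet_lt measurable_const (measurable_potential j).abs)
  have hset : MeasurableSet[MeasurableSpace.comap (covZ : Subject l q → Fin l → ℝ) inferInstance]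
      (covZ ⁻¹' Metric.closedBall z t) := ⟨_, hcb, rfl⟩
  rw [← ofReal_integral_eq_lintegral_ofReal hφ.integrableOn (Eventually.of_forall fun w =>
    Set.indicator_nonneg (fun _ _ => sq_nonneg _) w), ← setIntegral_condExp hm hφ hset,
    Measure.map_apply measurable_covZ hcb]
  refine (ENNReal.ofReal_le_ofReal (setIntegral_mono_on_ae (g := fun _ => ε)
    integrable_condExp.integrableOn (integrable_const ε).integrableOn (measurable_covZ hcb)
      (h.mono fun w hw hmem => hw (Metric.closedBall_subset_ball ht hmem)))).trans ?_
  rw [setIntegral_const, smul_eq_mul, mul_comm, ENNReal.ofReal_mul hε, ofReal_measureReal]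

lemma Population.tailSmall (hP : Population P a b s fX fZ S p m) {z : Fin l → ℝ}
    (h : LocallyUniformlySqIntegrable P z) : TailSmall (P.map observe) z := by
  intro ε hε
  obtain ⟨C, hC, hf⟩ := hP.density_Z.exists_map_le
  let c := C.toReal + 1
  have hc : 0 < c := by positivity
  have hCc : C ≤ ENNReal.ofReal c := by
    conv_lhs => rw [← ENNReal.ofReal_toReal hC]
    exact ENNReal.ofReal_le_ofReal (by simp [c])
  -- Two arms, the density bound `c` and the volume `(2 * t) ^ card` of the ball together restore `ε
  -- * t ^ card`.
  let e := ε / (2 * c * 2 ^ Fintype.card (Fin l))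
  have he : 0 < e := by positivity
  obtain ⟨M₀, r₀, hr₀, h0⟩ := h false e he
  obtain ⟨M₁, r₁, hr₁, h1⟩ := h true e he
  refine ⟨max M₀ M₁, ?_⟩
  filter_upwards [Ioo_mem_nhdsGT (lt_min hr₀ hr₁)] with t ht
  have hcb := (Metric.isClosed_closedBall (x := z) (ε := t)).measurableSet
  have hball : P.map covZ (Metric.closedBall z t) ≤
      ENNReal.ofReal (c * (2 * t) ^ Fintype.card (Fin l)) := by
    refine (hf _).trans ?_
    rw [Measure.smul_apply, smul_eq_mul, volume_closedBall_eq z ht.1.le,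
      ENNReal.ofReal_mul hc.le]
    gcongr
  have i0 := setLIntegral_tail_le hP he.le h0 (ht.2.trans_le (min_le_left _ _))
  have i1 := setLIntegral_tail_le hP he.le h1 (ht.2.trans_le (min_le_right _ _))
  have hm0 : Measurable fun w : Subject l q => ENNReal.ofReal
      ({w | M₀ < |potential false w|}.indicator (fun w => potential false w ^ 2) w) :=
    (((measurable_potential false).pow_const 2).indicator
      (measurableSet_lt measurable_const (measurable_potential false).abs)).ennreal_ofReal
  calc tailMeasure (P.map observe) (max M₀ M₁) (Metric.closedBall z t)
      = ∫⁻ w in covZ ⁻¹' Metric.closedBall z t, ENNReal.ofReal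
          ({o : Obs l q | max M₀ M₁ < |o.2.2|}.indicator (fun o => o.2.2 ^ 2) (observe w)) ∂P := by
        rw [tailMeasure, Measure.map_apply measurable_obsZ hcb,
          withDensity_apply _ (measurable_obsZ hcb),
          setLIntegral_map (measurable_obsZ hcb) (measurable_tail _) measurable_observe]
        rfl
    _ ≤ ∫⁻ w in covZ ⁻¹' Metric.closedBall z t, (ENNReal.ofReal
          ({w | M₀ < |potential false w|}.indicator (fun w => potential false w ^ 2) w) +
          ENNReal.ofReal
          ({w | M₁ < |potential true w|}.indicator (fun w => potential true w ^ 2) w)) ∂P := by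
        refine lintegral_mono fun w => ?_
        -- The observed outcome is one of the potential outcomes, and a value beyond both thresholds
        -- is beyond its own.
        by_cases hw : max M₀ M₁ < |outcome w|
        · rw [indicator_of_mem (by exact hw)]
          cases hd : treat w
          · have e1 : outcome w = potential false w := by rw [outcome, hd]
            rw [e1] at hw
            have : w ∈ {w : Subject l q | M₀ < |potential false w|} :=
              (le_max_left _ _).trans_lt hw
            rw [indicator_of_mem this]
            exact le_add_of_le_left (le_of_eq (by rw [← e1]; rfl))
          · have e1 : outcome w = potential true w := by rw [outcome, hd]
            rw [e1] at hw
            have : w ∈ {w : Subject l q | M₁ < |potential true w|} :=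
              (le_max_right _ _).trans_lt hw
            rw [indicator_of_mem (s := {w : Subject l q | M₁ < |potential true w|}) this]
            exact le_add_of_le_right (le_of_eq (by rw [← e1]; rfl))
        · rw [indicator_of_notMem (by exact hw), ENNReal.ofReal_zero]
          exact zero_le
    _ ≤ ENNReal.ofReal e * ENNReal.ofReal (c * (2 * t) ^ Fintype.card (Fin l)) +
        ENNReal.ofReal e * ENNReal.ofReal (c * (2 * t) ^ Fintype.card (Fin l)) := by
        rw [lintegral_add_left hm0]
        exact add_le_add (i0.trans (mul_le_mul_right hball _))
          (i1.trans (mul_le_mul_right hball _))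
    _ = ENNReal.ofReal (ε * t ^ Fintype.card (Fin l)) := by
        have ht0 := ht.1
        rw [← ENNReal.ofReal_mul he.le, ← ENNReal.ofReal_add (by positivity) (by positivity)]
        congr 1
        simp only [e]
        rw [mul_pow]
        field_simp
        norm_num

end Points

end IPW

theorem theorem4 {l q : ℕ} {Ω : Type*} [MeasurableSpace Ω] (μ : Measure Ω)
    [IsProbabilityMeasure μ] (P : Measure (IPW.Subject l q)) [IsProbabilityMeasure P]
    (a b : IPW.Cov l q) (s s₁ : ℕ) (fX : IPW.Cov l q → ℝ) (fZ : (Fin l → ℝ) → ℝ)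
    (S : Finset (Fin (l + q))) (p : (S → ℝ) → ℝ) (m : Bool → (S → ℝ) → ℝ)
    (hP : IPW.Population P a b s fX fZ S p m)
    (τ σ2 σs2 : (Fin l → ℝ) → ℝ) (hτ : IPW.IsCATE P τ) (hσ : IPW.IsSigmaSq P S p τ σ2)
    (hσs : IPW.IsSigmaStarSq P S p m τ σs2)
    (K : (Fin l → ℝ) → ℝ) (hK : IPW.SmoothingKernel s K)
    (L : (S → ℝ) → ℝ) (hL : IPW.PropensityKernel s₁ L)
    (h h₁ : ℕ → ℝ) (hh : IPW.Bandwidths l S.card s s₁ h h₁)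
    (w : ℕ → Ω → IPW.Obs l q) (hw : IPW.IsSample μ P w) :
    (∀ᵐ z ∂(P.map IPW.covZ), IPW.VarianceConsistentAt μ w K L h h₁ fZ σ2 σs2 z) ∧
    (∀ z ∈ interior (Icc (IPW.zPart a) (IPW.zPart b)),
      ContinuousAt τ z → ContinuousAt σ2 z → ContinuousAt σs2 z →
      IPW.LocallyUniformlySqIntegrable P z →
      IPW.VarianceConsistentAt μ w K L h h₁ fZ σ2 σs2 z) := by
  constructor
  · obtain ⟨⟨B, hB⟩, ⟨B₁, hB₁⟩, B₂, hB₂⟩ := hP.exists_ae_limits_le hτ hσ hσs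
    -- The exceptional sets are Lebesgue null, hence null for the law of `Z`.
    have hac := hP.density_Z.map_absolutelyContinuous
    filter_upwards [hP.density_Z.ae_mem,
      hac.ae_le (hP.ae_isLebesguePoint_density_mul (r := fun _ => 1)
        ⟨1, Eventually.of_forall fun _ => by simp⟩ measurable_const),
      hac.ae_le (hP.ae_isLebesguePoint_density_mul ⟨B, hB⟩ hτ.1),
      hac.ae_le (hP.ae_isLebesguePoint_density_mul (r := fun x => σ2 x + τ x ^ 2) ⟨B₁, hB₁⟩
        (hσ.1.add (hτ.1.pow_const 2))),
      hac.ae_le (hP.ae_isLebesguePoint_density_mul (r := fun x => σs2 x + τ x ^ 2) ⟨B₂, hB₂⟩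
        (hσs.1.add (hτ.1.pow_const 2))),
      hac.ae_le hP.ae_tailSmall] with z hz z0 z1 z2 z3 ht
    have := hP.convProb_SigmaHat hτ hσ hσs hK hL hh hz z0 z1 z2 z3 ht
    exact ⟨this.1.tendstoInMeasure hw, this.2.tendstoInMeasure hw⟩
  · intro z hz hcτ hcσ hcσs ht
    have := hP.convProb_SigmaHat hτ hσ hσs hK hL hh (interior_subset hz)
      (hP.isLebesguePoint_density_mul hz continuousAt_const)
      (hP.isLebesguePoint_density_mul hz hcτ)
      (hP.isLebesguePoint_density_mul hz (hcσ.add (hcτ.pow 2)))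
      (hP.isLebesguePoint_density_mul hz (hcσs.add (hcτ.pow 2))) (hP.tailSmall ht)
    exact ⟨this.1.tendstoInMeasure hw, this.2.tendstoInMeasure hw⟩
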